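/- **Setting.** Let $p,p',n'\ge 1$, $\alpha\ge 2$ and $1\le s\le p'$ be integers. Let $(\mathbf X,\mathbf Z)\in\mathbb R^2\times\mathbb R^p$ have a joint density $f_{\mathbf X,\mathbf Z}$, put $f_{\mathbf Z}(\mathbf z)=\int f_{\mathbf X,\mathbf Z}(\mathbf x,\mathbf z)\,d\mathbf x$, and let $\mathcal Z\subset\mathbb R^p$ be compact. The conditional Kendall's tau at $\mathbf z\in\mathcal Z$ is $$\tau(\mathbf z)=\mathbb P\big((X_{1,1}-X_{2,1})(X_{1,2}-X_{2,2})>0\mid \mathbf Z_1=\mathbf Z_2=\mathbf z\big)-\mathbb P\big((X_{1,1}-X_{2,1})(X_{1,2}-X_{2,2})<0\mid \mathbf Z_1=\mathbf Z_2=\mathbf z\big),$$ where, conditionally, $\mathbf X_1,\mathbf X_2$ are independent with density $f_{\mathbf X,\mathbf Z}(\cdot,\mathbf z)/f_{\mathbf Z}(\mathbf z)$. *Estimator.* Given an i.i.d. sample $(\mathbf X_i,\mathbf Z_i)_{i\le n}$ with density $f_{\mathbf X,\mathbf Z}$, a kernel $K$ and a bandwidth $h>0$, let $K_h(\mathbf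 u)=h^{-p}K(\mathbf u/h)$, $w_{i}(\mathbf z)=K_h(\mathbf Z_i-\mathbf z)/\sum_jK_h(\mathbf Z_j-\mathbf z)$ and $\hat\tau(\mathbf z)=\sum_{i,j}w_i(\mathbf z)w_j(\mathbf z)g^*(\mathbf X_i,\mathbf X_j)$, where $g^*(\mathbf x,\mathbf y)$ is one of $4\cdot 1\{x_1<y_1,x_2<y_2\}-1$, $\;1\{(x_1-y_1)(x_2-y_2)>0\}-1\{(x_1-y_1)(x_2-y_2)<0\}$, $\;1-4\cdot 1\{x_1<y_1,x_2>y_2\}$. For fixed points $\mathbf z'_1,\dots,\mathbf z'_{n'}\in\mathcal Z$ and functions $\boldsymbol\psi=(\psi_1,\dots,\psi_{p'})$, let $\mathbb Z'$ be the $n'\times p'$ matrix with rows $\boldsymbol\psi(\mathbf z'_i)^T$, let $\|\mathbf v\|_{n'}=|\mathbf v|_2/\sqrt{n'}$, and let $\hat\beta$ be a (measurable) minimizer over $\beta\in\mathbb R^{p'}$ of $\frac1{n'}\sum_{i=1}^{n'}\big(\Lambda(\hat\tau(\mathbf z'_i))-\boldsymbol\psi(\mathbf z'_i)^T\beta\big)^2+\lambda|\beta|_1$.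 *Assumptions.* 1. $K$ is bounded, symmetric and integrable, $C_K=\|K\|_\infty$, $\int K=1$, and for $1\le j<\alpha$ all moments $\int K(\mathbf u)u_{i_1}\cdots u_{i_j}\,d\mathbf u$ exist and vanish. 2. $f_{\mathbf Z}$ is $\alpha$ times continuously differentiable and there is $C_{K,\alpha}>0$ such that for all $\mathbf z\in\mathcal Z$, $\int|K|(\mathbf u)\sum_{i_1,\dots,i_\alpha}|u_{i_1}\cdots u_{i_\alpha}|\sup_{r\in[0,1]}\big|\frac{\partial^\alpha f_{\mathbf Z}}{\partial z_{i_1}\cdots\partial z_{i_\alpha}}(\mathbf z+r\mathbf u)\big|d\mathbf u\le C_{K,\alpha}$. 3. There are constants $f_{\min},f_{\max}>0$ with $f_{\mathbf Z}\ge f_{\min}$ on $\mathcal Z$ and $f_{\mathbf Z}\le f_{\max}$ on $\mathbb R^p$. 4. For almost every $\mathbf x$, $\mathbf z\mapsto f_{\mathbf X,\mathbf Z}(\mathbf x,\mathbf z)$ is $\alpha$ times differentiable on $\mathbb R^p$, and there is $C_{\mathbf X\mathbf Z,\alpha}>0$ such that for all $\mathbf z\in\mathcal Z$ the function $$|K|(\mathbf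 u)|K|(\mathbf v)\sum_{k=0}^\alpha\binom\alpha k\sum_{i_1,\dots,i_\alpha}\sup_{r\in[0,1]}\Big|\tfrac{\partial^kf_{\mathbf X,\mathbf Z}}{\partial z_{i_1}\cdots\partial z_{i_k}}(\mathbf x_1,\mathbf z+r\mathbf u)\tfrac{\partial^{\alpha-k}f_{\mathbf X,\mathbf Z}}{\partial z_{i_{k+1}}\cdots\partial z_{i_\alpha}}(\mathbf x_2,\mathbf z+r\mathbf v)\Big|\,|u_{i_1}\cdots u_{i_k}v_{i_{k+1}}\cdots v_{i_\alpha}|$$ is measurable in $(\mathbf u,\mathbf v,\mathbf x_1,\mathbf x_2)$ with integral at most $C_{\mathbf X\mathbf Z,\alpha}$. 5. $|\psi_j|\le C_\psi$ on $\mathcal Z$ for all $j$, with $C_\psi>0$. The function $\Lambda$ is continuously differentiable with $|\Lambda'|\le C_{\Lambda'}$, $C_{\Lambda'}>0$, on an open set $U\subset\mathbb R$ that contains $\tau(\mathcal Z)$ ($\Lambda$ being extended to $\mathbb R$ in any way). 6. $\Lambda(\tau(\mathbf z))=\boldsymbol\psi(\mathbf z)^T\beta^*$ for all $\mathbf z\in\mathcal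 Z$, where $\beta^*\in\mathbb R^{p'}$ has at most $s$ non-zero components. 7. (Restricted eigenvalue condition) $$\kappa:=\min\Big\{\frac{|\mathbb Z'\delta|_2}{\sqrt{n'}\,|\delta|_2}:\ \delta\ne0,\ |\delta_{J^c}|_1\le3|\delta_J|_1\text{ for some }J\subset\{1,\dots,p'\},\ |J|\le s\Big\}>0.$$ *Constants.* $$C_1=\frac{f_{\min}^2}{32f_{\max}\int K^2+(8/3)C_Kf_{\min}},\qquad C_2=\frac{\{16C_\psi C_{\Lambda'}(f_{\min}^2+8f_{\max}^2)f_{\max}\int K^2\}^2}{f_{\min}^8},$$ $$C_3=\frac{(64/3)C_\psi C_{\Lambda'}C_K^2(f_{\min}^2+8f_{\max}^2)}{f_{\min}^4},\qquad c_h=\Big(\frac{f_{\min}^4\,\alpha!}{2C_\psi C_{\Lambda'}(f_{\min}^2+16f_{\max}^2)C_{\mathbf X\mathbf Z,\alpha}}\Big)^{1/\alpha}.$$ **Corollary.** Let $0<\epsilon<1$, $\lambda=4t$, $t=(n-1)^{-\alpha(1-\epsilon)/(2\alpha+2p)}$ and $h=c_h(n-1)^{-1/(2\alpha+2p)}$.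 Let $n\ge2$ be so large that $$h^\alpha\le\min\Big(\frac{f_{\min}\,\alpha!}{4C_{K,\alpha}},\ \frac{f_{\min}^4\,\alpha!\,t}{8C_\psi C_{\Lambda'}(f_{\min}^2+8f_{\max}^2)C_{\mathbf X\mathbf Z,\alpha}}\Big),\qquad h\le1,\qquad \Big[\tau(\mathbf z'_i)\pm\frac{t}{C_\psi C_{\Lambda'}}\Big]\subset U\ \ (1\le i\le n').$$ Then $$\mathbb P\Big(\|\mathbb Z'(\hat\beta-\beta^*)\|_{n'}\le\frac{20\sqrt s}{\kappa(n-1)^{\alpha(1-\epsilon)/(2\alpha+2p)}}\ \text{ and }\ |\hat\beta-\beta^*|_q\le\frac{5\cdot4^{2/q}s^{1/q}}{\kappa^2(n-1)^{\alpha(1-\epsilon)/(2\alpha+2p)}}\ \text{ for every }1\le q\le2\Big)$$ $$\ge1-2n'\exp\Big(-C_1c_h^p(n-1)^{(2\alpha+p)/(2\alpha+2p)}\Big)-2n'\exp\Big(-\frac{c_h^{2p}(n-1)^{2\alpha\epsilon/(2p+2\alpha)}}{C_2+C_3(n-1)^{-\alpha(1-\epsilon)/(2\alpha+2p)}}\Big).$$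 Moreover, the conditions on $n$ hold for all sufficiently large $n$, and the right-hand side tends to $1$ as $n\to\infty$. -/

import Mathlib

open MeasureTheory ProbabilityTheory Filter Topology
open scoped ENNReal Nat

namespace CondKendall

noncomputable section

/-! ### Densities and conditional Kendall's tau -/

/-- The covariate space `ℝ^p`. -/
abbrev Cov (p : ℕ) : Type := EuclideanSpace ℝ (Fin p)

/-- The density `f_Z(z) = ∫ f_{X,Z}(x, z) dx` of the covariate. -/
def marginal {p : ℕ} (f : ℝ × ℝ → Cov p → ℝ) (z : Cov p) : ℝ := ∫ x, f x z

/-- The conditional law of `X` given `Z = z`, with density `f_{X,Z}(·, z) / f_Z(z)`. -/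
def condLaw {p : ℕ} (f : ℝ × ℝ → Cov p → ℝ) (z : Cov p) : Measure (ℝ × ℝ) :=
  volume.withDensity fun x => ENNReal.ofReal (f x z / marginal f z)

/-- Conditional Kendall's tau: probability of concordance minus probability of discordance for
two independent draws from the conditional law of `X` given `Z = z`. -/
def tau {p : ℕ} (f : ℝ × ℝ → Cov p → ℝ) (z : Cov p) : ℝ :=
  ((condLaw f z).prod (condLaw f z)).real
      {x : (ℝ × ℝ) × (ℝ × ℝ) | 0 < (x.1.1 - x.2.1) * (x.1.2 - x.2.2)} -
    ((condLaw f z).prod (condLaw f z)).real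
      {x : (ℝ × ℝ) × (ℝ × ℝ) | (x.1.1 - x.2.1) * (x.1.2 - x.2.2) < 0}

/-! ### The kernel estimator of conditional Kendall's tau -/

open Classical in
/-- `g₁(x, y) = 4 · 1{x₁ < y₁, x₂ < y₂} - 1`. -/
def g₁ (x y : ℝ × ℝ) : ℝ := 4 * (if x.1 < y.1 ∧ x.2 < y.2 then 1 else 0) - 1

open Classical in
/-- `g₂(x, y) = 1{(x₁ - y₁)(x₂ - y₂) > 0} - 1{(x₁ - y₁)(x₂ - y₂) < 0}`. -/
def g₂ (x y : ℝ × ℝ) : ℝ :=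
  (if 0 < (x.1 - y.1) * (x.2 - y.2) then 1 else 0) -
    (if (x.1 - y.1) * (x.2 - y.2) < 0 then 1 else 0)

open Classical in
/-- `g₃(x, y) = 1 - 4 · 1{x₁ < y₁, x₂ > y₂}`. -/
def g₃ (x y : ℝ × ℝ) : ℝ := 1 - 4 * (if x.1 < y.1 ∧ y.2 < x.2 then 1 else 0)

/-- The rescaled kernel `K_h(u) = h^{-p} K(u / h)`. -/
def scaledKernel {p : ℕ} (K : Cov p → ℝ) (h : ℝ) (u : Cov p) : ℝ := (h ^ p)⁻¹ * K (h⁻¹ • u)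

/-- The weights `w_{i,n}(z) = K_h(Z_i - z) / ∑_j K_h(Z_j - z)`. -/
def weight {p n : ℕ} (K : Cov p → ℝ) (h : ℝ) (Z : Fin n → Cov p) (z : Cov p) (i : Fin n) : ℝ :=
  scaledKernel K h (Z i - z) / ∑ j, scaledKernel K h (Z j - z)

/-- The estimator `∑_i ∑_j w_{i,n}(z) w_{j,n}(z) g(X_i, X_j)`. -/
def tauHat {p n : ℕ} (g : ℝ × ℝ → ℝ × ℝ → ℝ) (K : Cov p → ℝ) (h : ℝ)
    (X : Fin n → ℝ × ℝ) (Z : Fin n → Cov p) (z : Cov p) : ℝ :=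
  ∑ i, ∑ j, weight K h Z z i * weight K h Z z j * g (X i) (X j)

/-! ### Norms, the Lasso criterion, restricted eigenvalues -/

/-- The `ℓ_q` norm, `1 ≤ q < ∞`. -/
def lqNorm {m : ℕ} (q : ℝ) (v : Fin m → ℝ) : ℝ := (∑ j, |v j| ^ q) ^ (1 / q)

/-- The `ℓ₂` norm. -/
def l2Norm {m : ℕ} (v : Fin m → ℝ) : ℝ := √(∑ j, v j ^ 2)

/-- The empirical norm `|v|₂ / √m` on `ℝ^m`. -/
def empNorm {m : ℕ} (v : Fin m → ℝ) : ℝ := l2Norm v / √(m : ℝ)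

/-- The design matrix with rows `ψ(z'_i)ᵀ`. -/
def designMatrix {p p' n' : ℕ} (ψ : Fin p' → Cov p → ℝ) (z' : Fin n' → Cov p) :
    Matrix (Fin n') (Fin p') ℝ := Matrix.of fun i j => ψ j (z' i)

/-- `‖Y - A β‖²_{n'} + lam |β|₁`. -/
def lassoCriterion {n' p' : ℕ} (A : Matrix (Fin n') (Fin p') ℝ) (Y : Fin n' → ℝ) (lam : ℝ)
    (β : Fin p' → ℝ) : ℝ :=
  empNorm (Y - A.mulVec β) ^ 2 + lam * ∑ j, |β j|

/-- `β` is a minimizer of the Lasso criterion. -/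
def IsLasso {n' p' : ℕ} (A : Matrix (Fin n') (Fin p') ℝ) (Y : Fin n' → ℝ) (lam : ℝ)
    (β : Fin p' → ℝ) : Prop :=
  ∀ b : Fin p' → ℝ, lassoCriterion A Y lam β ≤ lassoCriterion A Y lam b

/-- The restricted eigenvalue number `κ(s, c₀)`: the least value of `|A δ|₂ / (√n' |δ|₂)` over
all `δ ≠ 0` such that `|δ_{J^c}|₁ ≤ c₀ |δ_J|₁` for some `J` with at most `s` elements. -/
def kappa {n' p' : ℕ} (A : Matrix (Fin n') (Fin p') ℝ) (s : ℕ) (c₀ : ℝ) : ℝ :=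
  sInf {r : ℝ | ∃ J : Finset (Fin p'), J.card ≤ s ∧ ∃ δ : Fin p' → ℝ, δ ≠ 0 ∧
    ∑ j ∈ Jᶜ, |δ j| ≤ c₀ * ∑ j ∈ J, |δ j| ∧
    r = l2Norm (A.mulVec δ) / (√(n' : ℝ) * l2Norm δ)}

/-! ### Assumptions on the kernel and on the densities -/

/-- The supremum norm `C_K` of the kernel. -/
def kernelSup {p : ℕ} (K : Cov p → ℝ) : ℝ := ⨆ u, |K u|

/-- Bounded symmetric kernels of order `α`. -/
structure IsKernelOfOrder {p : ℕ} (K : Cov p → ℝ) (α : ℕ) : Prop where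
  measurable : Measurable K
  bounded : BddAbove (Set.range fun u => |K u|)
  symm : ∀ u, K (-u) = K u
  integrable : Integrable K
  integral_eq_one : ∫ u, K u = 1
  moments : ∀ j : ℕ, 1 ≤ j → j < α → ∀ ι : Fin j → Fin p,
    Integrable (fun u => K u * ∏ l, u (ι l)) ∧ ∫ u, K u * ∏ l, u (ι l) = 0

/-- The iterated partial derivative `∂^k w / ∂z_{ι 0} ⋯ ∂z_{ι (k-1)}` at `z`. -/
def partialDeriv {p k : ℕ} (w : Cov p → ℝ) (ι : Fin k → Fin p) (z : Cov p) : ℝ :=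
  iteratedFDeriv ℝ k w z fun l => EuclideanSpace.single (ι l) (1 : ℝ)

/-- Smoothness of the covariate density `w`, with constant `C = C_{K,α}`. -/
def MarginalSmooth {p : ℕ} (K w : Cov p → ℝ) (𝒵 : Set (Cov p)) (α : ℕ) (C : ℝ) : Prop :=
  ContDiff ℝ α w ∧ ∀ z ∈ 𝒵,
    ∫⁻ u, ‖K u‖ₑ * ∑ ι : Fin α → Fin p, ‖∏ l, u (ι l)‖ₑ *
      ⨆ t ∈ Set.Icc (0 : ℝ) 1, ‖partialDeriv w ι (z + t • u)‖ₑ ≤ ENNReal.ofReal C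

/-- The first `k` entries of a multi-index of length `α`. -/
def headIdx {p α : ℕ} (k : Fin (α + 1)) (ι : Fin α → Fin p) : Fin k.val → Fin p :=
  fun l => ι ⟨l.val, by omega⟩

/-- The last `α - k` entries of a multi-index of length `α`. -/
def tailIdx {p α : ℕ} (k : Fin (α + 1)) (ι : Fin α → Fin p) : Fin (α - k.val) → Fin p :=
  fun l => ι ⟨k.val + l.val, by omega⟩

/-- `sup_{t ∈ [0,1]} |∂^k f(x₁, z + t u) · ∂^{α-k} f(x₂, z + t v)|`. -/
def holderSup {p α : ℕ} (f : ℝ × ℝ → Cov p → ℝ) (k : Fin (α + 1)) (ι : Fin α → Fin p)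
    (u v : Cov p) (x₁ x₂ : ℝ × ℝ) (z : Cov p) : ℝ≥0∞ :=
  ⨆ t ∈ Set.Icc (0 : ℝ) 1, ‖partialDeriv (f x₁) (headIdx k ι) (z + t • u) *
    partialDeriv (f x₂) (tailIdx k ι) (z + t • v)‖ₑ

/-- The integrand, as a function of `(u, v, x₁, x₂)`, in the smoothness assumption on `f_{X,Z}`. -/
def holderIntegrand {p : ℕ} (α : ℕ) (K : Cov p → ℝ) (f : ℝ × ℝ → Cov p → ℝ) (z : Cov p)
    (y : (Cov p × Cov p) × ((ℝ × ℝ) × (ℝ × ℝ))) : ℝ≥0∞ :=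
  ‖K y.1.1‖ₑ * ‖K y.1.2‖ₑ * ∑ k : Fin (α + 1), (Nat.choose α k.val : ℝ≥0∞) *
    ∑ ι : Fin α → Fin p, holderSup f k ι y.1.1 y.1.2 y.2.1 y.2.2 z *
      ‖(∏ l, y.1.1 (headIdx k ι l)) * ∏ l, y.1.2 (tailIdx k ι l)‖ₑ

/-- Smoothness of `z ↦ f_{X,Z}(x, z)`, with constant `C = C_{XZ,α}`: it is `α` times
differentiable for almost every `x`, and the integral of the products of derivatives is at
most `C`. -/
def JointSmooth {p : ℕ} (K : Cov p → ℝ) (f : ℝ × ℝ → Cov p → ℝ) (𝒵 : Set (Cov p)) (α : ℕ)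
    (C : ℝ) : Prop :=
  (∀ᵐ x, ∀ j : ℕ, j < α → Differentiable ℝ (iteratedFDeriv ℝ j (f x))) ∧
  ∀ z ∈ 𝒵, AEMeasurable (holderIntegrand α K f z) ∧
    ∫⁻ y, holderIntegrand α K f z y ≤ ENNReal.ofReal C

/-- `(X_i, Z_i)`, `i = 1, …, n`, are independent with common density `f`. -/
structure IsSample {Ω : Type*} [MeasurableSpace Ω] (P : Measure Ω) {p n : ℕ}
    (f : ℝ × ℝ → Cov p → ℝ) (X : Fin n → Ω → ℝ × ℝ) (Z : Fin n → Ω → Cov p) : Prop where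
  measurable_X : ∀ i, Measurable (X i)
  measurable_Z : ∀ i, Measurable (Z i)
  indep : iIndepFun (fun i ω => (X i ω, Z i ω)) P
  law : ∀ i, P.map (fun ω => (X i ω, Z i ω)) =
    (volume : Measure ((ℝ × ℝ) × Cov p)).withDensity fun y => ENNReal.ofReal (f y.1 y.2)

/-! ### Constants and tuning parameters -/

/-- `C₁ = f_min² / (32 f_max ∫K² + (8/3) C_K f_min)`. -/
def C₁ {p : ℕ} (K : Cov p → ℝ) (fmin fmax : ℝ) : ℝ :=
  fmin ^ 2 / (32 * fmax * (∫ u, K u ^ 2) + 8 / 3 * kernelSup K * fmin)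

/-- `C₂ = {16 C_ψ C_Λ' (f_min² + 8 f_max²) f_max ∫K²}² / f_min⁸`. -/
def C₂ {p : ℕ} (K : Cov p → ℝ) (fmin fmax Cψ CΛ : ℝ) : ℝ :=
  (16 * Cψ * CΛ * (fmin ^ 2 + 8 * fmax ^ 2) * fmax * ∫ u, K u ^ 2) ^ 2 / fmin ^ 8

/-- `C₃ = (64/3) C_ψ C_Λ' C_K² (f_min² + 8 f_max²) / f_min⁴`. -/
def C₃ {p : ℕ} (K : Cov p → ℝ) (fmin fmax Cψ CΛ : ℝ) : ℝ :=
  64 / 3 * Cψ * CΛ * kernelSup K ^ 2 * (fmin ^ 2 + 8 * fmax ^ 2) / fmin ^ 4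

/-- `c_h = (f_min⁴ α! / (2 C_ψ C_Λ' (f_min² + 16 f_max²) C_{XZ,α}))^{1/α}`. -/
def cBand (α : ℕ) (fmin fmax Cψ CΛ CXZ : ℝ) : ℝ :=
  (fmin ^ 4 * (α ! : ℝ) / (2 * Cψ * CΛ * (fmin ^ 2 + 16 * fmax ^ 2) * CXZ)) ^ (1 / (α : ℝ))

/-- The exponent `α (1 - ε) / (2 α + 2 p)`. -/
def rateExp (α p : ℕ) (ε : ℝ) : ℝ := α * (1 - ε) / (2 * α + 2 * p)

/-- `t = (n - 1)^{-α (1 - ε) / (2 α + 2 p)}`. -/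
def tPar (α p : ℕ) (ε : ℝ) (n : ℕ) : ℝ := ((n : ℝ) - 1) ^ (-rateExp α p ε)

/-- `h = c (n - 1)^{-1 / (2 α + 2 p)}`. -/
def hPar (α p : ℕ) (c : ℝ) (n : ℕ) : ℝ := c * ((n : ℝ) - 1) ^ (-(1 / (2 * (α : ℝ) + 2 * p)))

/-- The upper bound required on `h^α`. -/
def BandwidthCond (α : ℕ) (fmin fmax Cψ CΛ CKα CXZ h t : ℝ) : Prop :=
  h ^ α ≤ min (fmin * (α ! : ℝ) / (4 * CKα))
    (fmin ^ 4 * (α ! : ℝ) * t / (8 * Cψ * CΛ * (fmin ^ 2 + 8 * fmax ^ 2) * CXZ))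

/-- The lower bound on the probability, as a function of `n`, for the bandwidth constant `c`. -/
def probBound {p : ℕ} (K : Cov p → ℝ) (n' α : ℕ) (fmin fmax Cψ CΛ c ε : ℝ) (n : ℕ) : ℝ :=
  1 - 2 * n' * Real.exp (-(C₁ K fmin fmax * c ^ p *
        ((n : ℝ) - 1) ^ ((2 * (α : ℝ) + p) / (2 * α + 2 * p))))
    - 2 * n' * Real.exp (-(c ^ (2 * p) *
        ((n : ℝ) - 1) ^ (2 * (α : ℝ) * ε / (2 * p + 2 * α)) /
          (C₂ K fmin fmax Cψ CΛ + C₃ K fmin fmax Cψ CΛ * tPar α p ε n)))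

end

end CondKendall

open CondKendall

/-! The Lasso step is deterministic. When every response `Λ(τ̂(z'_i))` lies within `t / Cψ` of the
linear model, the noise correlates with a direction `δ` by at most `t |δ|₁`, so the penalty `4t`
dominates it. The error then lies in the cone of the restricted eigenvalue condition, and the
prediction, `ℓ₁` and `ℓ₂` bounds follow, with `1 < q < 2` by interpolation (`lasso_rates`). By the
mean value inequality for `Λ` it remains to bound the probability that `|τ̂ - τ| > t / (Cψ CΛ)` at
some design point, and a union bound reduces this to a single point.

At a point `z` the weights sum to one, so `τ̂ - τ` is the double sum of `(g - τ) K_h K_h` divided by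
the square of the sum of the `K_h` (`abs_tauHat_sub_le`). The denominator is controlled by
Bernstein's inequality and the bias of the density estimator. The off-diagonal part of the numerator
is a U-statistic. Hoeffding's averaging over permutations reduces it to means of `n / 2` independent
terms, which gives a Bernstein inequality (`uStat_bernstein`). Its mean is pure bias: `g - τ`
integrates to zero against `f(x₁, z) f(x₂, z)`, and a Taylor expansion of the product density
combined with the vanishing moments of `K` leaves a term of order `h^α`
(`abs_integral_pairKernel_le`).

The diagonal of the double sum is of order `1 / (n h^{2p})` and has no counterpart in the bandwidth
condition. It is absorbed by a dichotomy on the second exponent of the bound. If that exponent is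
below `1/2`, the claimed lower bound on the probability is negative; otherwise the very same
inequality makes the diagonal a fraction of the threshold (`tauHat_tail_of_bandwidthCond`). -/

namespace CondKendall

/-! ### Deterministic analysis of the Lasso -/

theorem empNorm_sq {m : ℕ} (v : Fin m → ℝ) : empNorm v ^ 2 = (∑ i, v i ^ 2) / m := by
  rw [empNorm, l2Norm, div_pow, Real.sq_sqrt (Finset.sum_nonneg fun i _ => sq_nonneg _),
    Real.sq_sqrt (Nat.cast_nonneg _)]

theorem empNorm_nonneg {m : ℕ} (v : Fin m → ℝ) : 0 ≤ empNorm v :=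
  div_nonneg (Real.sqrt_nonneg _) (Real.sqrt_nonneg _)

theorem l2Norm_sq {m : ℕ} (v : Fin m → ℝ) : l2Norm v ^ 2 = ∑ i, v i ^ 2 :=
  Real.sq_sqrt (Finset.sum_nonneg fun _ _ => sq_nonneg _)

theorem l2Norm_nonneg {m : ℕ} (v : Fin m → ℝ) : 0 ≤ l2Norm v := Real.sqrt_nonneg _

theorem sum_abs_le_sqrt_mul_l2Norm {m s : ℕ} (J : Finset (Fin m)) (hJ : J.card ≤ s)
    (v : Fin m → ℝ) : ∑ j ∈ J, |v j| ≤ √(s : ℝ) * l2Norm v := by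
  have h1 : (∑ j ∈ J, |v j|) ^ 2 ≤ s * ∑ j, v j ^ 2 := by
    calc (∑ j ∈ J, |v j|) ^ 2 ≤ J.card * ∑ j ∈ J, |v j| ^ 2 := sq_sum_le_card_mul_sum_sq
      _ ≤ s * ∑ j, v j ^ 2 := by
        simp only [sq_abs]
        gcongr
        · exact Finset.subset_univ _
  rw [l2Norm, ← Real.sqrt_mul (Nat.cast_nonneg _)]
  exact Real.le_sqrt_of_sq_le h1

/-- Log-convexity of the `ℓ_q` norms between `ℓ₁` and `ℓ₂`. -/
theorem sum_rpow_le_of_sum_le {m : ℕ} (v : Fin m → ℝ) {A B q : ℝ} (hA : 0 < A) (hB : 0 < B)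
    (h1 : ∑ j, |v j| ≤ A) (h2 : ∑ j, v j ^ 2 ≤ B) (hq1 : 1 ≤ q) (hq2 : q ≤ 2) :
    ∑ j, |v j| ^ q ≤ A ^ (2 - q) * B ^ (q - 1) := by
  have key : ∀ j, |v j| ^ q ≤
      A ^ (2 - q) * B ^ (q - 1) * ((2 - q) * (|v j| / A) + (q - 1) * (v j ^ 2 / B)) := by
    -- Weighted AM-GM with weights `2 - q` and `q - 1`, applied to each term after normalising by
    -- `A` and `B`; summing then costs a factor of at most one.
    intro j
    have := Real.geom_mean_le_arith_mean2_weighted (w₁ := 2 - q) (w₂ := q - 1)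
      (p₁ := |v j| / A) (p₂ := v j ^ 2 / B) (by linarith) (by linarith) (by positivity)
      (by positivity) (by ring)
    refine le_trans (le_of_eq ?_) (mul_le_mul_of_nonneg_left this (by positivity))
    rw [Real.div_rpow (abs_nonneg _) hA.le, Real.div_rpow (sq_nonneg _) hB.le, ← sq_abs (v j),
      ← Real.rpow_natCast |v j| 2, ← Real.rpow_mul (abs_nonneg _)]
    have e : |v j| ^ q = |v j| ^ (2 - q) * |v j| ^ (((2 : ℕ) : ℝ) * (q - 1)) := by
      rw [← Real.rpow_add_of_nonneg (abs_nonneg _) (by linarith)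
        (by push_cast; linarith)]
      congr 1; push_cast; ring
    rw [e]
    have : 0 < A ^ (2 - q) := by positivity
    have : 0 < B ^ (q - 1) := by positivity
    field_simp
  calc ∑ j, |v j| ^ q ≤ ∑ j, A ^ (2 - q) * B ^ (q - 1) *
        ((2 - q) * (|v j| / A) + (q - 1) * (v j ^ 2 / B)) := Finset.sum_le_sum fun j _ => key j
    _ = A ^ (2 - q) * B ^ (q - 1) *
        ((2 - q) * ((∑ j, |v j|) / A) + (q - 1) * ((∑ j, v j ^ 2) / B)) := by
      rw [← Finset.mul_sum, Finset.sum_add_distrib, ← Finset.mul_sum, ← Finset.mul_sum,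
        Finset.sum_div, Finset.sum_div]
    _ ≤ A ^ (2 - q) * B ^ (q - 1) * ((2 - q) * 1 + (q - 1) * 1) := by
      have : (∑ j, |v j|) / A ≤ 1 := (div_le_one hA).2 h1
      have : (∑ j, v j ^ 2) / B ≤ 1 := (div_le_one hB).2 h2
      have : 0 ≤ 2 - q := by linarith
      have : 0 ≤ q - 1 := by linarith
      gcongr
    _ = _ := by ring

/-- The quotients are nonnegative, so their infimum is a genuine lower bound. The homogeneous form
also covers `δ = 0`, which the definition of `kappa` excludes. -/
theorem kappa_mul_l2Norm_le {n' p' s : ℕ} (hn' : 0 < n') (A : Matrix (Fin n') (Fin p') ℝ)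
    (J : Finset (Fin p')) (hJ : J.card ≤ s) (δ : Fin p' → ℝ)
    (hδ : ∑ j ∈ Jᶜ, |δ j| ≤ 3 * ∑ j ∈ J, |δ j|) :
    kappa A s 3 * l2Norm δ ≤ empNorm (A.mulVec δ) := by
  by_cases h0 : δ = 0
  · subst h0
    simp [l2Norm, empNorm]
  have hpos : 0 < l2Norm δ := by
    refine lt_of_le_of_ne (l2Norm_nonneg _) fun h => h0 ?_
    have : ∑ i, δ i ^ 2 = 0 := by rw [← l2Norm_sq, ← h]; norm_num
    rw [Finset.sum_eq_zero_iff_of_nonneg fun _ _ => sq_nonneg _] at this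
    ext i
    simpa using this i (Finset.mem_univ _)
  have hsn : 0 < √(n' : ℝ) := Real.sqrt_pos.2 (by exact_mod_cast hn')
  have : kappa A s 3 ≤ l2Norm (A.mulVec δ) / (√(n' : ℝ) * l2Norm δ) := by
    refine csInf_le ⟨0, ?_⟩ ⟨J, hJ, δ, h0, hδ, rfl⟩
    rintro r ⟨_, _, δ', _, _, rfl⟩
    exact div_nonneg (l2Norm_nonneg _) (mul_nonneg (Real.sqrt_nonneg _) (l2Norm_nonneg _))
  rw [le_div_iff₀ (by positivity)] at this
  rw [empNorm, le_div_iff₀ hsn]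
  linarith

/-- The basic inequality of the Lasso with tuning parameter `4 t`. -/
theorem lasso_basic {n' p' : ℕ} (hn' : 0 < n') (A : Matrix (Fin n') (Fin p') ℝ)
    {Y : Fin n' → ℝ} {Cψ t : ℝ} (hCψ : 0 < Cψ) (hA : ∀ i j, |A i j| ≤ Cψ)
    {βs β : Fin p' → ℝ} (hY : ∀ i, |Y i - A.mulVec βs i| ≤ t / Cψ)
    (hβ : IsLasso A Y (4 * t) β) :
    empNorm (A.mulVec (β - βs)) ^ 2 ≤
      2 * t * ∑ j, |β j - βs j| + 4 * t * (∑ j, |βs j| - ∑ j, |β j|) := by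
  have h := hβ βs
  have hn : (0 : ℝ) < n' := by exact_mod_cast hn'
  simp only [lassoCriterion, empNorm_sq] at h ⊢
  set δ := β - βs with hδ
  have e1 : ∀ i, (Y - A.mulVec β) i = (Y i - A.mulVec βs i) - A.mulVec δ i := by
    intro i
    simp only [hδ, Matrix.mulVec_sub, Pi.sub_apply]; ring
  -- Duality of `ℓ₁` and `ℓ_∞`: the entries of `A` are at most `Cψ`, which cancels the `Cψ` in the
  -- noise level.
  have hcross : ∑ i, (Y i - A.mulVec βs i) * A.mulVec δ i ≤ n' * (t * ∑ j, |β j - βs j|) := by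
    have : ∀ i, (Y i - A.mulVec βs i) * A.mulVec δ i ≤ t * ∑ j, |β j - βs j| := by
      intro i
      have h2 : |A.mulVec δ i| ≤ Cψ * ∑ j, |β j - βs j| := by
        rw [Matrix.mulVec, dotProduct, Finset.mul_sum]
        refine (Finset.abs_sum_le_sum_abs _ _).trans (Finset.sum_le_sum fun j _ => ?_)
        rw [abs_mul]
        exact mul_le_mul_of_nonneg_right (hA i j) (abs_nonneg _)
      calc _ ≤ |Y i - A.mulVec βs i| * |A.mulVec δ i| := by
            rw [← abs_mul]; exact le_abs_self _
        _ ≤ t / Cψ * (Cψ * ∑ j, |β j - βs j|) := by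
            have := (abs_nonneg _).trans (hY i)
            exact mul_le_mul (hY i) h2 (abs_nonneg _) this
        _ = _ := by field_simp
    calc _ ≤ ∑ _i : Fin n', t * ∑ j, |β j - βs j| := Finset.sum_le_sum fun i _ => this i
      _ = _ := by simp
  have e2 : ∑ i, (Y - A.mulVec β) i ^ 2 = ∑ i, (Y - A.mulVec βs) i ^ 2
      - 2 * ∑ i, (Y i - A.mulVec βs i) * A.mulVec δ i + ∑ i, A.mulVec δ i ^ 2 := by
    rw [Finset.mul_sum, ← Finset.sum_sub_distrib, ← Finset.sum_add_distrib]
    refine Finset.sum_congr rfl fun i _ => ?_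
    rw [e1 i, Pi.sub_apply]; ring
  rw [e2, add_div, sub_div] at h
  have h3 : 2 * (∑ i, (Y i - A.mulVec βs i) * A.mulVec δ i) / n' ≤
      2 * t * ∑ j, |β j - βs j| := by
    rw [div_le_iff₀ hn]; linarith
  linarith

/-- Rates of the Lasso with tuning parameter `4 t`, for a noise bounded by `t / Cψ`. -/
theorem lasso_rates {n' p' s : ℕ} (hn' : 0 < n') (hs : 1 ≤ s) (A : Matrix (Fin n') (Fin p') ℝ)
    {Y : Fin n' → ℝ} {Cψ t : ℝ} (hCψ : 0 < Cψ) (ht : 0 < t) (hA : ∀ i j, |A i j| ≤ Cψ)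
    {βs β : Fin p' → ℝ} (hβs : {j | βs j ≠ 0}.ncard ≤ s)
    (hY : ∀ i, |Y i - A.mulVec βs i| ≤ t / Cψ)
    (hκ : 0 < kappa A s 3) (hβ : IsLasso A Y (4 * t) β) :
    empNorm (A.mulVec (β - βs)) ≤ 20 * √(s : ℝ) * t / kappa A s 3 ∧
    ∀ q : ℝ, 1 ≤ q → q ≤ 2 → lqNorm q (β - βs) ≤
      5 * (4 : ℝ) ^ (2 / q) * (s : ℝ) ^ (1 / q) * t / kappa A s 3 ^ 2 := by
  classical
  set κ := kappa A s 3 with hκdef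
  have hb := lasso_basic hn' A hCψ hA hY hβ
  set J : Finset (Fin p') := Finset.univ.filter fun j => βs j ≠ 0 with hJdef
  have hJ : J.card ≤ s := by
    have : {j | βs j ≠ 0} = (J : Set (Fin p')) := by ext; simp [hJdef]
    rwa [this, Set.ncard_coe_finset] at hβs
  set δ := β - βs with hδ
  have hδj : ∀ j, δ j = β j - βs j := fun j => rfl
  have hsplit : ∀ F : Fin p' → ℝ, ∑ j, F j = ∑ j ∈ J, F j + ∑ j ∈ Jᶜ, F j :=
    fun F => (Finset.sum_add_sum_compl J F).symm
  have h1 : ∑ j, |βs j| - ∑ j, |β j| ≤ ∑ j ∈ J, |δ j| - ∑ j ∈ Jᶜ, |δ j| := by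
    rw [hsplit, hsplit fun j => |β j|]
    have h0 : ∀ j ∈ Jᶜ, βs j = 0 := by intro j hj; simpa [hJdef] using hj
    have a1 : ∑ j ∈ Jᶜ, |βs j| = 0 := Finset.sum_eq_zero fun j hj => by rw [h0 j hj, abs_zero]
    have a2 : ∑ j ∈ Jᶜ, |β j| = ∑ j ∈ Jᶜ, |δ j| :=
      Finset.sum_congr rfl fun j hj => by rw [hδj, h0 j hj, sub_zero]
    have a3 : ∑ j ∈ J, |βs j| ≤ ∑ j ∈ J, |β j| + ∑ j ∈ J, |δ j| := by
      rw [← Finset.sum_add_distrib]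
      refine Finset.sum_le_sum fun j _ => ?_
      have := abs_sub_abs_le_abs_sub (βs j) (β j)
      rw [abs_sub_comm] at this
      rw [hδj]; linarith
    linarith
  have hb' : empNorm (A.mulVec δ) ^ 2 ≤ 6 * t * ∑ j ∈ J, |δ j| - 2 * t * ∑ j ∈ Jᶜ, |δ j| := by
    have h2 := hsplit fun j => |β j - βs j|
    rw [h2] at hb
    simp only [hδj] at h1 ⊢
    nlinarith
  -- The aperture `3` is the ratio `6t / 2t`, coming from noise `2t` against penalty `4t`.
  have hcone : ∑ j ∈ Jᶜ, |δ j| ≤ 3 * ∑ j ∈ J, |δ j| := by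
    have := sq_nonneg (empNorm (A.mulVec δ))
    have h3 : 0 ≤ 2 * t * (3 * ∑ j ∈ J, |δ j| - ∑ j ∈ Jᶜ, |δ j|) := by linarith
    have := nonneg_of_mul_nonneg_right h3 (by positivity)
    linarith
  have hRE : κ * l2Norm δ ≤ empNorm (A.mulVec δ) := kappa_mul_l2Norm_le hn' A J hJ δ hcone
  have hJ2 := sum_abs_le_sqrt_mul_l2Norm J hJ δ
  have hs0 : (0 : ℝ) < s := by exact_mod_cast hs
  have hss : 0 < √(s : ℝ) := Real.sqrt_pos.2 hs0
  have hE0 := empNorm_nonneg (A.mulVec δ)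
  have hJc0 : 0 ≤ ∑ j ∈ Jᶜ, |δ j| := Finset.sum_nonneg fun _ _ => abs_nonneg _
  -- The error appears squared on the left and, through the restricted eigenvalue, linearly on the
  -- right; one factor is cancelled.
  have hE : empNorm (A.mulVec δ) ≤ 6 * t * √(s : ℝ) / κ := by
    rw [le_div_iff₀ hκ]
    by_contra! hcon
    have hEpos : 0 < empNorm (A.mulVec δ) := by
      refine lt_of_le_of_ne hE0 fun h => ?_
      rw [← h, zero_mul] at hcon
      have : 0 < 6 * t * √(s : ℝ) := by positivity
      linarith
    have : empNorm (A.mulVec δ) ^ 2 * κ ≤ 6 * t * √(s : ℝ) * empNorm (A.mulVec δ) := by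
      calc empNorm (A.mulVec δ) ^ 2 * κ ≤ 6 * t * (√(s : ℝ) * l2Norm δ) * κ := by
            refine mul_le_mul_of_nonneg_right ?_ hκ.le
            nlinarith
        _ = 6 * t * √(s : ℝ) * (κ * l2Norm δ) := by ring
        _ ≤ _ := by gcongr
    nlinarith
  -- The constant `6` is relaxed to `20 = 5 · 4`, and the `ℓ₁` constant becomes `80 = 5 · 16`, so
  -- that interpolation gives exactly `5 · 4^{2/q}`.
  have h2 : l2Norm δ ≤ 20 * t * √(s : ℝ) / κ ^ 2 := by
    have : κ * l2Norm δ ≤ 20 * t * √(s : ℝ) / κ := hRE.trans (hE.trans (by gcongr; norm_num))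
    rw [le_div_iff₀ (by positivity)]
    rw [le_div_iff₀ hκ] at this
    linarith
  have h1' : ∑ j, |δ j| ≤ 80 * t * s / κ ^ 2 := by
    calc ∑ j, |δ j| ≤ 4 * ∑ j ∈ J, |δ j| := by rw [hsplit]; linarith
      _ ≤ 4 * (√(s : ℝ) * (20 * t * √(s : ℝ) / κ ^ 2)) := by gcongr; exact hJ2.trans (by gcongr)
      _ = 80 * t * (√(s : ℝ) * √(s : ℝ)) / κ ^ 2 := by ring
      _ = _ := by rw [Real.mul_self_sqrt hs0.le]
  refine ⟨hE.trans ?_, fun q hq1 hq2 => ?_⟩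
  · have : 0 < t * √(s : ℝ) := by positivity
    exact div_le_div_of_nonneg_right (by linarith) hκ.le
  have h22 : ∑ j, δ j ^ 2 ≤ 400 * t ^ 2 * s / κ ^ 4 := by
    rw [← l2Norm_sq]
    calc l2Norm δ ^ 2 ≤ (20 * t * √(s : ℝ) / κ ^ 2) ^ 2 := by
          gcongr; exact l2Norm_nonneg _
      _ = 400 * t ^ 2 * √(s : ℝ) ^ 2 / κ ^ 4 := by ring
      _ = _ := by rw [Real.sq_sqrt hs0.le]
  have h3 := sum_rpow_le_of_sum_le δ (by positivity) (by positivity) h1' h22 hq1 hq2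
  have hq0 : 0 < q := by linarith
  have hR : (0 : ℝ) ≤ 5 * (4 : ℝ) ^ (2 / q) * (s : ℝ) ^ (1 / q) * t / κ ^ 2 := by positivity
  simp only [one_div] at hR ⊢
  rw [lqNorm, one_div, Real.rpow_inv_le_iff_of_pos
    (Finset.sum_nonneg fun _ _ => by positivity) hR hq0]
  refine h3.trans (le_of_eq ?_)
  -- With `c = 5t/κ²` and `d = 16s` the two bounds are `c d` and `c² d`, and `(c d)^{2-q} (c²
  -- d)^{q-1} = c^q d`.
  have e1 : 80 * t * s / κ ^ 2 = (5 * t / κ ^ 2) * ((4 : ℝ) ^ (2 : ℝ) * s) := by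
    norm_num; ring
  have e2 : 400 * t ^ 2 * s / κ ^ 4 = (5 * t / κ ^ 2) ^ (2 : ℝ) * ((4 : ℝ) ^ (2 : ℝ) * s) := by
    norm_num; ring
  have e3 : 5 * (4 : ℝ) ^ (2 / q) * (s : ℝ) ^ (1 / q) * t / κ ^ 2 =
      (5 * t / κ ^ 2) * ((4 : ℝ) ^ (2 : ℝ) * s) ^ (1 / q) := by
    rw [Real.mul_rpow (by positivity) hs0.le, ← Real.rpow_mul (by norm_num)]
    ring_nf
  have hc : 0 < 5 * t / κ ^ 2 := by positivity
  have hd : 0 < (4 : ℝ) ^ (2 : ℝ) * s := by positivity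
  rw [← one_div, e1, e2, e3]
  generalize 5 * t / κ ^ 2 = c at hc ⊢
  generalize (4 : ℝ) ^ (2 : ℝ) * s = d at hd ⊢
  rw [Real.mul_rpow hc.le hd.le, Real.mul_rpow (by positivity) hd.le, ← Real.rpow_mul hc.le,
    Real.mul_rpow hc.le (by positivity), ← Real.rpow_mul hd.le, one_div_mul_cancel hq0.ne',
    Real.rpow_one]
  calc _ = (c ^ (2 - q) * c ^ (2 * (q - 1))) * (d ^ (2 - q) * d ^ (q - 1)) := by ring
    _ = c ^ q * d := by
      rw [← Real.rpow_add hc, ← Real.rpow_add hd]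
      ring_nf
      rw [Real.rpow_one]

end CondKendall

namespace CondKendall

/-! ### Bernstein's inequality for sums and for U-statistics of order two -/

/-- The Padé bound `(6 - 2u) exp u ≤ 6 + 4u + u²`. -/
theorem pade_exp (u : ℝ) : (6 - 2 * u) * Real.exp u ≤ 6 + 4 * u + u ^ 2 := by
  -- `D` is the difference of the two sides and `D1` its derivative. `D1` is increasing because `exp
  -- (-x) ≥ 1 - x`, and it vanishes at `0`, so `D` has its minimum `0` there.
  set D1 : ℝ → ℝ := fun x => 4 + 2 * x - (4 - 2 * x) * Real.exp x with hD1
  set D : ℝ → ℝ := fun x => 6 + 4 * x + x ^ 2 - (6 - 2 * x) * Real.exp x with hD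
  have d1 : ∀ x, HasDerivAt D1 (2 - (2 - 2 * x) * Real.exp x) x := by
    intro x
    have h := (((hasDerivAt_id x).const_mul 2).const_add 4).sub
      ((((hasDerivAt_id x).const_mul 2).const_sub 4).mul (Real.hasDerivAt_exp x))
    refine (h.congr_deriv ?_)
    simp; ring
  have d0 : ∀ x, HasDerivAt D (D1 x) x := by
    intro x
    have h := ((((hasDerivAt_id x).const_mul 4).const_add 6).add (hasDerivAt_pow 2 x)).sub
      ((((hasDerivAt_id x).const_mul 2).const_sub 6).mul (Real.hasDerivAt_exp x))
    refine (h.congr_deriv ?_)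
    simp [hD1]; ring
  have m1 : Monotone D1 := by
    refine monotone_of_hasDerivAt_nonneg d1 fun x => ?_
    have h1 := Real.add_one_le_exp (-x)
    have h2 : Real.exp (-x) * Real.exp x = 1 := by rw [← Real.exp_add]; simp
    have h3 := mul_le_mul_of_nonneg_right h1 (Real.exp_pos x).le
    simp only [Pi.zero_apply]
    linarith
  have z1 : D1 0 = 0 := by simp [hD1]
  have z0 : D 0 = 0 := by simp [hD]
  have key : 0 ≤ D u := by
    have hc : Continuous D := continuous_iff_continuousAt.2 fun x => (d0 x).continuousAt
    rcases le_total 0 u with hu | hu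
    · have : MonotoneOn D (Set.Ici 0) := by
        refine monotoneOn_of_deriv_nonneg (convex_Ici 0) hc.continuousOn
          (fun x _ => (d0 x).differentiableAt.differentiableWithinAt) fun x hx => ?_
        rw [(d0 x).deriv, ← z1]
        exact m1 (by simpa using (interior_subset hx))
      rw [← z0]
      exact this Set.self_mem_Ici hu hu
    · have : AntitoneOn D (Set.Iic 0) := by
        refine antitoneOn_of_deriv_nonpos (convex_Iic 0) hc.continuousOn
          (fun x _ => (d0 x).differentiableAt.differentiableWithinAt) fun x hx => ?_
        rw [(d0 x).deriv, ← z1]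
        exact m1 (by simpa using (interior_subset hx))
      rw [← z0]
      exact this hu Set.self_mem_Iic hu
  simp only [hD] at key
  linarith

/-- Dividing the Padé bound by its positive factor gives `exp u ≤ 1 + u + u² / (2 (1 - u/3))` for
every `u < 3`, negative or not; the last denominator decreases in `u`, so only an upper bound on `y`
is needed. -/
theorem exp_mul_le_of_le {y M θ : ℝ} (hθ : 0 ≤ θ) (hy : y ≤ M) (hθM : θ * M < 3) :
    Real.exp (θ * y) ≤ 1 + θ * y + y ^ 2 * (θ ^ 2 / (2 * (1 - θ * M / 3))) := by
  have hu : θ * y ≤ θ * M := mul_le_mul_of_nonneg_left hy hθ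
  have h := pade_exp (θ * y)
  have hpos : 0 < 6 - 2 * (θ * y) := by linarith
  have hpos' : 0 < 1 - θ * M / 3 := by linarith
  have h1 : Real.exp (θ * y) ≤ (6 + 4 * (θ * y) + (θ * y) ^ 2) / (6 - 2 * (θ * y)) := by
    rw [le_div_iff₀ hpos]; linarith
  have h2 : (6 + 4 * (θ * y) + (θ * y) ^ 2) / (6 - 2 * (θ * y)) =
      1 + θ * y + y ^ 2 * (θ ^ 2 / (2 * (1 - θ * y / 3))) := by
    have h3 : 3 - θ * y ≠ 0 := by intro h; linarith
    have : 6 - 2 * (θ * y) = 2 * (3 - θ * y) := by ring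
    have h4 : 1 - θ * y / 3 = (3 - θ * y) / 3 := by ring
    rw [this, h4]
    field_simp
    ring
  rw [h2] at h1
  refine h1.trans ?_
  gcongr

variable {Ω : Type*} [MeasurableSpace Ω] {P : Measure Ω} [IsProbabilityMeasure P]

theorem integrable_of_abs_le {Y : Ω → ℝ} (hY : AEMeasurable Y P) {M : ℝ}
    (hM : ∀ ω, |Y ω| ≤ M) : Integrable Y P :=
  Integrable.of_bound hY.aestronglyMeasurable M (ae_of_all _ hM)

/-- Bernstein's bound on the moment generating function of a bounded random variable. -/
theorem mgf_le_of_abs_le {Y : Ω → ℝ} (hY : AEMeasurable Y P) {M v θ : ℝ}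
    (hM : ∀ ω, |Y ω| ≤ M) (hv : ∫ ω, Y ω ^ 2 ∂P ≤ v) (hθ : 0 ≤ θ) (hθM : θ * M < 3) :
    mgf Y P θ ≤ Real.exp (θ * (∫ ω, Y ω ∂P) + v * (θ ^ 2 / (2 * (1 - θ * M / 3)))) := by
  have hi := integrable_of_abs_le hY hM
  have hi2 : Integrable (fun ω => Y ω ^ 2) P := by
    refine integrable_of_abs_le (hY.pow_const 2) (M := M ^ 2) fun ω => ?_
    rw [abs_pow]
    exact pow_le_pow_left₀ (abs_nonneg _) (hM ω) 2
  have hpos' : 0 < 1 - θ * M / 3 := by linarith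
  set c := θ ^ 2 / (2 * (1 - θ * M / 3)) with hc
  have hc0 : 0 ≤ c := by positivity
  calc mgf Y P θ = ∫ ω, Real.exp (θ * Y ω) ∂P := rfl
    _ ≤ ∫ ω, (1 + θ * Y ω + Y ω ^ 2 * c) ∂P := by
        refine integral_mono_of_nonneg (ae_of_all _ fun ω => (Real.exp_pos _).le)
          (((integrable_const _).add (hi.const_mul θ)).add (hi2.mul_const c))
          (ae_of_all _ fun ω => exp_mul_le_of_le hθ ((le_abs_self _).trans (hM ω)) hθM)
    _ = 1 + θ * (∫ ω, Y ω ∂P) + (∫ ω, Y ω ^ 2 ∂P) * c := by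
        have h1 : Integrable (fun ω => 1 + θ * Y ω) P := (integrable_const _).add (hi.const_mul θ)
        rw [integral_add h1 (hi2.mul_const c),
          integral_add (integrable_const _) (hi.const_mul θ), integral_const_mul,
          integral_mul_const]
        simp
    -- The variable is not centred: `v` bounds the raw second moment.
    _ ≤ (θ * (∫ ω, Y ω ∂P) + v * c) + 1 := by nlinarith
    _ ≤ _ := Real.add_one_le_exp _

/-- Chernoff's bound for a variable whose moment generating function satisfies Bernstein's
bound for an average of `m` terms. -/
theorem bernstein_tail {W : Ω → ℝ} {μ v M m x : ℝ} (hv : 0 < v) (hM : 0 ≤ M) (hm : 0 < m)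
    (hx : 0 ≤ x) (hint : ∀ θ, Integrable (fun ω => Real.exp (θ * W ω)) P)
    (hmgf : ∀ θ, 0 ≤ θ → θ * M < 3 * m →
      mgf W P θ ≤ Real.exp (θ * μ + v * (θ ^ 2 / (2 * m * (1 - θ * M / (3 * m)))))) :
    P.real {ω | μ + x ≤ W ω} ≤ Real.exp (-(m * x ^ 2 / (2 * v + 2 / 3 * M * x))) := by
  have hD : 0 < v + M * x / 3 := by positivity
  -- Bernstein's classical choice: it turns `1 - θ M / (3m)` into `v / (v + M x / 3)`, and the
  -- exponent collapses.
  set θ := m * x / (v + M * x / 3) with hθ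
  have hθ0 : 0 ≤ θ := by positivity
  have hθM : θ * M < 3 * m := by
    rw [hθ, div_mul_eq_mul_div, div_lt_iff₀ hD]
    nlinarith [mul_pos hm hv]
  refine (measure_ge_le_exp_mul_mgf (μ + x) hθ0 (hint θ)).trans ?_
  refine (mul_le_mul_of_nonneg_left (hmgf θ hθ0 hθM) (Real.exp_pos _).le).trans ?_
  rw [← Real.exp_add]
  refine le_of_eq (congrArg _ ?_)
  have h1 : 1 - θ * M / (3 * m) = v / (v + M * x / 3) := by
    rw [hθ]; field_simp; ring
  have h2 : 2 * v + 2 / 3 * M * x = 2 * (v + M * x / 3) := by ring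
  rw [h1, h2, hθ]
  field_simp
  ring

/-- The lower tail of the average of independent bounded variables. -/
theorem bernstein_lower {n : ℕ} (hn : 0 < n) {Y : Fin n → Ω → ℝ}
    (hY : ∀ i, Measurable (Y i)) (hind : iIndepFun Y P) {μ v M x : ℝ} (hv : 0 < v)
    (hM0 : 0 ≤ M) (hx : 0 ≤ x) (hM : ∀ i ω, |Y i ω| ≤ M) (hμ : ∀ i, ∫ ω, Y i ω ∂P = μ)
    (hv2 : ∀ i, ∫ ω, Y i ω ^ 2 ∂P ≤ v) :
    P.real {ω | (∑ i, Y i ω) / n ≤ μ - x} ≤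
      Real.exp (-(n * x ^ 2 / (2 * v + 2 / 3 * M * x))) := by
  have hn' : (0 : ℝ) < n := by exact_mod_cast hn
  -- The sign turns the lower tail into an upper one.
  set F : Fin n → Ω → ℝ := fun i ω => -(1 / (n : ℝ)) * Y i ω with hF
  have hFm : ∀ i, Measurable (F i) := fun i => (hY i).const_mul _
  have hFi : iIndepFun F P := hind.comp (fun _ y => -(1 / (n : ℝ)) * y) fun _ =>
    measurable_const.mul measurable_id
  have hFM : ∀ i ω, |F i ω| ≤ M / n := fun i ω => by
    rw [hF]; simp only [abs_mul, abs_neg, abs_of_pos (one_div_pos.2 hn')]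
    rw [div_mul_eq_mul_div, one_mul]
    gcongr
    exact hM i ω
  have hset : {ω | (∑ i, Y i ω) / n ≤ μ - x} = {ω | -μ + x ≤ (∑ i, F i) ω} := by
    ext ω
    simp only [Set.mem_ofPred_eq, Finset.sum_apply, hF, ← Finset.mul_sum]
    rw [show -(1 / (n : ℝ)) * ∑ i, Y i ω = -((∑ i, Y i ω) / n) by ring]
    constructor <;> intro h <;> linarith
  rw [hset]
  have hsm : Measurable (∑ i, F i) := by fun_prop
  refine bernstein_tail hv hM0 hn' hx (fun θ => ?_) fun θ hθ hθM => ?_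
  · refine integrable_of_abs_le (M := Real.exp (|θ| * ∑ _i : Fin n, M / n))
      (hsm.const_mul θ).exp.aemeasurable fun ω => ?_
    rw [Real.abs_exp]
    refine Real.exp_le_exp.2 ((le_abs_self _).trans ?_)
    rw [abs_mul, Finset.sum_apply]
    gcongr
    exact (Finset.abs_sum_le_sum_abs _ _).trans (Finset.sum_le_sum fun i _ => hFM i ω)
  · rw [hFi.mgf_sum hFm]
    have : ∀ i ∈ Finset.univ, mgf (F i) P θ ≤
        Real.exp (θ * (-(1 / (n : ℝ)) * μ) + v / n ^ 2 * (θ ^ 2 / (2 * (1 - θ * (M / n) / 3)))) := by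
      intro i _
      have h1 : ∫ ω, F i ω ∂P = -(1 / (n : ℝ)) * μ := by
        rw [← hμ i, ← integral_const_mul]
      rw [← h1]
      refine mgf_le_of_abs_le (hFm i).aemeasurable (hFM i) ?_ hθ ?_
      · have : ∀ ω, F i ω ^ 2 = (1 / (n : ℝ) ^ 2) * Y i ω ^ 2 := fun ω => by rw [hF]; ring
        simp_rw [this]
        rw [integral_const_mul, div_mul_eq_mul_div, one_mul]
        gcongr
        exact hv2 i
      · rw [← mul_div_assoc, div_lt_iff₀ hn']; exact hθM
    refine (Finset.prod_le_prod (fun i _ => mgf_nonneg) this).trans (le_of_eq ?_)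
    rw [Finset.prod_const, Finset.card_univ, Fintype.card_fin, ← Real.exp_nat_mul]
    congr 1
    have : θ * (M / n) / 3 = θ * M / (3 * n) := by field_simp
    rw [this, mul_add]
    have h5 : (1 - θ * M / (3 * n)) ≠ 0 := by
      have : θ * M / (3 * n) < 1 := by rw [div_lt_one (by positivity)]; exact hθM
      linarith
    congr 1
    · field_simp
    · generalize 1 - θ * M / (3 * n) = w at h5
      field_simp

/-! #### U-statistics -/

/-- Averaging over all permutations. -/
theorem sum_perm_eq {n : ℕ} (F : Fin n → Fin n → ℝ) {a b : Fin n} (hab : a ≠ b) :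
    ((n : ℝ) * (n - 1)) * ∑ σ : Equiv.Perm (Fin n), F (σ a) (σ b) =
      (n ! : ℝ) * ∑ i, ∑ j, if i ≠ j then F i j else 0 := by
  -- The sum over `σ` does not depend on the ordered pair of distinct positions, because right
  -- multiplication by a permutation taking `a` to `c` and `b` to `d` reindexes it. Summing over all
  -- pairs and exchanging the sums then gives the identity.
  have hT : ∀ c d : Fin n, c ≠ d → ∑ σ : Equiv.Perm (Fin n), F (σ c) (σ d) =
      ∑ σ : Equiv.Perm (Fin n), F (σ a) (σ b) := by
    intro c d hcd
    have hne : Equiv.swap a c b ≠ c := by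
      intro h
      apply hab
      have := congrArg (Equiv.swap a c) h
      simpa using this.symm
    refine Fintype.sum_equiv (Equiv.mulRight (Equiv.swap (Equiv.swap a c b) d * Equiv.swap a c))
      _ _ fun σ => ?_
    have h1 : (Equiv.swap (Equiv.swap a c b) d) c = c :=
      Equiv.swap_apply_of_ne_of_ne hne.symm hcd
    simp [Equiv.Perm.mul_apply, h1]
  have hcount : ∑ i : Fin n, ∑ j : Fin n, (if i ≠ j then (1 : ℝ) else 0) = n * (n - 1) := by
    have : ∀ i : Fin n, ∑ j : Fin n, (if i ≠ j then (1 : ℝ) else 0) = n - 1 := by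
      intro i
      have : ∀ j : Fin n, (if i ≠ j then (1 : ℝ) else 0) = 1 - if i = j then 1 else 0 := by
        intro j; split_ifs <;> simp_all
      simp [this]
    simp only [this, Finset.sum_const, Finset.card_univ, Fintype.card_fin, nsmul_eq_mul]
  have h2 : ∑ σ : Equiv.Perm (Fin n), ∑ c, ∑ d, (if c ≠ d then F (σ c) (σ d) else 0) =
      (n ! : ℝ) * ∑ i, ∑ j, if i ≠ j then F i j else 0 := by
    have : ∀ σ : Equiv.Perm (Fin n), ∑ c, ∑ d, (if c ≠ d then F (σ c) (σ d) else 0) =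
        ∑ i, ∑ j, if i ≠ j then F i j else 0 := by
      intro σ
      refine Fintype.sum_equiv σ _ _ fun c => Fintype.sum_equiv σ _ _ fun d => ?_
      simp [σ.injective.ne_iff]
    simp only [this, Finset.sum_const, Finset.card_univ, Fintype.card_perm, Fintype.card_fin,
      nsmul_eq_mul]
  rw [← h2, Finset.sum_comm, ← hcount, Finset.sum_mul]
  refine Finset.sum_congr rfl fun c _ => ?_
  rw [Finset.sum_comm, Finset.sum_mul]
  refine Finset.sum_congr rfl fun d _ => ?_
  split_ifs with h
  · rw [one_mul, hT c d h]
  · simp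

/-- The U-statistic of order two with kernel `H`. -/
noncomputable def uStat {S : Type*} {n : ℕ} (H : S → S → ℝ) (ξ : Fin n → S) : ℝ :=
  (∑ i, ∑ j, if i ≠ j then H (ξ i) (ξ j) else 0) / (n * (n - 1))

/-- The average of `H` over the pairs `(ξ_{σ(2k)}, ξ_{σ(2k+1)})`. -/
noncomputable def pairAverage {S : Type*} {n : ℕ} (H : S → S → ℝ) (ξ : Fin n → S)
    (σ : Equiv.Perm (Fin n)) : ℝ :=
  ∑ k : Fin (n / 2), ((n / 2 : ℕ) : ℝ)⁻¹ *
    H (ξ (σ ⟨2 * k, by omega⟩)) (ξ (σ ⟨2 * k + 1, by omega⟩))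

/-- Hoeffding's representation. For a fixed `σ` the `n / 2` pairs are disjoint, so under
independence each `pairAverage` is a mean of independent terms, which `uStat` itself is not. -/
theorem uStat_eq_average {S : Type*} {n : ℕ} (hn : 2 ≤ n) (H : S → S → ℝ) (ξ : Fin n → S) :
    uStat H ξ = ∑ σ : Equiv.Perm (Fin n), (n ! : ℝ)⁻¹ * pairAverage H ξ σ := by
  have hm : ((n / 2 : ℕ) : ℝ) ≠ 0 := by
    have : 0 < n / 2 := by omega
    exact_mod_cast this.ne'
  have hn' : (2 : ℝ) ≤ n := by exact_mod_cast hn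
  have hf : (n ! : ℝ) ≠ 0 := by exact_mod_cast n.factorial_ne_zero
  have hnn : (n : ℝ) * (n - 1) ≠ 0 := by
    have : 0 < (n : ℝ) * (n - 1) := by apply mul_pos <;> linarith
    exact this.ne'
  simp only [pairAverage, Finset.mul_sum]
  rw [Finset.sum_comm]
  have : ∀ k : Fin (n / 2), ∑ σ : Equiv.Perm (Fin n), (n ! : ℝ)⁻¹ * (((n / 2 : ℕ) : ℝ)⁻¹ *
      H (ξ (σ ⟨2 * k, by omega⟩)) (ξ (σ ⟨2 * k + 1, by omega⟩))) =
      ((n / 2 : ℕ) : ℝ)⁻¹ * uStat H ξ := by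
    intro k
    have h := sum_perm_eq (fun i j => H (ξ i) (ξ j)) (a := ⟨2 * k, by omega⟩)
      (b := ⟨2 * k + 1, by omega⟩) (by simp)
    rw [← Finset.mul_sum, ← Finset.mul_sum, uStat]
    rw [mul_comm, ← eq_div_iff hnn] at h
    rw [h]
    field_simp
  simp only [this]
  simp only [Finset.sum_const, Finset.card_univ, Fintype.card_fin, nsmul_eq_mul]
  field_simp

variable {S : Type*} [MeasurableSpace S]

/-- Disjoint index pairs read disjoint blocks of an independent family. The induction separates the
block of one pair from the union of the remaining blocks. -/
theorem mgf_sum_pairs {n : ℕ} {ξ : Fin n → Ω → S} (hξ : ∀ i, Measurable (ξ i))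
    (hind : iIndepFun ξ P) {F : S → S → ℝ} (hF : Measurable (Function.uncurry F))
    {ι : Type*} (a b : ι → Fin n) (T : Finset ι)
    (hdisj : ∀ k ∈ T, ∀ l ∈ T, k ≠ l → a k ≠ a l ∧ a k ≠ b l ∧ b k ≠ a l ∧ b k ≠ b l) (θ : ℝ) :
    mgf (fun ω => ∑ k ∈ T, F (ξ (a k) ω) (ξ (b k) ω)) P θ =
      ∏ k ∈ T, mgf (fun ω => F (ξ (a k) ω) (ξ (b k) ω)) P θ := by
  classical
  have hm : ∀ k, Measurable fun ω => F (ξ (a k) ω) (ξ (b k) ω) := fun k =>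
    hF.comp ((hξ _).prodMk (hξ _))
  induction T using Finset.induction_on with
  | empty => simp
  | insert k T hk ih =>
    rw [Finset.prod_insert hk, ← ih fun k' hk' l hl h =>
      hdisj k' (Finset.mem_insert_of_mem hk') l (Finset.mem_insert_of_mem hl) h]
    simp only [Finset.sum_insert hk]
    set A : Finset (Fin n) := {a k, b k} with hA
    set B : Finset (Fin n) := T.image a ∪ T.image b with hB
    have hAB : Disjoint A B := by
      rw [Finset.disjoint_left]
      intro i hi hi'
      have hk' : ∀ l ∈ T, _ := fun l hl => hdisj k (Finset.mem_insert_self _ _) l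
        (Finset.mem_insert_of_mem hl) (by rintro rfl; exact hk hl)
      simp only [hA, hB, Finset.mem_insert, Finset.mem_singleton, Finset.mem_union,
        Finset.mem_image] at hi hi'
      grind
    have hI := hind.indepFun_finset A B hAB hξ
    have haA : a k ∈ A := by simp [hA]
    have hbA : b k ∈ A := by simp [hA]
    -- The sum runs over `T.attach` so that each index carries its membership in `B`, making the sum
    -- a function of the family restricted to `B`.
    have hI2 : IndepFun (fun ω => F (ξ (a k) ω) (ξ (b k) ω))
        (fun ω => ∑ l ∈ T.attach, F (ξ (a l) ω) (ξ (b l) ω)) P := by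
      have hφ : Measurable fun y : A → S => F (y ⟨a k, haA⟩) (y ⟨b k, hbA⟩) :=
        hF.comp (f := fun y : A → S => (y ⟨a k, haA⟩, y ⟨b k, hbA⟩)) (by fun_prop)
      have haB : ∀ l : {x // x ∈ T}, a l ∈ B := fun l =>
        Finset.mem_union_left _ (Finset.mem_image_of_mem _ l.2)
      have hbB : ∀ l : {x // x ∈ T}, b l ∈ B := fun l =>
        Finset.mem_union_right _ (Finset.mem_image_of_mem _ l.2)
      have hψ : Measurable fun y : B → S =>
          ∑ l ∈ T.attach, F (y ⟨a l, haB l⟩) (y ⟨b l, hbB l⟩) :=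
        Finset.measurable_sum _ fun l _ =>
          hF.comp (f := fun y : B → S => (y ⟨a l, haB l⟩, y ⟨b l, hbB l⟩)) (by fun_prop)
      exact hI.comp hφ hψ
    have hs : ∀ ω, ∑ l ∈ T.attach, F (ξ (a l) ω) (ξ (b l) ω) =
        ∑ l ∈ T, F (ξ (a l) ω) (ξ (b l) ω) := fun ω =>
      Finset.sum_attach T fun l => F (ξ (a l) ω) (ξ (b l) ω)
    simp only [hs] at hI2
    exact hI2.mgf_add ((hm k).const_mul θ).exp.aestronglyMeasurable
      ((Finset.measurable_sum _ fun l _ => hm l).const_mul θ).exp.aestronglyMeasurable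

/-- The upper tail in Hoeffding's version of Bernstein's inequality for U-statistics. -/
theorem uStat_bernstein {n : ℕ} (hn : 2 ≤ n) {ξ : Fin n → Ω → S} (hξ : ∀ i, Measurable (ξ i))
    (hind : iIndepFun ξ P) {ν : Measure S} (hlaw : ∀ i, P.map (ξ i) = ν) {H : S → S → ℝ}
    (hH : Measurable (Function.uncurry H)) {M v x : ℝ} (hM : ∀ y y', |H y y'| ≤ M) (hM0 : 0 ≤ M)
    (hv : 0 < v) (hx : 0 ≤ x) (hv2 : ∫ y, H y.1 y.2 ^ 2 ∂(ν.prod ν) ≤ v) :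
    P.real {ω | (∫ y, H y.1 y.2 ∂(ν.prod ν)) + x ≤ uStat H fun i => ξ i ω} ≤
      Real.exp (-(((n / 2 : ℕ) : ℝ) * x ^ 2 / (2 * v + 2 / 3 * M * x))) := by
  have hm : (0 : ℝ) < (n / 2 : ℕ) := by
    have : 0 < n / 2 := by omega
    exact_mod_cast this
  set m : ℝ := ((n / 2 : ℕ) : ℝ) with hmdef
  have hfac : (0 : ℝ) < n ! := by exact_mod_cast n.factorial_pos
  set F : S → S → ℝ := fun y y' => m⁻¹ * H y y' with hFdef
  have hF : Measurable (Function.uncurry F) := hH.const_mul _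
  have hFM : ∀ y y', |F y y'| ≤ M / m := fun y y' => by
    rw [hFdef]; simp only [abs_mul, abs_of_pos (inv_pos.2 hm)]
    rw [div_eq_inv_mul]
    gcongr
    exact hM y y'
  have hHm : ∀ i j, Measurable fun ω => H (ξ i ω) (ξ j ω) := fun i j =>
    hH.comp ((hξ _).prodMk (hξ _))
  have hpm : ∀ σ, Measurable fun ω => pairAverage H (fun i => ξ i ω) σ := fun σ =>
    Finset.measurable_sum _ fun k _ => (hHm _ _).const_mul _
  have hum : Measurable fun ω => uStat H fun i => ξ i ω := by
    refine Measurable.div_const (Finset.measurable_sum _ fun i _ =>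
      Finset.measurable_sum _ fun j _ => ?_) _
    split_ifs
    · exact hHm i j
    · exact measurable_const
  have hpb : ∀ σ ω, |pairAverage H (fun i => ξ i ω) σ| ≤ ∑ _k : Fin (n / 2), M / m := fun σ ω =>
    (Finset.abs_sum_le_sum_abs _ _).trans (Finset.sum_le_sum fun k _ => hFM _ _)
  have hpi : ∀ σ θ, Integrable
      (fun ω => Real.exp (θ * pairAverage H (fun i => ξ i ω) σ)) P := fun σ θ => by
    refine integrable_of_abs_le (M := Real.exp (|θ| * ∑ _k : Fin (n / 2), M / m))
      ((hpm σ).const_mul θ).exp.aemeasurable fun ω => ?_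
    rw [Real.abs_exp]
    refine Real.exp_le_exp.2 ((le_abs_self _).trans ?_)
    rw [abs_mul]
    gcongr
    exact hpb σ ω
  -- Jensen's inequality over the uniform law on permutations: the moment generating function of the
  -- U-statistic is at most the average of those of the `pairAverage`s.
  have hjensen : ∀ θ ω, Real.exp (θ * uStat H fun i => ξ i ω) ≤
      ∑ σ : Equiv.Perm (Fin n), (n ! : ℝ)⁻¹ *
        Real.exp (θ * pairAverage H (fun i => ξ i ω) σ) := by
    intro θ ω
    have := convexOn_exp.map_sum_le (t := (Finset.univ : Finset (Equiv.Perm (Fin n))))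
      (w := fun _ => (n ! : ℝ)⁻¹) (p := fun σ => θ * pairAverage H (fun i => ξ i ω) σ)
      (fun _ _ => by positivity)
      (by simp [Fintype.card_perm, hfac.ne']) (fun _ _ => Set.mem_univ _)
    simp only [smul_eq_mul] at this
    refine le_trans (le_of_eq ?_) this
    rw [uStat_eq_average hn, Finset.mul_sum]
    congr 1
    exact Finset.sum_congr rfl fun σ _ => by ring
  have hsumi : ∀ θ, Integrable (fun ω => ∑ σ : Equiv.Perm (Fin n), (n ! : ℝ)⁻¹ *
        Real.exp (θ * pairAverage H (fun i => ξ i ω) σ)) P := fun θ =>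
    integrable_finsetSum _ fun σ _ => (hpi σ θ).const_mul _
  refine bernstein_tail hv hM0 hm hx (fun θ => ?_) fun θ hθ hθM => ?_
  · refine (hsumi θ).mono' (hum.const_mul θ).exp.aestronglyMeasurable (ae_of_all _ fun ω => ?_)
    rw [Real.norm_eq_abs, Real.abs_exp]
    exact hjensen θ ω
  · set R := Real.exp (θ * (∫ y, H y.1 y.2 ∂(ν.prod ν)) +
      v * (θ ^ 2 / (2 * m * (1 - θ * M / (3 * m))))) with hR
    have hone : ∀ σ : Equiv.Perm (Fin n),
        mgf (fun ω => pairAverage H (fun i => ξ i ω) σ) P θ ≤ R := by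
      intro σ
      set a : Fin (n / 2) → Fin n := fun k => σ ⟨2 * k, by omega⟩ with ha
      set b : Fin (n / 2) → Fin n := fun k => σ ⟨2 * k + 1, by omega⟩ with hb
      have hdisj : ∀ k ∈ (Finset.univ : Finset (Fin (n / 2))), ∀ l ∈ Finset.univ, k ≠ l →
          a k ≠ a l ∧ a k ≠ b l ∧ b k ≠ a l ∧ b k ≠ b l := by
        intro k _ l _ hkl
        have : (k : ℕ) ≠ l := fun h => hkl (Fin.ext h)
        simp only [ha, hb, ne_eq, σ.injective.eq_iff, Fin.mk.injEq]
        omega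
      have h1 : mgf (fun ω => pairAverage H (fun i => ξ i ω) σ) P θ =
          ∏ k : Fin (n / 2), mgf (fun ω => F (ξ (a k) ω) (ξ (b k) ω)) P θ :=
        mgf_sum_pairs hξ hind hF a b Finset.univ hdisj θ
      rw [h1]
      have h2 : ∀ k ∈ (Finset.univ : Finset (Fin (n / 2))),
          mgf (fun ω => F (ξ (a k) ω) (ξ (b k) ω)) P θ ≤
          Real.exp (θ * (m⁻¹ * ∫ y, H y.1 y.2 ∂(ν.prod ν)) +
            v / m ^ 2 * (θ ^ 2 / (2 * (1 - θ * (M / m) / 3)))) := by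
        intro k _
        have hne : a k ≠ b k := by simp [ha, hb, σ.injective.eq_iff]
        -- Each pair consists of two distinct observations, so its moments are integrals against `ν
        -- ⊗ ν`, whatever `σ` is.
        have hmap : P.map (fun ω => (ξ (a k) ω, ξ (b k) ω)) = ν.prod ν := by
          have := (indepFun_iff_map_prod_eq_prod_map_map (hξ (a k)).aemeasurable
            (hξ (b k)).aemeasurable).1 (hind.indepFun hne)
          rw [this, hlaw, hlaw]
        have hpair : Measurable fun ω => (ξ (a k) ω, ξ (b k) ω) := (hξ _).prodMk (hξ _)
        have hint : ∀ G : S × S → ℝ, Measurable G →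
            ∫ ω, G (ξ (a k) ω, ξ (b k) ω) ∂P = ∫ y, G y ∂(ν.prod ν) := fun G hG => by
          rw [← hmap, integral_map hpair.aemeasurable hG.aestronglyMeasurable]
        have e1 : ∫ ω, F (ξ (a k) ω) (ξ (b k) ω) ∂P = m⁻¹ * ∫ y, H y.1 y.2 ∂(ν.prod ν) := by
          rw [← integral_const_mul]
          exact hint (fun y => m⁻¹ * H y.1 y.2) (hH.const_mul _)
        rw [← e1]
        refine mgf_le_of_abs_le (hF.comp hpair).aemeasurable (fun ω => hFM _ _) ?_ hθ ?_
        · have e2 : ∫ ω, F (ξ (a k) ω) (ξ (b k) ω) ^ 2 ∂P =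
              (m ^ 2)⁻¹ * ∫ y, H y.1 y.2 ^ 2 ∂(ν.prod ν) := by
            rw [← integral_const_mul]
            rw [hint (fun y => (m⁻¹ * H y.1 y.2) ^ 2) ((hH.const_mul _).pow_const 2)]
            exact integral_congr_ae (ae_of_all _ fun y => by simp only; ring)
          refine e2.trans_le ?_
          rw [div_eq_inv_mul]
          gcongr
        · rw [← mul_div_assoc, div_lt_iff₀ hm]; exact hθM
      refine (Finset.prod_le_prod (fun i _ => mgf_nonneg) h2).trans (le_of_eq ?_)
      rw [Finset.prod_const, Finset.card_univ, Fintype.card_fin, ← Real.exp_nat_mul, ← hmdef, hR]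
      congr 1
      have : θ * (M / m) / 3 = θ * M / (3 * m) := by field_simp
      rw [this, mul_add]
      have h5 : (1 - θ * M / (3 * m)) ≠ 0 := by
        have : θ * M / (3 * m) < 1 := by rw [div_lt_one (by positivity)]; exact hθM
        linarith
      congr 1
      · field_simp
      · generalize 1 - θ * M / (3 * m) = w at h5
        field_simp
    calc mgf (fun ω => uStat H fun i => ξ i ω) P θ
        ≤ ∫ ω, ∑ σ : Equiv.Perm (Fin n), (n ! : ℝ)⁻¹ *
            Real.exp (θ * pairAverage H (fun i => ξ i ω) σ) ∂P :=
          integral_mono_of_nonneg (ae_of_all _ fun ω => (Real.exp_pos _).le) (hsumi θ)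
            (ae_of_all _ (hjensen θ))
      _ = ∑ σ : Equiv.Perm (Fin n), (n ! : ℝ)⁻¹ *
            mgf (fun ω => pairAverage H (fun i => ξ i ω) σ) P θ := by
          rw [integral_finsetSum _ fun σ _ => (hpi σ θ).const_mul _]
          exact Finset.sum_congr rfl fun σ _ => integral_const_mul _ _
      _ ≤ ∑ _σ : Equiv.Perm (Fin n), (n ! : ℝ)⁻¹ * R := by
          gcongr with σ
          exact hone σ
      _ = R := by
          simp only [Finset.sum_const, Finset.card_univ, Fintype.card_perm, Fintype.card_fin,
            nsmul_eq_mul]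
          field_simp

end CondKendall

namespace CondKendall

/-! ### Taylor expansions along lines -/

/-- Taylor's inequality for a function `c 0` with successive derivatives `c 1, …, c m`. -/
theorem taylor_bound (m : ℕ) (c : ℕ → ℝ → ℝ)
    (hc : ∀ j < m, ∀ r, HasDerivAt (c j) (c (j + 1) r) r) {h B : ℝ}
    (hB : ∀ r ∈ Set.Icc 0 h, |c m r| ≤ B) :
    ∀ r ∈ Set.Icc 0 h, |c 0 r - ∑ j ∈ Finset.range m, c j 0 * (r ^ j / (j ! : ℝ))| ≤
      B * (r ^ m / (m ! : ℝ)) := by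
  induction m generalizing c with
  | zero => simpa using hB
  | succ m ih =>
    -- The derivative of the remainder is the remainder of the shifted sequence; a comparison of
    -- derivatives integrates its bound without any continuity of the top derivative.
    have ih' := ih (fun j => c (j + 1)) (fun j hj r => hc (j + 1) (by omega) r) hB
    set D : ℝ → ℝ := fun r => c 0 r - ∑ j ∈ Finset.range (m + 1), c j 0 * (r ^ j / (j ! : ℝ))
      with hD
    have hmono : ∀ j r, HasDerivAt (fun r : ℝ => r ^ (j + 1) / ((j + 1)! : ℝ))
        (r ^ j / (j ! : ℝ)) r := by
      intro j r
      refine ((hasDerivAt_pow (j + 1) r).div_const _).congr_deriv ?_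
      have : (j ! : ℝ) ≠ 0 := by exact_mod_cast j.factorial_ne_zero
      rw [Nat.factorial_succ]
      push_cast
      field_simp
    have hD' : ∀ r, HasDerivAt D
        (c 1 r - ∑ j ∈ Finset.range m, c (j + 1) 0 * (r ^ j / (j ! : ℝ))) r := by
      intro r
      have hD2 : D = fun r => c 0 r - (∑ j ∈ Finset.range m,
          c (j + 1) 0 * (r ^ (j + 1) / ((j + 1)! : ℝ)) + c 0 0) := by
        funext r
        rw [hD]
        simp only [Finset.sum_range_succ']
        simp
      rw [hD2]
      refine (hc 0 (by omega) r).sub (HasDerivAt.add_const _ ?_)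
      exact HasDerivAt.fun_sum fun j _ => (hmono j r).const_mul _
    have hfence := image_norm_le_of_norm_deriv_right_le_deriv_boundary (a := 0) (b := h)
      (f := D) (B := fun r => B * (r ^ (m + 1) / ((m + 1)! : ℝ)))
      (B' := fun r => B * (r ^ m / (m ! : ℝ)))
      (fun r _ => (hD' r).continuousAt.continuousWithinAt)
      (fun r _ => (hD' r).hasDerivWithinAt)
      (by simp [hD, Finset.sum_range_succ']) (fun r => (hmono m r).const_mul B)
      (fun r hr => ih' r ⟨hr.1, hr.2.le⟩)
    exact fun r hr => hfence hr

/-- The supremum of the derivative along a segment may be infinite for some directions; in `ℝ≥0∞`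
the bound is then trivial. -/
theorem taylor_bound_enorm (m : ℕ) (c : ℕ → ℝ → ℝ)
    (hc : ∀ j < m, ∀ r, HasDerivAt (c j) (c (j + 1) r) r) {h : ℝ} (hh : 0 < h) {B : ℝ≥0∞}
    (hB : ∀ r ∈ Set.Icc 0 h, ‖c m r‖ₑ ≤ B) :
    ‖c 0 h - ∑ j ∈ Finset.range m, c j 0 * (h ^ j / (j ! : ℝ))‖ₑ ≤
      ENNReal.ofReal (h ^ m / (m ! : ℝ)) * B := by
  have hpos : 0 < h ^ m / (m ! : ℝ) := by positivity
  rcases eq_or_ne B ⊤ with rfl | hBt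
  · rw [ENNReal.mul_top (by simpa using hpos)]
    exact le_top
  have := taylor_bound m c hc (B := B.toReal) (fun r hr => by
    have := hB r hr
    rw [← Real.norm_eq_abs, ← toReal_enorm]
    exact ENNReal.toReal_mono hBt this) h ⟨hh.le, le_rfl⟩
  rw [Real.enorm_eq_ofReal_abs]
  refine (ENNReal.ofReal_le_ofReal this).trans (le_of_eq ?_)
  rw [mul_comm, ENNReal.ofReal_mul hpos.le, ENNReal.ofReal_toReal hBt]

variable {p : ℕ}

/-- The `k`-th derivative of `r ↦ w (z + r u)`. -/
noncomputable def lineDerivIter (w : Cov p → ℝ) (z u : Cov p) (k : ℕ) (r : ℝ) : ℝ :=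
  iteratedFDeriv ℝ k w (z + r • u) fun _ => u

theorem lineDerivIter_zero (w : Cov p → ℝ) (z u : Cov p) (r : ℝ) :
    lineDerivIter w z u 0 r = w (z + r • u) := by simp [lineDerivIter]

theorem hasDerivAt_lineDerivIter {w : Cov p → ℝ} {k : ℕ}
    (hw : Differentiable ℝ (iteratedFDeriv ℝ k w)) (z u : Cov p) (r : ℝ) :
    HasDerivAt (lineDerivIter w z u k) (lineDerivIter w z u (k + 1) r) r := by
  have h1 : HasDerivAt (fun r : ℝ => z + r • u) u r := by
    simpa using ((hasDerivAt_id r).smul_const u).const_add z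
  have h2 := (hw (z + r • u)).hasFDerivAt.comp_hasDerivAt r h1
  have h3 := ((ContinuousMultilinearMap.apply ℝ (fun _ : Fin k => Cov p) ℝ
    fun _ => u).hasFDerivAt).comp_hasDerivAt r h2
  -- Inserting one more `u` in the first slot is, by definition of `iteratedFDeriv`, differentiating
  -- once more in direction `u`.
  exact h3

/-- Leibniz' rule for sequences of successive derivatives. -/
theorem hasDerivAt_leibniz {a b : ℕ → ℝ → ℝ} {m : ℕ}
    (ha : ∀ j < m, ∀ r, HasDerivAt (a j) (a (j + 1) r) r)
    (hb : ∀ j < m, ∀ r, HasDerivAt (b j) (b (j + 1) r) r) :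
    ∀ j < m, ∀ r, HasDerivAt
      (fun r => ∑ i ∈ Finset.HasAntidiagonal.antidiagonal j, (j.choose i.1 : ℝ) * (a i.1 r * b i.2 r))
      (∑ i ∈ Finset.HasAntidiagonal.antidiagonal (j + 1), ((j + 1).choose i.1 : ℝ) * (a i.1 r * b i.2 r)) r := by
  intro j hj r
  have h : HasDerivAt
      (fun r => ∑ i ∈ Finset.HasAntidiagonal.antidiagonal j, (j.choose i.1 : ℝ) * (a i.1 r * b i.2 r))
      (∑ i ∈ Finset.HasAntidiagonal.antidiagonal j, (j.choose i.1 : ℝ) *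
        (a (i.1 + 1) r * b i.2 r + a i.1 r * b (i.2 + 1) r)) r := by
    refine HasDerivAt.fun_sum fun i hi => HasDerivAt.const_mul _ ?_
    have := Finset.HasAntidiagonal.mem_antidiagonal.1 hi
    exact (ha i.1 (by omega) r).mul (hb i.2 (by omega) r)
  refine h.congr_deriv ?_
  rw [Finset.sum_antidiagonal_choose_succ_mul fun k l => a k r * b l r, ← Finset.sum_add_distrib]
  refine Finset.sum_congr rfl fun i hi => ?_
  have := Finset.HasAntidiagonal.mem_antidiagonal.1 hi
  have hch : j.choose i.2 = j.choose i.1 := by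
    rw [← Nat.choose_symm_of_eq_add (by omega : j = i.1 + i.2)]
  rw [hch]; ring

/-- Expansion in the canonical basis. It turns directional derivatives into partial derivatives
times monomials, the form in which the moments of `K` and the smoothness assumptions are given. -/
theorem multilinear_apply_diag {k : ℕ}
    (T : ContinuousMultilinearMap ℝ (fun _ : Fin k => Cov p) ℝ) (u : Cov p) :
    (T fun _ => u) = ∑ ι : Fin k → Fin p,
      (T fun l => EuclideanSpace.single (ι l) (1 : ℝ)) * ∏ l, u (ι l) := by
  have hu : u = ∑ i, u i • EuclideanSpace.single i (1 : ℝ) := by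
    ext j
    simp [Finset.sum_apply, Pi.single_apply]
  conv_lhs => rw [hu]
  rw [T.map_sum fun _ i => u i • EuclideanSpace.single i (1 : ℝ)]
  refine Finset.sum_congr rfl fun ι _ => ?_
  rw [T.map_smul_univ]
  simp [mul_comm]

theorem lineDerivIter_eq (w : Cov p → ℝ) (z u : Cov p) (k : ℕ) (r : ℝ) :
    lineDerivIter w z u k r =
      ∑ ι : Fin k → Fin p, partialDeriv w ι (z + r • u) * ∏ l, u (ι l) :=
  multilinear_apply_diag _ _

/-! ### Vanishing moments of the kernel against multilinear forms. -/

namespace IsKernelOfOrder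

variable {K : Cov p → ℝ} {α : ℕ}

theorem integrable_mul_multilinear (hK : IsKernelOfOrder K α) {k : ℕ} (hk : k < α)
    (T : ContinuousMultilinearMap ℝ (fun _ : Fin k => Cov p) ℝ) :
    Integrable fun u => K u * T fun _ => u := by
  simp_rw [multilinear_apply_diag T, Finset.mul_sum]
  refine integrable_finsetSum _ fun ι _ => ?_
  have : Integrable fun u => K u * ∏ l, u (ι l) := by
    -- The moment assumption starts at degree one; degree zero is the integrability of `K` itself.
    rcases Nat.eq_zero_or_pos k with rfl | hk0
    · simpa using hK.integrable
    · exact (hK.moments k hk0 hk ι).1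
  refine (this.const_mul (T fun l => EuclideanSpace.single (ι l) (1 : ℝ))).congr
    (ae_of_all _ fun u => ?_)
  simp only; ring

theorem integral_mul_multilinear (hK : IsKernelOfOrder K α) {k : ℕ} (hk0 : 1 ≤ k) (hk : k < α)
    (T : ContinuousMultilinearMap ℝ (fun _ : Fin k => Cov p) ℝ) :
    ∫ u, K u * (T fun _ => u) = 0 := by
  simp_rw [multilinear_apply_diag T, Finset.mul_sum, ← mul_assoc, mul_comm (K _), mul_assoc]
  rw [integral_finsetSum]
  · refine Finset.sum_eq_zero fun ι _ => ?_
    rw [integral_const_mul, (hK.moments k hk0 hk ι).2, mul_zero]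
  · exact fun ι _ => (hK.moments k hk0 hk ι).1.const_mul _

theorem integrable_mul_lineDerivIter (hK : IsKernelOfOrder K α) (w : Cov p → ℝ) (z : Cov p)
    {k : ℕ} (hk : k < α) : Integrable fun u => K u * lineDerivIter w z u k 0 := by
  simpa [lineDerivIter] using hK.integrable_mul_multilinear hk (iteratedFDeriv ℝ k w z)

theorem integral_mul_lineDerivIter (hK : IsKernelOfOrder K α) (w : Cov p → ℝ) (z : Cov p)
    {k : ℕ} (hk0 : 1 ≤ k) (hk : k < α) : ∫ u, K u * lineDerivIter w z u k 0 = 0 := by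
  simpa [lineDerivIter] using hK.integral_mul_multilinear hk0 hk (iteratedFDeriv ℝ k w z)

end IsKernelOfOrder

/-! ### Bias of the kernel smoothers -/

theorem enorm_lineDerivIter_le (w : Cov p → ℝ) (z u : Cov p) (k : ℕ) {r : ℝ}
    (hr : r ∈ Set.Icc (0 : ℝ) 1) :
    ‖lineDerivIter w z u k r‖ₑ ≤ ∑ ι : Fin k → Fin p, ‖∏ l, u (ι l)‖ₑ *
      ⨆ t ∈ Set.Icc (0 : ℝ) 1, ‖partialDeriv w ι (z + t • u)‖ₑ := by
  rw [lineDerivIter_eq]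
  refine (enorm_sum_le _ _).trans (Finset.sum_le_sum fun ι _ => ?_)
  rw [enorm_mul, mul_comm]
  gcongr
  exact le_iSup₂ (f := fun t (_ : t ∈ Set.Icc (0 : ℝ) 1) => ‖partialDeriv w ι (z + t • u)‖ₑ) r hr

/-- Bias of the kernel smoother of the covariate density. -/
theorem marginal_bias {K w : Cov p → ℝ} {𝒵 : Set (Cov p)} {α : ℕ} (hα : 1 ≤ α) {C : ℝ}
    (hC : 0 ≤ C) (hK : IsKernelOfOrder K α) (hw : MarginalSmooth K w 𝒵 α C) {z : Cov p}
    (hz : z ∈ 𝒵) {h : ℝ} (hh : 0 < h) (hh1 : h ≤ 1)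
    (hint : Integrable fun u => K u * w (z + h • u)) :
    |(∫ u, K u * w (z + h • u)) - w z| ≤ h ^ α / (α ! : ℝ) * C := by
  obtain ⟨m, rfl⟩ : ∃ m, α = m + 1 := ⟨α - 1, by omega⟩
  -- `R` is the Taylor remainder of order `α`. Against `K` the degree-zero term gives `w z` and
  -- those of degrees `1, …, α - 1` vanish, so the bias is `∫ K R`.
  set R : Cov p → ℝ := fun u => w (z + h • u) -
    ∑ j ∈ Finset.range (m + 1), lineDerivIter w z u j 0 * (h ^ j / (j ! : ℝ)) with hR
  have hterm : ∀ j ∈ Finset.range m,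
      Integrable fun u => K u * lineDerivIter w z u (j + 1) 0 * (h ^ (j + 1) / ((j + 1)! : ℝ)) :=
    fun j hj => (hK.integrable_mul_lineDerivIter w z
      (by have := Finset.mem_range.1 hj; omega)).mul_const _
  have hKR : ∀ u, K u * R u = K u * w (z + h • u) - K u * w z - ∑ j ∈ Finset.range m,
      K u * lineDerivIter w z u (j + 1) 0 * (h ^ (j + 1) / ((j + 1)! : ℝ)) := by
    intro u
    simp only [hR, Finset.sum_range_succ', mul_sub, mul_add, Finset.mul_sum]
    simp [lineDerivIter_zero, mul_assoc]
    ring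
  have hintR : ∫ u, K u * R u = (∫ u, K u * w (z + h • u)) - w z := by
    simp_rw [hKR]
    have hint' : Integrable fun u => K u * w (z + h • u) - K u * w z :=
      hint.sub (hK.integrable.mul_const _)
    rw [integral_sub hint' (integrable_finsetSum _ hterm),
      integral_sub hint (hK.integrable.mul_const _), integral_finsetSum _ hterm,
      integral_mul_const, hK.integral_eq_one, one_mul]
    simp only [integral_mul_const]
    rw [Finset.sum_eq_zero, sub_zero]
    intro j hj
    rw [hK.integral_mul_lineDerivIter w z (by omega)
      (by have := Finset.mem_range.1 hj; omega), zero_mul]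
  have hbound : ∀ u, ‖K u * R u‖ₑ ≤ ENNReal.ofReal (h ^ (m + 1) / ((m + 1)! : ℝ)) *
      (‖K u‖ₑ * ∑ ι : Fin (m + 1) → Fin p, ‖∏ l, u (ι l)‖ₑ *
        ⨆ t ∈ Set.Icc (0 : ℝ) 1, ‖partialDeriv w ι (z + t • u)‖ₑ) := by
    intro u
    rw [enorm_mul, mul_left_comm]
    gcongr
    have := taylor_bound_enorm (m + 1) (lineDerivIter w z u)
      (fun j hj r => hasDerivAt_lineDerivIter
        (hw.1.differentiable_iteratedFDeriv (by exact_mod_cast hj)) z u r) hh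
      -- `h ≤ 1` keeps the segment `[0, h]` inside the range `[0, 1]` of the supremum.
      (fun r hr => enorm_lineDerivIter_le w z u (m + 1) ⟨hr.1, hr.2.trans hh1⟩)
    rwa [lineDerivIter_zero] at this
  rw [← hintR, ← Real.norm_eq_abs, ← toReal_enorm]
  refine ENNReal.toReal_le_of_le_ofReal (by positivity) ?_
  refine (enorm_integral_le_lintegral_enorm _).trans ((lintegral_mono hbound).trans ?_)
  rw [lintegral_const_mul' _ _ ENNReal.ofReal_ne_top, ENNReal.ofReal_mul (by positivity)]
  gcongr
  exact hw.2 z hz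

/-- Cutting a multi-index after `k` entries is a bijection. It merges the product of two expansions
into the single sum of the smoothness assumption. -/
theorem sum_head_tail {α : ℕ} (k : Fin (α + 1)) {M : Type*} [AddCommMonoid M]
    (F : (Fin k.val → Fin p) → (Fin (α - k.val) → Fin p) → M) :
    ∑ a, ∑ b, F a b = ∑ ι : Fin α → Fin p, F (headIdx k ι) (tailIdx k ι) := by
  rw [← Fintype.sum_prod_type' F]
  symm
  have hk := k.2
  refine Fintype.sum_equiv
    { toFun := fun ι => (headIdx k ι, tailIdx k ι)
      invFun := fun y i => if hi : i.val < k.val then y.1 ⟨i, hi⟩ else y.2 ⟨i - k, by omega⟩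
      left_inv := fun ι => by
        funext i
        by_cases hi : i.val < k.val
        · simp [hi, headIdx]
        · simp only [hi, dite_false, tailIdx]
          congr 1
          ext
          simp only
          omega
      right_inv := fun y => by
        refine Prod.ext ?_ ?_
        · funext l
          simp [headIdx]
        · funext l
          simp [tailIdx] } _ _ fun ι => rfl

/-- The left side is the `α`-th derivative of `r ↦ f(x₁, z + r u) f(x₂, z + r v)` by Leibniz' rule;
the right side is `holderIntegrand` without its kernel factors. -/
theorem enorm_leibniz_le (f : ℝ × ℝ → Cov p → ℝ) (α : ℕ) (z u v : Cov p) (x₁ x₂ : ℝ × ℝ) {r : ℝ}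
    (hr : r ∈ Set.Icc (0 : ℝ) 1) :
    ‖∑ i ∈ Finset.HasAntidiagonal.antidiagonal α, (α.choose i.1 : ℝ) *
      (lineDerivIter (f x₁) z u i.1 r * lineDerivIter (f x₂) z v i.2 r)‖ₑ ≤
    ∑ k : Fin (α + 1), (Nat.choose α k.val : ℝ≥0∞) *
      ∑ ι : Fin α → Fin p, holderSup f k ι u v x₁ x₂ z *
        ‖(∏ l, u (headIdx k ι l)) * ∏ l, v (tailIdx k ι l)‖ₑ := by
  rw [Finset.Nat.sum_antidiagonal_eq_sum_range_succ fun k l => (α.choose k : ℝ) *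
      (lineDerivIter (f x₁) z u k r * lineDerivIter (f x₂) z v l r), Nat.succ_eq_add_one,
    Finset.sum_range]
  refine (enorm_sum_le _ _).trans (Finset.sum_le_sum fun k _ => ?_)
  rw [enorm_mul]
  have : ‖(α.choose k.val : ℝ)‖ₑ = (Nat.choose α k.val : ℝ≥0∞) := by
    rw [Real.enorm_of_nonneg (Nat.cast_nonneg _), ENNReal.ofReal_natCast]
  rw [this]
  gcongr
  rw [lineDerivIter_eq, lineDerivIter_eq, Finset.sum_mul_sum, sum_head_tail k fun a b =>
    partialDeriv (f x₁) a (z + r • u) * (∏ l, u (a l)) *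
      (partialDeriv (f x₂) b (z + r • v) * ∏ l, v (b l))]
  refine (enorm_sum_le _ _).trans (Finset.sum_le_sum fun ι _ => ?_)
  rw [mul_mul_mul_comm, enorm_mul]
  gcongr
  exact le_iSup₂ (f := fun t (_ : t ∈ Set.Icc (0 : ℝ) 1) =>
    ‖partialDeriv (f x₁) (headIdx k ι) (z + t • u) *
      partialDeriv (f x₂) (tailIdx k ι) (z + t • v)‖ₑ) r hr

/-- Bias of the product kernel smoother of `f(x₁, ·) f(x₂, ·)` for fixed `x₁`, `x₂`. -/
theorem pair_bias {K : Cov p → ℝ} {α : ℕ} (hα : 1 ≤ α) (hK : IsKernelOfOrder K α)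
    (f : ℝ × ℝ → Cov p → ℝ) {x₁ x₂ : ℝ × ℝ}
    (h₁ : ∀ j : ℕ, j < α → Differentiable ℝ (iteratedFDeriv ℝ j (f x₁)))
    (h₂ : ∀ j : ℕ, j < α → Differentiable ℝ (iteratedFDeriv ℝ j (f x₂))) (z : Cov p)
    {h : ℝ} (hh : 0 < h) (hh1 : h ≤ 1)
    (hint : Integrable fun y : Cov p × Cov p =>
      K y.1 * K y.2 * (f x₁ (z + h • y.1) * f x₂ (z + h • y.2) - f x₁ z * f x₂ z)) :
    ‖∫ y : Cov p × Cov p,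
      K y.1 * K y.2 * (f x₁ (z + h • y.1) * f x₂ (z + h • y.2) - f x₁ z * f x₂ z)‖ₑ ≤
    ENNReal.ofReal (h ^ α / (α ! : ℝ)) *
      ∫⁻ y : Cov p × Cov p, holderIntegrand α K f z (y, (x₁, x₂)) := by
  obtain ⟨m, rfl⟩ : ∃ m, α = m + 1 := ⟨α - 1, by omega⟩
  set c : Cov p × Cov p → ℕ → ℝ → ℝ := fun y j r => ∑ i ∈ Finset.HasAntidiagonal.antidiagonal j,
    (j.choose i.1 : ℝ) * (lineDerivIter (f x₁) z y.1 i.1 r * lineDerivIter (f x₂) z y.2 i.2 r)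
    with hc
  have hc0 : ∀ y r, c y 0 r = f x₁ (z + r • y.1) * f x₂ (z + r • y.2) := by
    intro y r; simp [hc, lineDerivIter_zero]
  set R : Cov p × Cov p → ℝ := fun y => c y 0 h -
    ∑ j ∈ Finset.range (m + 1), c y j 0 * (h ^ j / (j ! : ℝ)) with hR
  -- In a Leibniz term of total degree between `1` and `α - 1`, at least one factor has degree in
  -- that same range, and its kernel moment vanishes.
  have hterm : ∀ j ∈ Finset.range m,
      Integrable (fun y : Cov p × Cov p =>
        K y.1 * K y.2 * (c y (j + 1) 0 * (h ^ (j + 1) / ((j + 1)! : ℝ)))) ∧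
      ∫ y : Cov p × Cov p, K y.1 * K y.2 *
        (c y (j + 1) 0 * (h ^ (j + 1) / ((j + 1)! : ℝ))) = 0 := by
    intro j hj
    have hj' := Finset.mem_range.1 hj
    have hsum : ∀ y : Cov p × Cov p, K y.1 * K y.2 *
        (c y (j + 1) 0 * (h ^ (j + 1) / ((j + 1)! : ℝ))) =
        ∑ i ∈ Finset.HasAntidiagonal.antidiagonal (j + 1),
          (h ^ (j + 1) / ((j + 1)! : ℝ) * ((j + 1).choose i.1 : ℝ)) *
            ((K y.1 * lineDerivIter (f x₁) z y.1 i.1 0) *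
              (K y.2 * lineDerivIter (f x₂) z y.2 i.2 0)) := by
      intro y
      simp only [hc, Finset.sum_mul, Finset.mul_sum]
      exact Finset.sum_congr rfl fun i _ => by ring
    have hi : ∀ i ∈ Finset.HasAntidiagonal.antidiagonal (j + 1), Integrable fun y : Cov p × Cov p =>
          (h ^ (j + 1) / ((j + 1)! : ℝ) * ((j + 1).choose i.1 : ℝ)) *
            ((K y.1 * lineDerivIter (f x₁) z y.1 i.1 0) *
              (K y.2 * lineDerivIter (f x₂) z y.2 i.2 0)) := by
      intro i hi
      have := Finset.HasAntidiagonal.mem_antidiagonal.1 hi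
      exact ((hK.integrable_mul_lineDerivIter (f x₁) z (by omega)).mul_prod
        (hK.integrable_mul_lineDerivIter (f x₂) z (by omega))).const_mul _
    simp_rw [hsum]
    refine ⟨integrable_finsetSum _ hi, ?_⟩
    rw [integral_finsetSum _ hi]
    refine Finset.sum_eq_zero fun i hi => ?_
    have := Finset.HasAntidiagonal.mem_antidiagonal.1 hi
    rw [integral_const_mul]
    have hprod := integral_prod_mul (μ := (volume : Measure (Cov p)))
      (ν := (volume : Measure (Cov p)))
      (fun u => K u * lineDerivIter (f x₁) z u i.1 0)
      (fun u => K u * lineDerivIter (f x₂) z u i.2 0)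
    rw [Measure.volume_eq_prod, hprod]
    rcases Nat.eq_zero_or_pos i.1 with h0 | h0
    · rw [hK.integral_mul_lineDerivIter (f x₂) z (by omega) (by omega), mul_zero, mul_zero]
    · rw [hK.integral_mul_lineDerivIter (f x₁) z (by omega) (by omega), zero_mul, mul_zero]
  have hKR : ∀ y : Cov p × Cov p, K y.1 * K y.2 * R y =
      K y.1 * K y.2 * (f x₁ (z + h • y.1) * f x₂ (z + h • y.2) - f x₁ z * f x₂ z) -
      ∑ j ∈ Finset.range m, K y.1 * K y.2 *
        (c y (j + 1) 0 * (h ^ (j + 1) / ((j + 1)! : ℝ))) := by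
    intro y
    rw [hR]
    simp only [Finset.sum_range_succ', hc0, ← Finset.mul_sum]
    simp
    ring
  have hintR : ∫ y : Cov p × Cov p, K y.1 * K y.2 * R y = ∫ y : Cov p × Cov p,
      K y.1 * K y.2 * (f x₁ (z + h • y.1) * f x₂ (z + h • y.2) - f x₁ z * f x₂ z) := by
    simp_rw [hKR]
    rw [integral_sub hint (integrable_finsetSum _ fun j hj => (hterm j hj).1),
      integral_finsetSum _ fun j hj => (hterm j hj).1, Finset.sum_eq_zero, sub_zero]
    exact fun j hj => (hterm j hj).2
  rw [← hintR]
  refine (enorm_integral_le_lintegral_enorm _).trans ?_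
  rw [← lintegral_const_mul' _ _ ENNReal.ofReal_ne_top]
  refine lintegral_mono fun y => ?_
  rw [enorm_mul, enorm_mul, holderIntegrand, mul_left_comm]
  gcongr
  exact taylor_bound_enorm (m + 1) (c y)
    (hasDerivAt_leibniz (fun j hj r => hasDerivAt_lineDerivIter (h₁ j hj) z y.1 r)
      (fun j hj r => hasDerivAt_lineDerivIter (h₂ j hj) z y.2 r)) hh
    (fun r hr => enorm_leibniz_le f (m + 1) z y.1 y.2 x₁ x₂ ⟨hr.1, hr.2.trans hh1⟩)

end CondKendall

namespace CondKendall

/-! ### The conditional Kendall's tau as an integral -/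

theorem measurable_g₁ : Measurable (Function.uncurry g₁) := by
  refine Measurable.sub_const (Measurable.const_mul (Measurable.ite ?_ measurable_const
    measurable_const) _) _
  have m1 : MeasurableSet {y : (ℝ × ℝ) × (ℝ × ℝ) | y.1.1 < y.2.1} :=
    measurableSet_lt (by fun_prop) (by fun_prop)
  have m2 : MeasurableSet {y : (ℝ × ℝ) × (ℝ × ℝ) | y.1.2 < y.2.2} :=
    measurableSet_lt (by fun_prop) (by fun_prop)
  exact m1.inter m2

theorem measurable_g₂ : Measurable (Function.uncurry g₂) := by
  refine Measurable.sub (Measurable.ite ?_ measurable_const measurable_const)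
    (Measurable.ite ?_ measurable_const measurable_const)
  · exact measurableSet_lt (by fun_prop) (by fun_prop)
  · exact measurableSet_lt (by fun_prop) (by fun_prop)

theorem measurable_g₃ : Measurable (Function.uncurry g₃) := by
  refine Measurable.const_sub (Measurable.const_mul (Measurable.ite ?_ measurable_const
    measurable_const) _) _
  have m1 : MeasurableSet {y : (ℝ × ℝ) × (ℝ × ℝ) | y.1.1 < y.2.1} :=
    measurableSet_lt (by fun_prop) (by fun_prop)
  have m2 : MeasurableSet {y : (ℝ × ℝ) × (ℝ × ℝ) | y.2.2 < y.1.2} :=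
    measurableSet_lt (by fun_prop) (by fun_prop)
  exact m1.inter m2

theorem abs_g₁_le (x y : ℝ × ℝ) : |g₁ x y| ≤ 3 := by
  unfold g₁; split_ifs <;> norm_num

theorem abs_g₂_le (x y : ℝ × ℝ) : |g₂ x y| ≤ 3 := by
  unfold g₂; split_ifs <;> norm_num

theorem abs_g₃_le (x y : ℝ × ℝ) : |g₃ x y| ≤ 3 := by
  unfold g₃; split_ifs <;> norm_num

/-- Away from ties the symmetrisation of `g₁` is `g₂`, so both have the same mean under an
exchangeable law without ties. -/
theorem g₁_add_swap {x y : ℝ × ℝ} (h1 : x.1 ≠ y.1) (h2 : x.2 ≠ y.2) :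
    g₁ x y + g₁ y x = 2 * g₂ x y := by
  unfold g₁ g₂
  rcases lt_or_gt_of_ne h1 with a | a <;> rcases lt_or_gt_of_ne h2 with b | b <;>
  simp only [mul_pos_iff, mul_neg_iff, sub_pos, sub_neg, a, b, a.not_gt, b.not_gt] <;> norm_num

theorem g₃_add_swap {x y : ℝ × ℝ} (h1 : x.1 ≠ y.1) (h2 : x.2 ≠ y.2) :
    g₃ x y + g₃ y x = 2 * g₂ x y := by
  unfold g₃ g₂
  rcases lt_or_gt_of_ne h1 with a | a <;> rcases lt_or_gt_of_ne h2 with b | b <;>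
  simp only [mul_pos_iff, mul_neg_iff, sub_pos, sub_neg, a, b, a.not_gt, b.not_gt] <;> norm_num

theorem ae_no_ties : ∀ᵐ x : (ℝ × ℝ) × (ℝ × ℝ), x.1.1 ≠ x.2.1 ∧ x.1.2 ≠ x.2.2 := by
  have h1 : volume {x : (ℝ × ℝ) × (ℝ × ℝ) | x.1.1 = x.2.1} = 0 := by
    rw [Measure.volume_eq_prod, Measure.measure_prod_null
      (measurableSet_eq_fun (by fun_prop) (by fun_prop))]
    refine ae_of_all _ fun a => ?_
    have : Prod.mk a ⁻¹' {x : (ℝ × ℝ) × (ℝ × ℝ) | x.1.1 = x.2.1} =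
        ({a.1} : Set ℝ) ×ˢ (Set.univ : Set ℝ) := by
      ext y; simp [eq_comm]
    change volume (Prod.mk a ⁻¹' _) = 0
    rw [this, Measure.volume_eq_prod, Measure.prod_prod]
    simp
  have h2 : volume {x : (ℝ × ℝ) × (ℝ × ℝ) | x.1.2 = x.2.2} = 0 := by
    rw [Measure.volume_eq_prod, Measure.measure_prod_null
      (measurableSet_eq_fun (by fun_prop) (by fun_prop))]
    refine ae_of_all _ fun a => ?_
    have : Prod.mk a ⁻¹' {x : (ℝ × ℝ) × (ℝ × ℝ) | x.1.2 = x.2.2} =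
        (Set.univ : Set ℝ) ×ˢ ({a.2} : Set ℝ) := by
      ext y; simp [eq_comm]
    change volume (Prod.mk a ⁻¹' _) = 0
    rw [this, Measure.volume_eq_prod, Measure.prod_prod]
    simp
  have e1 : ∀ᵐ x : (ℝ × ℝ) × (ℝ × ℝ), x.1.1 ≠ x.2.1 := measure_eq_zero_iff_ae_notMem.1 h1
  have e2 : ∀ᵐ x : (ℝ × ℝ) × (ℝ × ℝ), x.1.2 ≠ x.2.2 := measure_eq_zero_iff_ae_notMem.1 h2
  exact e1.and e2

variable {p : ℕ} {f : ℝ × ℝ → Cov p → ℝ}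

/-- The integral of a non-integrable function is `0` by convention, so positivity certifies
integrability. -/
theorem integrable_of_marginal_pos {z : Cov p} (hz : 0 < marginal f z) :
    Integrable fun x => f x z := by
  by_contra h
  rw [marginal, integral_undef h] at hz
  exact lt_irrefl _ hz

theorem isProbabilityMeasure_condLaw (hf_nonneg : ∀ x z, 0 ≤ f x z) {z : Cov p}
    (hz : 0 < marginal f z) : IsProbabilityMeasure (condLaw f z) := by
  refine ⟨?_⟩
  have hi := integrable_of_marginal_pos hz
  rw [condLaw, withDensity_apply _ MeasurableSet.univ, Measure.restrict_univ,
    ← ofReal_integral_eq_lintegral_ofReal (hi.div_const _)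
      (ae_of_all _ fun x => div_nonneg (hf_nonneg x z) hz.le), integral_div]
  change ENNReal.ofReal (marginal f z / marginal f z) = 1
  rw [div_self hz.ne', ENNReal.ofReal_one]

theorem abs_tau_le (hf_nonneg : ∀ x z, 0 ≤ f x z) {z : Cov p}
    (hz : 0 < marginal f z) : |tau f z| ≤ 1 := by
  have := isProbabilityMeasure_condLaw hf_nonneg hz
  rw [tau, abs_sub_le_iff]
  constructor <;>
  linarith [measureReal_nonneg (μ := (condLaw f z).prod (condLaw f z))
      (s := {x : (ℝ × ℝ) × (ℝ × ℝ) | 0 < (x.1.1 - x.2.1) * (x.1.2 - x.2.2)}),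
    measureReal_nonneg (μ := (condLaw f z).prod (condLaw f z))
      (s := {x : (ℝ × ℝ) × (ℝ × ℝ) | (x.1.1 - x.2.1) * (x.1.2 - x.2.2) < 0}),
    measureReal_le_one (μ := (condLaw f z).prod (condLaw f z))
      (s := {x : (ℝ × ℝ) × (ℝ × ℝ) | 0 < (x.1.1 - x.2.1) * (x.1.2 - x.2.2)}),
    measureReal_le_one (μ := (condLaw f z).prod (condLaw f z))
      (s := {x : (ℝ × ℝ) × (ℝ × ℝ) | (x.1.1 - x.2.1) * (x.1.2 - x.2.2) < 0})]

theorem integral_g₂_eq_tau (hf_nonneg : ∀ x z, 0 ≤ f x z) {z : Cov p}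
    (hz : 0 < marginal f z) :
    ∫ x, g₂ x.1 x.2 ∂((condLaw f z).prod (condLaw f z)) = tau f z := by
  classical
  have := isProbabilityMeasure_condLaw hf_nonneg hz
  have m1 : MeasurableSet {x : (ℝ × ℝ) × (ℝ × ℝ) | 0 < (x.1.1 - x.2.1) * (x.1.2 - x.2.2)} :=
    measurableSet_lt (by fun_prop) (by fun_prop)
  have m2 : MeasurableSet {x : (ℝ × ℝ) × (ℝ × ℝ) | (x.1.1 - x.2.1) * (x.1.2 - x.2.2) < 0} :=
    measurableSet_lt (by fun_prop) (by fun_prop)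
  have i1 := (integrable_const (μ := (condLaw f z).prod (condLaw f z)) (1 : ℝ)).indicator m1
  have i2 := (integrable_const (μ := (condLaw f z).prod (condLaw f z)) (1 : ℝ)).indicator m2
  rw [tau, ← integral_indicator_one m1, ← integral_indicator_one m2]
  refine Eq.trans ?_ (integral_sub i1 i2)
  refine integral_congr_ae (ae_of_all _ fun x => ?_)
  simp only [g₂, Set.indicator_apply, Set.mem_ofPred_eq, Pi.one_apply]

theorem condLaw_prod_ac (z : Cov p) :
    (condLaw f z).prod (condLaw f z) ≪ volume :=
  (withDensity_absolutelyContinuous _ _).prod (withDensity_absolutelyContinuous _ _)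

/-- The product law is invariant under the swap and, being absolutely continuous, does not see ties.
-/
theorem integral_eq_of_add_swap (hf_nonneg : ∀ x z, 0 ≤ f x z) {z : Cov p}
    (hz : 0 < marginal f z) {g : ℝ × ℝ → ℝ × ℝ → ℝ}
    (hg : Measurable (Function.uncurry g)) {M : ℝ} (hM : ∀ x y, |g x y| ≤ M)
    (hsw : ∀ {x y : ℝ × ℝ}, x.1 ≠ y.1 → x.2 ≠ y.2 → g x y + g y x = 2 * g₂ x y) :
    ∫ x, g x.1 x.2 ∂((condLaw f z).prod (condLaw f z)) = tau f z := by
  have := isProbabilityMeasure_condLaw hf_nonneg hz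
  set ν := (condLaw f z).prod (condLaw f z) with hν
  have i1 : Integrable (fun x : (ℝ × ℝ) × (ℝ × ℝ) => g x.1 x.2) ν :=
    integrable_of_abs_le hg.aemeasurable fun x => hM _ _
  have i2 : Integrable (fun x : (ℝ × ℝ) × (ℝ × ℝ) => g x.2 x.1) ν :=
    integrable_of_abs_le (hg.comp measurable_swap).aemeasurable fun x => hM _ _
  have h1 : ∫ x, g x.2 x.1 ∂ν = ∫ x, g x.1 x.2 ∂ν :=
    integral_prod_swap (μ := condLaw f z) (ν := condLaw f z) fun x => g x.1 x.2
  have h2 : ∫ x, (g x.1 x.2 + g x.2 x.1) ∂ν = ∫ x, 2 * g₂ x.1 x.2 ∂ν := by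
    have hae := (condLaw_prod_ac (f := f) z).ae_le ae_no_ties
    refine integral_congr_ae ?_
    filter_upwards [hae] with x hx
    exact hsw hx.1 hx.2
  rw [integral_add i1 i2, h1, integral_const_mul, hν, integral_g₂_eq_tau hf_nonneg hz] at h2
  linarith

/-- The three choices of the function `g` in the definition of the estimator have the same
properties. -/
theorem admissible_g (hf_nonneg : ∀ x z, 0 ≤ f x z)
    {g : ℝ × ℝ → ℝ × ℝ → ℝ} (hg : g = g₁ ∨ g = g₂ ∨ g = g₃) :
    Measurable (Function.uncurry g) ∧ (∀ x y, |g x y| ≤ 3) ∧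
    ∀ z, 0 < marginal f z → ∫ x, g x.1 x.2 ∂((condLaw f z).prod (condLaw f z)) = tau f z := by
  rcases hg with rfl | rfl | rfl
  · exact ⟨measurable_g₁, abs_g₁_le, fun z hz =>
      integral_eq_of_add_swap hf_nonneg hz measurable_g₁ abs_g₁_le g₁_add_swap⟩
  · exact ⟨measurable_g₂, abs_g₂_le, fun z hz => integral_g₂_eq_tau hf_nonneg hz⟩
  · exact ⟨measurable_g₃, abs_g₃_le, fun z hz =>
      integral_eq_of_add_swap hf_nonneg hz measurable_g₃ abs_g₃_le g₃_add_swap⟩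

/-- The centring of `g` at `τ`, with the normalisation by `f_Z(z)²` removed. It cancels the leading
term in the mean of the numerator. -/
theorem integral_sub_tau_mul_eq_zero (hf_nonneg : ∀ x z, 0 ≤ f x z) {z : Cov p}
    (hm : Measurable fun x => f x z) (hz : 0 < marginal f z) {g : ℝ × ℝ → ℝ × ℝ → ℝ}
    (hg : Measurable (Function.uncurry g)) {M : ℝ} (hM : ∀ x y, |g x y| ≤ M)
    (hτ : ∫ x, g x.1 x.2 ∂((condLaw f z).prod (condLaw f z)) = tau f z) :
    ∫ x : (ℝ × ℝ) × (ℝ × ℝ), (g x.1 x.2 - tau f z) * (f x.1 z * f x.2 z) = 0 := by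
  have := isProbabilityMeasure_condLaw hf_nonneg hz
  have h1 : ∫ x, (g x.1 x.2 - tau f z) ∂((condLaw f z).prod (condLaw f z)) = 0 := by
    have hi : Integrable (fun x : (ℝ × ℝ) × (ℝ × ℝ) => g x.1 x.2)
        ((condLaw f z).prod (condLaw f z)) :=
      integrable_of_abs_le hg.aemeasurable fun x => hM x.1 x.2
    rw [integral_sub hi (integrable_const _), hτ]
    simp
  have hd : Measurable fun x => ENNReal.ofReal (f x z / marginal f z) :=
    (hm.div_const _).ennreal_ofReal
  rw [condLaw, prod_withDensity hd hd, integral_withDensity_eq_integral_toReal_smul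
    (by fun_prop) (ae_of_all _ fun x => ENNReal.mul_lt_top ENNReal.ofReal_lt_top
      ENNReal.ofReal_lt_top)] at h1
  have h2 : ∀ x : (ℝ × ℝ) × (ℝ × ℝ), (ENNReal.ofReal (f x.1 z / marginal f z) *
      ENNReal.ofReal (f x.2 z / marginal f z)).toReal • (g x.1 x.2 - tau f z) =
      (marginal f z ^ 2)⁻¹ * ((g x.1 x.2 - tau f z) * (f x.1 z * f x.2 z)) := by
    intro x
    rw [ENNReal.toReal_mul, ENNReal.toReal_ofReal (div_nonneg (hf_nonneg _ _) hz.le),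
      ENNReal.toReal_ofReal (div_nonneg (hf_nonneg _ _) hz.le), smul_eq_mul]
    field_simp
  simp_rw [h2] at h1
  rw [integral_const_mul, ← Measure.volume_eq_prod] at h1
  exact (mul_eq_zero.1 h1).resolve_left (by positivity)

/-! ### Rescaled coordinates -/

/-- `((u, v), (x₁, x₂)) ↦ ((x₁, u), (x₂, v))`. -/
def pairing {A B : Type*} (y : (A × A) × (B × B)) : (B × A) × (B × A) :=
  ((y.2.1, y.1.1), (y.2.2, y.1.2))

/-- The law of two observations groups each `x` with its covariate, while the smoothness assumption
groups the covariates together; `pairing` passes between the two by swaps and reassociations. -/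
theorem measurePreserving_pairing {A B : Type*} [MeasureSpace A] [MeasureSpace B]
    [SigmaFinite (volume : Measure A)] [SigmaFinite (volume : Measure B)] :
    MeasurePreserving (pairing : (A × A) × (B × B) → (B × A) × (B × A)) := by
  have s0 : MeasurePreserving (Prod.swap : (A × A) × (B × B) → (B × B) × (A × A)) :=
    Measure.measurePreserving_swap
  have s1 : MeasurePreserving (MeasurableEquiv.prodAssoc : (B × B) × (A × A) ≃ᵐ B × B × A × A) :=
    volume_preserving_prodAssoc
  have s2 : MeasurePreserving (Prod.map id (MeasurableEquiv.prodAssoc (α := B) (β := A)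
      (γ := A)).symm : B × B × A × A → B × (B × A) × A) :=
    (MeasurePreserving.id volume).prod
      (volume_preserving_prodAssoc (α₁ := B) (β₁ := A) (γ₁ := A)).symm
  have s3 : MeasurePreserving (Prod.map id (Prod.map Prod.swap id) :
      B × (B × A) × A → B × (A × B) × A) :=
    (MeasurePreserving.id volume).prod (Measure.measurePreserving_swap.prod
      (MeasurePreserving.id volume))
  have s4 : MeasurePreserving (Prod.map id (MeasurableEquiv.prodAssoc (α := A) (β := B)
      (γ := A)) : B × (A × B) × A → B × A × B × A) :=
    (MeasurePreserving.id volume).prod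
      (volume_preserving_prodAssoc (α₁ := A) (β₁ := B) (γ₁ := A))
  have s5 : MeasurePreserving (MeasurableEquiv.prodAssoc (α := B) (β := A)
      (γ := B × A)).symm :=
    (volume_preserving_prodAssoc (α₁ := B) (β₁ := A) (γ₁ := B × A)).symm
  exact s5.comp (s4.comp (s3.comp (s2.comp (s1.comp s0))))

theorem measurableEmbedding_pairing {A B : Type*} [MeasurableSpace A] [MeasurableSpace B] :
    MeasurableEmbedding (pairing : (A × A) × (B × B) → (B × A) × (B × A)) := by
  let e : (A × A) × (B × B) ≃ᵐ (B × A) × (B × A) :=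
    { toFun := pairing
      invFun := fun y => ((y.1.2, y.2.2), (y.1.1, y.2.1))
      left_inv := fun _ => rfl
      right_inv := fun _ => rfl
      measurable_toFun := by
        change Measurable fun y : (A × A) × (B × B) => ((y.2.1, y.1.1), (y.2.2, y.1.2))
        fun_prop
      measurable_invFun := by
        change Measurable fun y : (B × A) × (B × A) => ((y.1.2, y.2.2), (y.1.1, y.2.1))
        fun_prop }
  exact e.measurableEmbedding

theorem lintegral_affine {z : Cov p} {h : ℝ} (hh : 0 < h) {G : Cov p → ℝ≥0∞}
    (hG : Measurable G) :
    ∫⁻ ζ, G ζ = ENNReal.ofReal (h ^ p) * ∫⁻ u, G (z + h • u) := by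
  have h1 : ∫⁻ u, G (z + h • u) = ∫⁻ u, G (z + u) ∂(Measure.map (h • ·) volume) := by
    exact (lintegral_map (hG.comp (measurable_const_add z)) (measurable_const_smul h)).symm
  rw [h1, Measure.map_addHaar_smul volume hh.ne', lintegral_smul_measure,
    lintegral_add_left_eq_self, finrank_euclideanSpace_fin, smul_eq_mul, ← mul_assoc,
    ← ENNReal.ofReal_mul (by positivity), abs_of_pos (by positivity),
    mul_inv_cancel₀ (by positivity), ENNReal.ofReal_one, one_mul]

/-- The observation `(x, ζ)` in the coordinates centred at `z` and rescaled by the bandwidth. -/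
noncomputable def rescale (z : Cov p) (h : ℝ) (y : (ℝ × ℝ) × Cov p) : (ℝ × ℝ) × Cov p :=
  (y.1, h⁻¹ • (y.2 - z))

theorem measurable_rescale (z : Cov p) (h : ℝ) : Measurable (rescale z h) := by
  unfold rescale; fun_prop

/-- The density of a rescaled observation. -/
noncomputable def rescaledDensity (f : ℝ × ℝ → Cov p → ℝ) (z : Cov p) (h : ℝ)
    (y : (ℝ × ℝ) × Cov p) : ℝ := h ^ p * f y.1 (z + h • y.2)

/-- The law of a rescaled observation. -/
noncomputable def rescaledLaw (f : ℝ × ℝ → Cov p → ℝ) (z : Cov p) (h : ℝ) :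
    Measure ((ℝ × ℝ) × Cov p) :=
  volume.withDensity fun y => ENNReal.ofReal (rescaledDensity f z h y)

instance (z : Cov p) (h : ℝ) : SFinite (rescaledLaw f z h) := by
  unfold rescaledLaw; infer_instance

theorem measurable_rescaledDensity (hf : Measurable (Function.uncurry f)) (z : Cov p) (h : ℝ) :
    Measurable (rescaledDensity f z h) := by
  refine Measurable.const_mul ?_ _
  exact hf.comp (f := fun y : (ℝ × ℝ) × Cov p => (y.1, z + h • y.2)) (by fun_prop)

theorem rescaledDensity_nonneg (hf_nonneg : ∀ x z, 0 ≤ f x z) (z : Cov p) {h : ℝ} (hh : 0 < h)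
    (y : (ℝ × ℝ) × Cov p) : 0 ≤ rescaledDensity f z h y :=
  mul_nonneg (by positivity) (hf_nonneg _ _)

/-- The substitution `ζ = z + h u` at fixed `x`; its Jacobian `h^p` is the factor in
`rescaledDensity`. -/
theorem map_rescale (hf : Measurable (Function.uncurry f)) (z : Cov p)
    {h : ℝ} (hh : 0 < h) :
    ((volume : Measure ((ℝ × ℝ) × Cov p)).withDensity fun y => ENNReal.ofReal (f y.1 y.2)).map
      (rescale z h) = rescaledLaw f z h := by
  have hfe : Measurable fun y : (ℝ × ℝ) × Cov p => ENNReal.ofReal (f y.1 y.2) :=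
    hf.ennreal_ofReal
  have hre : Measurable fun y => ENNReal.ofReal (rescaledDensity f z h y) :=
    (measurable_rescaledDensity hf z h).ennreal_ofReal
  refine Measure.ext_of_lintegral _ fun (G : (ℝ × ℝ) × Cov p → ℝ≥0∞) hG => ?_
  have hGr : Measurable fun y => G (rescale z h y) := hG.comp (measurable_rescale z h)
  rw [lintegral_map hG (measurable_rescale z h), lintegral_withDensity_eq_lintegral_mul _ hfe hGr,
    rescaledLaw, lintegral_withDensity_eq_lintegral_mul _ hre hG, Measure.volume_eq_prod,
    lintegral_prod _ (hfe.mul hGr).aemeasurable, lintegral_prod _ (hre.mul hG).aemeasurable]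
  refine lintegral_congr fun x => ?_
  refine (lintegral_affine (z := z) hh
    ((hfe.mul hGr).comp (measurable_prodMk_left (x := x)))).trans ?_
  rw [← lintegral_const_mul' _ _ ENNReal.ofReal_ne_top]
  refine lintegral_congr fun u => ?_
  simp only [Function.comp, Pi.mul_apply, rescale, rescaledDensity, add_sub_cancel_left,
    inv_smul_smul₀ hh.ne']
  rw [← mul_assoc, ENNReal.ofReal_mul (by positivity)]

theorem integral_rescaledLaw (hf : Measurable (Function.uncurry f))
    (hf_nonneg : ∀ x z, 0 ≤ f x z) (z : Cov p) {h : ℝ} (hh : 0 < h)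
    (F : (ℝ × ℝ) × Cov p → ℝ) :
    ∫ y, F y ∂(rescaledLaw f z h) = ∫ y, rescaledDensity f z h y * F y := by
  rw [rescaledLaw, integral_withDensity_eq_integral_toReal_smul
    (measurable_rescaledDensity hf z h).ennreal_ofReal
    (ae_of_all _ fun _ => ENNReal.ofReal_lt_top)]
  refine integral_congr_ae (ae_of_all _ fun y => ?_)
  simp only [smul_eq_mul, ENNReal.toReal_ofReal (rescaledDensity_nonneg hf_nonneg z hh y)]

theorem integrable_rescaledDensity (hf : Measurable (Function.uncurry f))
    (hf_nonneg : ∀ x z, 0 ≤ f x z) (z : Cov p) {h : ℝ} (hh : 0 < h)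
    [IsProbabilityMeasure (rescaledLaw f z h)] : Integrable (rescaledDensity f z h) := by
  refine ⟨(measurable_rescaledDensity hf z h).aestronglyMeasurable, ?_⟩
  have h1 : rescaledLaw f z h Set.univ = 1 := measure_univ
  rw [rescaledLaw, withDensity_apply _ MeasurableSet.univ, Measure.restrict_univ] at h1
  rw [hasFiniteIntegral_iff_ofReal (ae_of_all _ (rescaledDensity_nonneg hf_nonneg z hh)), h1]
  exact ENNReal.one_lt_top

end CondKendall

namespace CondKendall

/-! ### Moments of the rescaled observations -/

variable {p : ℕ} {f : ℝ × ℝ → Cov p → ℝ} {K : Cov p → ℝ} {α : ℕ}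

theorem abs_le_kernelSup (hK : IsKernelOfOrder K α) (u : Cov p) : |K u| ≤ kernelSup K :=
  le_ciSup hK.bounded u

theorem kernelSup_nonneg (hK : IsKernelOfOrder K α) : 0 ≤ kernelSup K :=
  (abs_nonneg (K 0)).trans (abs_le_kernelSup hK 0)

theorem integrable_kernel_sq (hK : IsKernelOfOrder K α) : Integrable fun u => K u ^ 2 := by
  simp_rw [pow_two]
  exact hK.integrable.bdd_mul hK.measurable.aestronglyMeasurable
    (ae_of_all _ fun u => by rw [Real.norm_eq_abs]; exact abs_le_kernelSup hK u)

/-- Otherwise `K` would vanish almost everywhere, against `∫ K = 1`. Bernstein's inequality needs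
this strict positivity of the variance bounds. -/
theorem integral_kernel_sq_pos (hK : IsKernelOfOrder K α) : 0 < ∫ u, K u ^ 2 := by
  refine lt_of_le_of_ne (integral_nonneg fun u => sq_nonneg _) fun h => ?_
  have h1 := (integral_eq_zero_iff_of_nonneg (fun u => sq_nonneg (K u))
    (integrable_kernel_sq hK)).1 h.symm
  have h2 : ∫ u, K u = 0 := by
    rw [integral_eq_zero_of_ae]
    filter_upwards [h1] with u hu
    simpa using hu
  rw [hK.integral_eq_one] at h2
  exact one_ne_zero h2

theorem kernelSup_pos (hK : IsKernelOfOrder K α) : 0 < kernelSup K := by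
  refine lt_of_le_of_ne (kernelSup_nonneg hK) fun h => ?_
  have h0 : ∀ u, K u = 0 := fun u => by
    have := abs_le_kernelSup hK u
    rw [← h] at this
    simpa using this
  have := hK.integral_eq_one
  simp [h0] at this

/-- The value of the rescaled kernel in rescaled coordinates. -/
noncomputable def kernelValue (K : Cov p → ℝ) (h : ℝ) (y : (ℝ × ℝ) × Cov p) : ℝ :=
  (h ^ p)⁻¹ * K y.2

theorem measurable_kernelValue (hK : IsKernelOfOrder K α) (h : ℝ) :
    Measurable (kernelValue K h) :=
  (hK.measurable.comp measurable_snd).const_mul _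

theorem abs_kernelValue_le (hK : IsKernelOfOrder K α) {h : ℝ} (hh : 0 < h)
    (y : (ℝ × ℝ) × Cov p) : |kernelValue K h y| ≤ (h ^ p)⁻¹ * kernelSup K := by
  rw [kernelValue, abs_mul, abs_of_pos (by positivity)]
  exact mul_le_mul_of_nonneg_left (abs_le_kernelSup hK _) (by positivity)

theorem integral_rescaledLaw_snd
    (hf : Measurable (Function.uncurry f)) (hf_nonneg : ∀ x z, 0 ≤ f x z) (z : Cov p)
    {h : ℝ} (hh : 0 < h) [IsProbabilityMeasure (rescaledLaw f z h)]
    {F : Cov p → ℝ} (hF : Measurable F) {M : ℝ}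
    (hM : ∀ u, |F u| ≤ M) :
    ∫ y, F y.2 ∂(rescaledLaw f z h) = ∫ u, h ^ p * (F u * marginal f (z + h • u)) := by
  rw [integral_rescaledLaw hf hf_nonneg z hh, Measure.volume_eq_prod, integral_prod_symm]
  · refine integral_congr_ae (ae_of_all _ fun u => ?_)
    simp only [rescaledDensity, marginal]
    rw [integral_mul_const, integral_const_mul]
    ring
  · exact (integrable_rescaledDensity hf hf_nonneg z hh).mul_bdd
      (hF.comp measurable_snd).aestronglyMeasurable (ae_of_all _ fun y => hM y.2)

theorem integral_kernelValue
    (hf : Measurable (Function.uncurry f)) (hf_nonneg : ∀ x z, 0 ≤ f x z) (z : Cov p)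
    {h : ℝ} (hh : 0 < h) [IsProbabilityMeasure (rescaledLaw f z h)]
    (hK : IsKernelOfOrder K α) :
    ∫ y, kernelValue K h y ∂(rescaledLaw f z h) = ∫ u, K u * marginal f (z + h • u) := by
  simp only [kernelValue]
  rw [integral_const_mul, integral_rescaledLaw_snd hf hf_nonneg z hh hK.measurable
    (abs_le_kernelSup hK), integral_const_mul, inv_mul_cancel_left₀ (by positivity)]

theorem marginal_nonneg (hf_nonneg : ∀ x z, 0 ≤ f x z) (z : Cov p) : 0 ≤ marginal f z :=
  integral_nonneg fun x => hf_nonneg x z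

theorem integral_kernelValue_sq_le
    (hf : Measurable (Function.uncurry f)) (hf_nonneg : ∀ x z, 0 ≤ f x z) (z : Cov p)
    {h : ℝ} (hh : 0 < h) [IsProbabilityMeasure (rescaledLaw f z h)]
    (hK : IsKernelOfOrder K α) {fmax : ℝ}
    (hmax : ∀ z, marginal f z ≤ fmax) :
    ∫ y, kernelValue K h y ^ 2 ∂(rescaledLaw f z h) ≤ (h ^ p)⁻¹ * (fmax * ∫ u, K u ^ 2) := by
  simp only [kernelValue, mul_pow]
  have hK2 : ∀ u, |K u ^ 2| ≤ kernelSup K ^ 2 := fun u => by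
    rw [abs_pow]; exact pow_le_pow_left₀ (abs_nonneg _) (abs_le_kernelSup hK u) 2
  rw [integral_const_mul, integral_rescaledLaw_snd (F := fun u => K u ^ 2) hf hf_nonneg z hh
    (hK.measurable.pow_const 2) hK2, integral_const_mul]
  have h1 : ∫ u, K u ^ 2 * marginal f (z + h • u) ≤ fmax * ∫ u, K u ^ 2 := by
    rw [← integral_const_mul]
    refine integral_mono_of_nonneg (ae_of_all _ fun u =>
      mul_nonneg (sq_nonneg _) (marginal_nonneg hf_nonneg _))
      ((integrable_kernel_sq hK).const_mul _) (ae_of_all _ fun u => ?_)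
    simp only
    rw [mul_comm fmax]
    exact mul_le_mul_of_nonneg_left (hmax _) (sq_nonneg _)
  have hp : 0 < h ^ p := by positivity
  calc _ = (h ^ p)⁻¹ * ∫ u, K u ^ 2 * marginal f (z + h • u) := by field_simp
    _ ≤ _ := by gcongr

/-! ### The kernel of the U-statistic -/

/-- The kernel of the U-statistic at the numerator of the estimator. -/
noncomputable def pairKernel (G : ℝ × ℝ → ℝ × ℝ → ℝ) (K : Cov p → ℝ) (h : ℝ)
    (y y' : (ℝ × ℝ) × Cov p) : ℝ :=
  G y.1 y'.1 * (kernelValue K h y * kernelValue K h y')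

theorem measurable_pairKernel {G : ℝ × ℝ → ℝ × ℝ → ℝ} (hG : Measurable (Function.uncurry G))
    (hK : IsKernelOfOrder K α) (h : ℝ) : Measurable (Function.uncurry (pairKernel G K h)) := by
  have h1 := measurable_kernelValue hK h
  have h2 : Measurable fun y : ((ℝ × ℝ) × Cov p) × ((ℝ × ℝ) × Cov p) => G y.1.1 y.2.1 :=
    hG.comp (f := fun y : ((ℝ × ℝ) × Cov p) × ((ℝ × ℝ) × Cov p) => (y.1.1, y.2.1)) (by fun_prop)
  exact h2.mul ((h1.comp measurable_fst).mul (h1.comp measurable_snd))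

theorem abs_pairKernel_le {h : ℝ} (hh : 0 < h) {G : ℝ × ℝ → ℝ × ℝ → ℝ} {M : ℝ} (hM : ∀ x y, |G x y| ≤ M)
    (hK : IsKernelOfOrder K α) (y y' : (ℝ × ℝ) × Cov p) :
    |pairKernel G K h y y'| ≤ M * ((h ^ p)⁻¹ * kernelSup K) ^ 2 := by
  rw [pairKernel, abs_mul, abs_mul, pow_two]
  have h0 := (abs_nonneg _).trans (hM 0 0)
  have h1 := abs_kernelValue_le hK hh y
  have h2 := abs_kernelValue_le hK hh y'
  have h3 := (abs_nonneg _).trans h1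
  gcongr
  exact hM _ _

/-- Once `G²` is replaced by `M²`, the integral over the product law factorises into the square of
the second moment of one kernel value. -/
theorem integral_pairKernel_sq_le
    (hf : Measurable (Function.uncurry f)) (hf_nonneg : ∀ x z, 0 ≤ f x z) (z : Cov p)
    {h : ℝ} (hh : 0 < h) [IsProbabilityMeasure (rescaledLaw f z h)]
    {G : ℝ × ℝ → ℝ × ℝ → ℝ}
    {M : ℝ} (hM : ∀ x y, |G x y| ≤ M)
    (hK : IsKernelOfOrder K α) {fmax : ℝ} (hmax : ∀ z, marginal f z ≤ fmax) :
    ∫ y, pairKernel G K h y.1 y.2 ^ 2 ∂((rescaledLaw f z h).prod (rescaledLaw f z h)) ≤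
      M ^ 2 * ((h ^ p)⁻¹ * (fmax * ∫ u, K u ^ 2)) ^ 2 := by
  have hb : ∀ y, |kernelValue K h y ^ 2| ≤ ((h ^ p)⁻¹ * kernelSup K) ^ 2 := fun y => by
    rw [abs_pow]; exact pow_le_pow_left₀ (abs_nonneg _) (abs_kernelValue_le hK hh y) 2
  have hi : Integrable (fun y => kernelValue K h y ^ 2) (rescaledLaw f z h) :=
    integrable_of_abs_le ((measurable_kernelValue hK h).pow_const 2).aemeasurable hb
  have h1 : ∫ y, pairKernel G K h y.1 y.2 ^ 2 ∂((rescaledLaw f z h).prod (rescaledLaw f z h)) ≤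
      ∫ y, M ^ 2 * (kernelValue K h y.1 ^ 2 * kernelValue K h y.2 ^ 2)
        ∂((rescaledLaw f z h).prod (rescaledLaw f z h)) := by
    refine integral_mono_of_nonneg (ae_of_all _ fun y => sq_nonneg _)
      ((hi.mul_prod hi).const_mul _) (ae_of_all _ fun y => ?_)
    simp only [pairKernel]
    rw [mul_pow, mul_pow]
    refine mul_le_mul_of_nonneg_right ?_ (by positivity)
    rw [← sq_abs]
    exact pow_le_pow_left₀ (abs_nonneg _) (hM _ _) 2
  refine h1.trans ?_
  rw [integral_const_mul, integral_prod_mul (μ := rescaledLaw f z h) (ν := rescaledLaw f z h)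
    (fun y => kernelValue K h y ^ 2)
    (fun y => kernelValue K h y ^ 2), ← pow_two]
  have h2 := integral_kernelValue_sq_le hf hf_nonneg z hh hK hmax
  have h3 : 0 ≤ ∫ y, kernelValue K h y ^ 2 ∂(rescaledLaw f z h) :=
    integral_nonneg fun y => sq_nonneg _
  gcongr

/-- Bias of the numerator of the estimator. -/
theorem abs_integral_pairKernel_le
    (hf : Measurable (Function.uncurry f)) (hf_nonneg : ∀ x z, 0 ≤ f x z) (z : Cov p)
    {h : ℝ} (hh : 0 < h) [IsProbabilityMeasure (rescaledLaw f z h)]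
    (hα : 1 ≤ α) (hK : IsKernelOfOrder K α) (hh1 : h ≤ 1)
    {𝒵 : Set (Cov p)} {C : ℝ} (hC : 0 ≤ C) (hJ : JointSmooth K f 𝒵 α C) (hz : z ∈ 𝒵)
    (hzpos : 0 < marginal f z)
    {G : ℝ × ℝ → ℝ × ℝ → ℝ} (hG : Measurable (Function.uncurry G)) {M : ℝ}
    (hM : ∀ x y, |G x y| ≤ M)
    (hG0 : ∫ x : (ℝ × ℝ) × (ℝ × ℝ), G x.1 x.2 * (f x.1 z * f x.2 z) = 0) :
    |∫ y, pairKernel G K h y.1 y.2 ∂((rescaledLaw f z h).prod (rescaledLaw f z h))| ≤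
      M * (h ^ α / (α ! : ℝ) * C) := by
  have hM0 : 0 ≤ M := (abs_nonneg _).trans (hM 0 0)
  have hhp : 0 < h ^ p := by positivity
  set A : (ℝ × ℝ) × Cov p → ℝ := fun y => K y.2 * f y.1 (z + h • y.2) with hA
  have hAi : Integrable A := by
    have h1 : Integrable fun y => kernelValue K h y * rescaledDensity f z h y :=
      (integrable_rescaledDensity hf hf_nonneg z hh).bdd_mul
        (measurable_kernelValue hK h).aestronglyMeasurable
        (ae_of_all _ fun y => abs_kernelValue_le hK hh y)
    refine h1.congr (ae_of_all _ fun y => ?_)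
    simp only [kernelValue, rescaledDensity, hA]
    field_simp
  -- `Ψ₁` carries the densities at the displaced covariates, `Ψ₀` those frozen at `z`. By `hG0` the
  -- frozen part integrates to zero against `G`, so it may be subtracted for free.
  set Ψ₁ : (Cov p × Cov p) × ((ℝ × ℝ) × (ℝ × ℝ)) → ℝ := fun y =>
    K y.1.1 * K y.1.2 * (f y.2.1 (z + h • y.1.1) * f y.2.2 (z + h • y.1.2)) with hΨ₁
  set Ψ₀ : (Cov p × Cov p) × ((ℝ × ℝ) × (ℝ × ℝ)) → ℝ := fun y =>
    K y.1.1 * K y.1.2 * (f y.2.1 z * f y.2.2 z) with hΨ₀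
  have hGm : Measurable fun y : (Cov p × Cov p) × ((ℝ × ℝ) × (ℝ × ℝ)) => G y.2.1 y.2.2 :=
    hG.comp measurable_snd
  have hΨ₁i : Integrable Ψ₁ := by
    have h1 : Integrable (fun y : ((ℝ × ℝ) × Cov p) × ((ℝ × ℝ) × Cov p) => A y.1 * A y.2) :=
      hAi.mul_prod hAi
    have h2 := (measurePreserving_pairing (A := Cov p) (B := ℝ × ℝ)).integrable_comp_of_integrable
      h1
    refine h2.congr (ae_of_all _ fun y => ?_)
    simp only [Function.comp, pairing, hA, hΨ₁]
    ring
  have hfz := integrable_of_marginal_pos hzpos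
  have hΨ₀i : Integrable Ψ₀ :=
    (hK.integrable.mul_prod hK.integrable).mul_prod (hfz.mul_prod hfz)
  have hGΨ : ∀ {Ψ : (Cov p × Cov p) × ((ℝ × ℝ) × (ℝ × ℝ)) → ℝ}, Integrable Ψ →
      Integrable fun y => G y.2.1 y.2.2 * Ψ y := fun hΨ =>
    hΨ.bdd_mul hGm.aestronglyMeasurable (ae_of_all _ fun y => hM _ _)
  have e1 : ∫ y, pairKernel G K h y.1 y.2 ∂((rescaledLaw f z h).prod (rescaledLaw f z h)) =
      ∫ y : (Cov p × Cov p) × ((ℝ × ℝ) × (ℝ × ℝ)), G y.2.1 y.2.2 * Ψ₁ y := by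
    have hd := (measurable_rescaledDensity hf z h).ennreal_ofReal
    have hprod : (rescaledLaw f z h).prod (rescaledLaw f z h) =
        (volume : Measure (((ℝ × ℝ) × Cov p) × ((ℝ × ℝ) × Cov p))).withDensity
        fun y => ENNReal.ofReal (rescaledDensity f z h y.1) *
          ENNReal.ofReal (rescaledDensity f z h y.2) := by
      rw [rescaledLaw, prod_withDensity hd hd]
      rfl
    have hnn : ∀ y, (ENNReal.ofReal (rescaledDensity f z h y)).toReal = rescaledDensity f z h y :=
      fun y => ENNReal.toReal_ofReal (rescaledDensity_nonneg hf_nonneg z hh y)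
    rw [hprod, integral_withDensity_eq_integral_toReal_smul
      (f := fun y : ((ℝ × ℝ) × Cov p) × ((ℝ × ℝ) × Cov p) =>
        ENNReal.ofReal (rescaledDensity f z h y.1) * ENNReal.ofReal (rescaledDensity f z h y.2))
      ((hd.comp measurable_fst).mul (hd.comp measurable_snd))
      (ae_of_all _ fun x => ENNReal.mul_lt_top ENNReal.ofReal_lt_top ENNReal.ofReal_lt_top),
      ← (measurePreserving_pairing (A := Cov p) (B := ℝ × ℝ)).integral_comp
        measurableEmbedding_pairing]
    refine integral_congr_ae (ae_of_all _ fun y => ?_)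
    simp only [pairing, ENNReal.toReal_mul, smul_eq_mul, hnn]
    simp only [pairKernel, kernelValue, hΨ₁, rescaledDensity]
    field_simp
  have e0 : ∫ y : (Cov p × Cov p) × ((ℝ × ℝ) × (ℝ × ℝ)), G y.2.1 y.2.2 * Ψ₀ y = 0 := by
    have : ∀ y : (Cov p × Cov p) × ((ℝ × ℝ) × (ℝ × ℝ)), G y.2.1 y.2.2 * Ψ₀ y =
        (K y.1.1 * K y.1.2) * (G y.2.1 y.2.2 * (f y.2.1 z * f y.2.2 z)) := fun y => by
      simp only [hΨ₀]; ring
    simp_rw [this]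
    rw [Measure.volume_eq_prod, integral_prod_mul (fun u : Cov p × Cov p => K u.1 * K u.2)
      (fun x : (ℝ × ℝ) × (ℝ × ℝ) => G x.1 x.2 * (f x.1 z * f x.2 z)), hG0, mul_zero]
  have hBi : Integrable fun y => Ψ₁ y - Ψ₀ y := hΨ₁i.sub hΨ₀i
  have e2 : ∫ y : (Cov p × Cov p) × ((ℝ × ℝ) × (ℝ × ℝ)), G y.2.1 y.2.2 * Ψ₁ y =
      ∫ x : (ℝ × ℝ) × (ℝ × ℝ), G x.1 x.2 * ∫ u : Cov p × Cov p, (Ψ₁ (u, x) - Ψ₀ (u, x)) := by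
    have h1 : ∫ y : (Cov p × Cov p) × ((ℝ × ℝ) × (ℝ × ℝ)), G y.2.1 y.2.2 * (Ψ₁ y - Ψ₀ y) =
        ∫ y : (Cov p × Cov p) × ((ℝ × ℝ) × (ℝ × ℝ)), G y.2.1 y.2.2 * Ψ₁ y := by
      simp_rw [mul_sub]
      rw [integral_sub (hGΨ hΨ₁i) (hGΨ hΨ₀i), e0, sub_zero]
    rw [← h1, Measure.volume_eq_prod, integral_prod_symm _ (hGΨ hBi)]
    exact integral_congr_ae (ae_of_all _ fun x =>
      integral_const_mul (G x.1 x.2) fun u => Ψ₁ (u, x) - Ψ₀ (u, x))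
  rw [e1, e2, ← Real.norm_eq_abs, ← toReal_enorm]
  refine ENNReal.toReal_le_of_le_ofReal (by positivity) ?_
  refine (enorm_integral_le_lintegral_enorm _).trans ?_
  -- Integrating over the covariates first keeps `G` outside as a bounded factor: no smoothness of
  -- `G` is involved, and the bias bound is applied for almost every `(x₁, x₂)`.
  have hae : ∀ᵐ x : (ℝ × ℝ) × (ℝ × ℝ),
      ‖G x.1 x.2 * ∫ u : Cov p × Cov p, (Ψ₁ (u, x) - Ψ₀ (u, x))‖ₑ ≤
      ENNReal.ofReal M * ENNReal.ofReal (h ^ α / (α ! : ℝ)) *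
        ∫⁻ u : Cov p × Cov p, holderIntegrand α K f z (u, x) := by
    have hs1 : ∀ᵐ x : (ℝ × ℝ) × (ℝ × ℝ),
        ∀ j : ℕ, j < α → Differentiable ℝ (iteratedFDeriv ℝ j (f x.1)) :=
      Measure.quasiMeasurePreserving_fst.ae hJ.1
    have hs2 : ∀ᵐ x : (ℝ × ℝ) × (ℝ × ℝ),
        ∀ j : ℕ, j < α → Differentiable ℝ (iteratedFDeriv ℝ j (f x.2)) :=
      Measure.quasiMeasurePreserving_snd.ae hJ.1
    have hs3 : ∀ᵐ x : (ℝ × ℝ) × (ℝ × ℝ), Integrable fun u : Cov p × Cov p =>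
        Ψ₁ (u, x) - Ψ₀ (u, x) := hBi.prod_left_ae
    filter_upwards [hs1, hs2, hs3] with x h1 h2 h3
    have hsub : ∀ u : Cov p × Cov p, Ψ₁ (u, x) - Ψ₀ (u, x) = K u.1 * K u.2 *
        (f x.1 (z + h • u.1) * f x.2 (z + h • u.2) - f x.1 z * f x.2 z) := fun u => by
      simp only [hΨ₁, hΨ₀]; ring
    simp_rw [hsub] at h3 ⊢
    rw [enorm_mul, mul_assoc]
    gcongr
    · rw [Real.enorm_eq_ofReal_abs]
      exact ENNReal.ofReal_le_ofReal (hM _ _)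
    · exact pair_bias hα hK f h1 h2 z hh hh1 h3
  refine (lintegral_mono_ae hae).trans ?_
  have hJz := hJ.2 z hz
  rw [lintegral_const_mul' _ _ (ENNReal.mul_ne_top ENNReal.ofReal_ne_top ENNReal.ofReal_ne_top),
    ← lintegral_prod_symm (μ := (volume : Measure (Cov p × Cov p)))
      (ν := (volume : Measure ((ℝ × ℝ) × (ℝ × ℝ)))) _ hJz.1, mul_assoc,
    ENNReal.ofReal_mul hM0, ENNReal.ofReal_mul (by positivity)]
  gcongr
  exact hJz.2

end CondKendall

namespace CondKendall

/-! ### Error of the estimator at a point -/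

variable {p : ℕ} {f : ℝ × ℝ → Cov p → ℝ} {K : Cov p → ℝ} {α : ℕ}

/-- Deterministic bound on the error of the estimator by a U-statistic and a diagonal term. -/
theorem abs_tauHat_sub_le {n : ℕ} (hn : 2 ≤ n) (g : ℝ × ℝ → ℝ × ℝ → ℝ) (K : Cov p → ℝ) (h : ℝ)
    (X : Fin n → ℝ × ℝ) (Z : Fin n → Cov p) (z : Cov p) {τ fmin M b : ℝ} (hfmin : 0 < fmin)
    (hM : ∀ x y, |g x y - τ| ≤ M) (hb : ∀ i, |scaledKernel K h (Z i - z)| ≤ b)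
    (hS : fmin / 2 ≤ (∑ i, scaledKernel K h (Z i - z)) / n) :
    |tauHat g K h X Z z - τ| ≤ 4 / fmin ^ 2 *
      (|uStat (pairKernel (fun x y => g x y - τ) K h) fun i => rescale z h (X i, Z i)| +
        M * b ^ 2 / n) := by
  have hn0 : (0 : ℝ) < n := by exact_mod_cast (by omega : 0 < n)
  have hn2 : (2 : ℝ) ≤ n := by exact_mod_cast hn
  set k : Fin n → ℝ := fun i => scaledKernel K h (Z i - z) with hk
  set S := ∑ i, k i with hSdef
  have hSn : fmin / 2 * n ≤ S := (le_div_iff₀ hn0).1 hS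
  have hSpos : 0 < S := lt_of_lt_of_le (by positivity) hSn
  set G : Fin n → Fin n → ℝ := fun i j => (g (X i) (X j) - τ) * (k i * k j) with hG
  set U := uStat (pairKernel (fun x y => g x y - τ) K h) fun i => rescale z h (X i, Z i) with hU
  have hUeq : ∑ i, ∑ j, (if i ≠ j then G i j else 0) = U * (n * (n - 1)) := by
    rw [hU, uStat, div_mul_cancel₀]
    · rfl
    · have : 0 < (n : ℝ) * (n - 1) := mul_pos hn0 (by linarith)
      exact this.ne'
  have hw : ∑ i, ∑ j, weight K h Z z i * weight K h Z z j = 1 := by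
    rw [← Finset.sum_mul_sum]
    have : ∑ i, weight K h Z z i = 1 := by
      simp only [weight]
      rw [← Finset.sum_div]
      exact div_self hSpos.ne'
    rw [this, one_mul]
  -- Since the weights sum to one, `τ` can be moved inside the double sum.
  have hdiff : tauHat g K h X Z z - τ = (∑ i, ∑ j, G i j) / S ^ 2 := by
    have : τ = ∑ i, ∑ j, weight K h Z z i * weight K h Z z j * τ := by
      simp_rw [← Finset.sum_mul]
      rw [hw, one_mul]
    conv_lhs => rw [this]
    rw [tauHat, ← Finset.sum_sub_distrib, Finset.sum_div]
    refine Finset.sum_congr rfl fun i _ => ?_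
    rw [← Finset.sum_sub_distrib, Finset.sum_div]
    refine Finset.sum_congr rfl fun j _ => ?_
    change k i / S * (k j / S) * g (X i) (X j) - k i / S * (k j / S) * τ = _
    rw [hG]
    field_simp
  -- The diagonal need not vanish (`g₁ x x = -1`), so it is kept as a separate deterministic term.
  have hdiag : ∑ i, ∑ j, G i j = U * (n * (n - 1)) + ∑ i, G i i := by
    rw [← hUeq, ← Finset.sum_add_distrib]
    refine Finset.sum_congr rfl fun i _ => ?_
    have : ∀ j, G i j = (if i ≠ j then G i j else 0) + if i = j then G i j else 0 := by
      intro j; split_ifs <;> simp_all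
    rw [Finset.sum_congr rfl fun j _ => this j, Finset.sum_add_distrib]
    simp
  have hdiag' : |∑ i, G i i| ≤ n * (M * b ^ 2) := by
    refine (Finset.abs_sum_le_sum_abs _ _).trans ?_
    calc ∑ i, |G i i| ≤ ∑ _i : Fin n, M * b ^ 2 := by
          refine Finset.sum_le_sum fun i _ => ?_
          rw [hG]
          simp only [abs_mul]
          have h0 := (abs_nonneg _).trans (hM 0 0)
          have h1 := (abs_nonneg _).trans (hb i)
          rw [pow_two]
          gcongr
          · exact hM _ _
          · exact hb i
          · exact hb i
      _ = _ := by simp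
  have hnum : |∑ i, ∑ j, G i j| ≤ n ^ 2 * (|U| + M * b ^ 2 / n) := by
    rw [hdiag]
    refine (abs_add_le _ _).trans ?_
    rw [abs_mul, abs_of_pos (mul_pos hn0 (by linarith : (0 : ℝ) < n - 1))]
    have h1 : |U| * (n * (n - 1)) ≤ |U| * n ^ 2 := by
      refine mul_le_mul_of_nonneg_left ?_ (abs_nonneg _)
      nlinarith
    have h2 : (n : ℝ) ^ 2 * (M * b ^ 2 / n) = n * (M * b ^ 2) := by field_simp
    rw [mul_add, h2]
    linarith
  have hS2 : fmin ^ 2 * n ^ 2 / 4 ≤ S ^ 2 := by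
    calc fmin ^ 2 * n ^ 2 / 4 = (fmin / 2 * n) ^ 2 := by ring
      _ ≤ S ^ 2 := pow_le_pow_left₀ (by positivity) hSn 2
  rw [hdiff, abs_div, abs_of_pos (by positivity : 0 < S ^ 2), div_le_iff₀ (by positivity)]
  have hV : 0 ≤ |U| + M * b ^ 2 / n := by
    have h0 := (abs_nonneg _).trans hnum
    exact nonneg_of_mul_nonneg_right h0 (by positivity)
  calc |∑ i, ∑ j, G i j| ≤ n ^ 2 * (|U| + M * b ^ 2 / n) := hnum
    _ = 4 / fmin ^ 2 * (|U| + M * b ^ 2 / n) * (fmin ^ 2 * n ^ 2 / 4) := by field_simp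
    _ ≤ _ := by gcongr

theorem uStat_neg {S : Type*} {n : ℕ} (H : S → S → ℝ) (ξ : Fin n → S) :
    uStat (fun y y' => -H y y') ξ = -uStat H ξ := by
  have : ∀ i j : Fin n, (if i ≠ j then -H (ξ i) (ξ j) else 0) =
      -(if i ≠ j then H (ξ i) (ξ j) else 0) := fun i j => by split_ifs <;> simp
  simp only [uStat, this, Finset.sum_neg_distrib, neg_div]

/-- Exponential inequality for the estimator at a point. -/
theorem tauHat_tail {Ω : Type*} [MeasurableSpace Ω] {P : Measure Ω} [IsProbabilityMeasure P]
    {n : ℕ} (hn : 2 ≤ n) (hα : 1 < α) {𝒵 : Set (Cov p)} (hK : IsKernelOfOrder K α)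
    (hf : Measurable (Function.uncurry f)) (hf_nonneg : ∀ x z, 0 ≤ f x z)
    {g : ℝ × ℝ → ℝ × ℝ → ℝ} (hg : g = g₁ ∨ g = g₂ ∨ g = g₃)
    {CKα : ℝ} (hCKα : 0 < CKα) (hmarg : MarginalSmooth K (marginal f) 𝒵 α CKα)
    {fmin fmax : ℝ} (hfmin : 0 < fmin) (hmin : ∀ z ∈ 𝒵, fmin ≤ marginal f z)
    (hfmax : 0 < fmax) (hmax : ∀ z, marginal f z ≤ fmax)
    {CXZ : ℝ} (hCXZ : 0 < CXZ) (hJ : JointSmooth K f 𝒵 α CXZ)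
    {X : Fin n → Ω → ℝ × ℝ} {Z : Fin n → Ω → Cov p} (hXZ : IsSample P f X Z)
    {z : Cov p} (hz : z ∈ 𝒵) {h : ℝ} (hh : 0 < h) (hh1 : h ≤ 1)
    (hbias : h ^ α / (α ! : ℝ) * CKα ≤ fmin / 4) {x : ℝ} (hx : 0 ≤ x) :
    P.real {ω | 4 / fmin ^ 2 * (4 * (h ^ α / (α ! : ℝ) * CXZ) + x +
        4 * ((h ^ p)⁻¹ * kernelSup K) ^ 2 / n) <
        |tauHat g K h (fun i => X i ω) (fun i => Z i ω) z - tau f z|} ≤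
      Real.exp (-(n * (fmin / 4) ^ 2 / (2 * ((h ^ p)⁻¹ * (fmax * ∫ u, K u ^ 2)) +
        2 / 3 * ((h ^ p)⁻¹ * kernelSup K) * (fmin / 4)))) +
      2 * Real.exp (-(((n / 2 : ℕ) : ℝ) * x ^ 2 /
        (2 * (4 ^ 2 * ((h ^ p)⁻¹ * (fmax * ∫ u, K u ^ 2)) ^ 2) +
        2 / 3 * (4 * ((h ^ p)⁻¹ * kernelSup K) ^ 2) * x))) := by
  obtain ⟨hgm, hg3, hgτ⟩ := admissible_g hf_nonneg hg
  have hzpos : 0 < marginal f z := hfmin.trans_le (hmin z hz)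
  have hhp : 0 < h ^ p := by positivity
  have hIK := integral_kernel_sq_pos hK
  have hCK := kernelSup_nonneg hK
  have hfz : Measurable fun x => f x z := hf.comp (measurable_id.prodMk measurable_const)
  set ξ : Fin n → Ω → (ℝ × ℝ) × Cov p := fun i ω => rescale z h (X i ω, Z i ω) with hξdef
  have hξ : ∀ i, Measurable (ξ i) := fun i => (measurable_rescale z h).comp
    ((hXZ.measurable_X i).prodMk (hXZ.measurable_Z i))
  have hξind : iIndepFun ξ P :=
    hXZ.indep.comp (fun _ => rescale z h) fun _ => measurable_rescale z h
  have hlaw : ∀ i, P.map (ξ i) = rescaledLaw f z h := by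
    intro i
    rw [← map_rescale hf z hh, ← hXZ.law i, Measure.map_map (measurable_rescale z h)
      ((hXZ.measurable_X i).prodMk (hXZ.measurable_Z i))]
    rfl
  -- That the density has total mass one is inherited from `P` through an observation of the sample.
  have hprob : IsProbabilityMeasure (rescaledLaw f z h) := by
    rw [← hlaw ⟨0, by omega⟩]
    exact Measure.isProbabilityMeasure_map (hξ _).aemeasurable
  set G : ℝ × ℝ → ℝ × ℝ → ℝ := fun x y => g x y - tau f z with hGdef
  -- The bound `4` used from here on is `3 + 1`, from `|g| ≤ 3` and `|τ| ≤ 1`.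
  have hGm : Measurable (Function.uncurry G) := hgm.sub_const _
  have hG4 : ∀ x y, |G x y| ≤ 4 := fun x y => by
    refine (abs_sub _ _).trans ?_
    linarith [hg3 x y, abs_tau_le hf_nonneg hzpos]
  have hG0 := integral_sub_tau_mul_eq_zero hf_nonneg hfz hzpos hgm hg3 (hgτ z hzpos)
  have hEH := abs_integral_pairKernel_le hf hf_nonneg z hh hα.le hK hh1 hCXZ.le hJ hz hzpos hGm
    hG4 hG0
  set H := pairKernel G K h with hH
  have hHm : Measurable (Function.uncurry H) := measurable_pairKernel hGm hK h
  have hHM : ∀ y y', |H y y'| ≤ 4 * ((h ^ p)⁻¹ * kernelSup K) ^ 2 :=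
    abs_pairKernel_le hh hG4 hK
  have hH2 := integral_pairKernel_sq_le hf hf_nonneg z hh hG4 hK hmax
  set v := (h ^ p)⁻¹ * (fmax * ∫ u, K u ^ 2) with hv
  set b := (h ^ p)⁻¹ * kernelSup K with hb
  have hvpos : 0 < v := by positivity
  have hb0 : 0 ≤ b := by positivity
  have hpull : ∀ F : (ℝ × ℝ) × Cov p → ℝ, Measurable F → ∀ i,
      ∫ ω, F (ξ i ω) ∂P = ∫ y, F y ∂(rescaledLaw f z h) := fun F hF i => by
    rw [← hlaw i, integral_map (hξ i).aemeasurable hF.aestronglyMeasurable]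
  have hkm := measurable_kernelValue (p := p) hK h
  -- the denominator
  have t1 := bernstein_lower (P := P) (by omega : 0 < n)
    (Y := fun i ω => kernelValue K h (ξ i ω)) (fun i => hkm.comp (hξ i))
    (hξind.comp (fun _ => kernelValue K h) fun _ => hkm)
    (μ := ∫ u, K u * marginal f (z + h • u)) (v := v) (M := b) (x := fmin / 4) hvpos hb0
    (by positivity) (fun i ω => abs_kernelValue_le hK hh _)
    (fun i => by rw [hpull _ hkm, integral_kernelValue hf hf_nonneg z hh hK])
    (fun i => by
      rw [hpull (fun y => kernelValue K h y ^ 2) (hkm.pow_const 2)]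
      exact integral_kernelValue_sq_le hf hf_nonneg z hh hK hmax)
  -- the numerator
  have t2 := uStat_bernstein (P := P) hn hξ hξind hlaw hHm hHM (by positivity)
    (v := 4 ^ 2 * v ^ 2) (by positivity) hx hH2
  have t3 := uStat_bernstein (P := P) hn hξ hξind hlaw (H := fun y y' => -H y y') hHm.neg
    (fun y y' => by rw [abs_neg]; exact hHM y y') (by positivity)
    (v := 4 ^ 2 * v ^ 2) (by positivity) hx (by simpa only [neg_sq] using hH2)
  rw [integral_neg] at t3
  simp only [uStat_neg] at t3
  set E := ∫ y, H y.1 y.2 ∂((rescaledLaw f z h).prod (rescaledLaw f z h)) with hE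
  have hint : Integrable fun u => K u * marginal f (z + h • u) := by
    refine hK.integrable.mul_bdd (c := fmax) ?_ (ae_of_all _ fun u => ?_)
    · exact (hmarg.1.continuous.comp (by fun_prop)).aestronglyMeasurable
    · rw [Real.norm_eq_abs, abs_of_nonneg (marginal_nonneg hf_nonneg _)]
      exact hmax _
  have hmb := (marginal_bias hα.le hCKα.le hK hmarg hz hh hh1 hint).trans hbias
  have hmz := hmin z hz
  -- Off three bad events, bias and fluctuation of the density estimator cost `fmin / 4` each,
  -- leaving at least `fmin / 2`, and the U-statistic is controlled from both sides.
  refine (measureReal_mono (s₂ := {ω | (∑ i, kernelValue K h (ξ i ω)) / n ≤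
      (∫ u, K u * marginal f (z + h • u)) - fmin / 4} ∪
      ({ω | E + x ≤ uStat H fun i => ξ i ω} ∪ {ω | -E + x ≤ -uStat H fun i => ξ i ω}))
      (fun ω hω => ?_)).trans ?_
  · by_contra hcon
    simp only [Set.mem_union, Set.mem_ofPred_eq, not_or, not_le] at hcon hω
    obtain ⟨c1, c2, c3⟩ := hcon
    have hS : fmin / 2 ≤ (∑ i, scaledKernel K h (Z i ω - z)) / n := by
      have : ∑ i, scaledKernel K h (Z i ω - z) = ∑ i, kernelValue K h (ξ i ω) := rfl
      rw [this]
      have := (abs_le.1 hmb).1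
      linarith
    have hdet := abs_tauHat_sub_le hn g K h (fun i => X i ω) (fun i => Z i ω) z
      (τ := tau f z) hfmin hG4 (b := b) (fun i => abs_kernelValue_le hK hh (ξ i ω)) hS
    have hUle : |uStat H fun i => ξ i ω| ≤ 4 * (h ^ α / (α ! : ℝ) * CXZ) + x := by
      have := abs_le.1 hEH
      rw [abs_le]
      constructor <;> linarith
    have : |tauHat g K h (fun i => X i ω) (fun i => Z i ω) z - tau f z| ≤
        4 / fmin ^ 2 * (4 * (h ^ α / (α ! : ℝ) * CXZ) + x + 4 * b ^ 2 / n) := by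
      refine hdet.trans ?_
      gcongr
    linarith
  · refine (measureReal_union_le _ _).trans (add_le_add t1 ?_)
    refine (measureReal_union_le _ _).trans ?_
    linarith

/-! ### Matching the Bernstein exponents with the constants `C₁`, `C₂`, `C₃`. -/

theorem bernstein_exponent_density {w V c m n : ℝ} (hw : 0 < w) (hV : 0 ≤ V) (hc : 0 < c)
    (hm : 0 < m) :
    n * (m / 4) ^ 2 / (2 * (w⁻¹ * V) + 2 / 3 * (w⁻¹ * c) * (m / 4)) =
      m ^ 2 / (32 * V + 8 / 3 * c * m) * (w * n) := by
  have h0 : 0 < 32 * V + 8 / 3 * c * m := by positivity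
  have h1 : 2 * (w⁻¹ * V) + 2 / 3 * (w⁻¹ * c) * (m / 4) =
      (32 * V + 8 / 3 * c * m) / (16 * w) := by field_simp; ring
  rw [h1]
  generalize 32 * V + 8 / 3 * c * m = A at h0 ⊢
  field_simp
  ring

theorem bernstein_exponent_pair {w V c t m : ℝ} (hw : 0 < w) (hV : 0 < V) (hc : 0 ≤ c)
    (ht : 0 ≤ t) :
    m * (4 * t) ^ 2 / (2 * (4 ^ 2 * (w⁻¹ * V) ^ 2) + 2 / 3 * (4 * (w⁻¹ * c) ^ 2) * (4 * t)) =
      w ^ 2 * (2 * m) * t ^ 2 / (4 * V ^ 2 + 4 / 3 * c ^ 2 * t) := by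
  have h0 : 0 < 4 * V ^ 2 + 4 / 3 * c ^ 2 * t := by positivity
  have h1 : 2 * (4 ^ 2 * (w⁻¹ * V) ^ 2) + 2 / 3 * (4 * (w⁻¹ * c) ^ 2) * (4 * t) =
      8 * (4 * V ^ 2 + 4 / 3 * c ^ 2 * t) / w ^ 2 := by field_simp; ring
  rw [h1]
  generalize 4 * V ^ 2 + 4 / 3 * c ^ 2 * t = A at h0 ⊢
  field_simp
  ring

set_option maxHeartbeats 1000000 in
/-- The exponential inequality with the tuning of the bandwidth. -/
theorem tauHat_tail_of_bandwidthCond {Ω : Type*} [MeasurableSpace Ω] {P : Measure Ω}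
    [IsProbabilityMeasure P]
    {n : ℕ} (hn : 2 ≤ n) (hα : 1 < α) {𝒵 : Set (Cov p)} (hK : IsKernelOfOrder K α)
    (hf : Measurable (Function.uncurry f)) (hf_nonneg : ∀ x z, 0 ≤ f x z)
    {g : ℝ × ℝ → ℝ × ℝ → ℝ} (hg : g = g₁ ∨ g = g₂ ∨ g = g₃)
    {CKα : ℝ} (hCKα : 0 < CKα) (hmarg : MarginalSmooth K (marginal f) 𝒵 α CKα)
    {fmin fmax : ℝ} (hfmin : 0 < fmin) (hmin : ∀ z ∈ 𝒵, fmin ≤ marginal f z)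
    (hfmax : 0 < fmax) (hmax : ∀ z, marginal f z ≤ fmax)
    {CXZ : ℝ} (hCXZ : 0 < CXZ) (hJ : JointSmooth K f 𝒵 α CXZ)
    {X : Fin n → Ω → ℝ × ℝ} {Z : Fin n → Ω → Cov p} (hXZ : IsSample P f X Z)
    {z : Cov p} (hz : z ∈ 𝒵) {h t Cψ CΛ : ℝ} (hh : 0 < h) (hh1 : h ≤ 1) (ht : 0 < t)
    (hCψ : 0 < Cψ) (hCΛ : 0 < CΛ) (hband : BandwidthCond α fmin fmax Cψ CΛ CKα CXZ h t)
    (hlarge : 1 / 2 ≤ h ^ (2 * p) * ((n : ℝ) - 1) * t ^ 2 /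
      (C₂ K fmin fmax Cψ CΛ + C₃ K fmin fmax Cψ CΛ * t)) :
    P.real {ω | t / (Cψ * CΛ) <
        |tauHat g K h (fun i => X i ω) (fun i => Z i ω) z - tau f z|} ≤
      Real.exp (-(C₁ K fmin fmax * (h ^ p * ((n : ℝ) - 1)))) +
      2 * Real.exp (-(h ^ (2 * p) * ((n : ℝ) - 1) * t ^ 2 /
        (C₂ K fmin fmax Cψ CΛ + C₃ K fmin fmax Cψ CΛ * t))) := by
  have hIK := integral_kernel_sq_pos hK
  have hCK := kernelSup_pos hK
  have hfac : (0 : ℝ) < α ! := by exact_mod_cast α.factorial_pos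
  have hn2 : (2 : ℝ) ≤ n := by exact_mod_cast hn
  have hfm : fmin ≤ fmax := (hmin z hz).trans (hmax z)
  have hw : 0 < h ^ p := by positivity
  have hw2 : h ^ (2 * p) = (h ^ p) ^ 2 := by rw [mul_comm, pow_mul]
  obtain ⟨hb1, hb2⟩ := le_min_iff.1 hband
  have hD : 9 * fmin ^ 2 ≤ fmin ^ 2 + 8 * fmax ^ 2 := by
    have : fmin ^ 2 ≤ fmax ^ 2 := pow_le_pow_left₀ hfmin.le hfm 2
    linarith
  simp only [C₁, C₂, C₃] at hlarge ⊢
  set D := fmin ^ 2 + 8 * fmax ^ 2 with hDdef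
  have hDpos : 0 < D := by positivity
  set V := fmax * ∫ u, K u ^ 2 with hV
  have hVpos : 0 < V := by positivity
  set c := kernelSup K with hc
  set N := (n : ℝ) - 1 with hN
  have hNpos : 0 < N := by rw [hN]; linarith
  -- The scale is chosen so that, for `t' = t / q`, the second bandwidth condition says that the
  -- bias factor is at most `t'`, and `C₂ + C₃ t` becomes `q² (4V² + (8/3) c² t')`.
  set q := 8 * Cψ * CΛ * D / fmin ^ 4 with hq
  have hqpos : 0 < q := by positivity
  set t' := t / q with ht'
  have ht'pos : 0 < t' := by positivity
  have htq : t = q * t' := by rw [ht']; field_simp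
  have hbias1 : h ^ α / (α ! : ℝ) * CKα ≤ fmin / 4 := by
    rw [le_div_iff₀ (by positivity)] at hb1
    rw [div_mul_eq_mul_div, div_le_iff₀ hfac]
    linarith
  have hbias2 : h ^ α / (α ! : ℝ) * CXZ ≤ t' := by
    calc h ^ α / (α ! : ℝ) * CXZ ≤
          fmin ^ 4 * (α ! : ℝ) * t / (8 * Cψ * CΛ * D * CXZ) / (α ! : ℝ) * CXZ := by gcongr
      _ = t' := by rw [ht', hq]; field_simp
  have hden : (16 * Cψ * CΛ * D * fmax * ∫ u, K u ^ 2) ^ 2 / fmin ^ 8 +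
      64 / 3 * Cψ * CΛ * c ^ 2 * D / fmin ^ 4 * t =
      q ^ 2 * (4 * V ^ 2 + 8 / 3 * c ^ 2 * t') := by
    rw [htq, hq, hV]; field_simp; ring
  have hexp2 : h ^ (2 * p) * N * t ^ 2 / ((16 * Cψ * CΛ * D * fmax * ∫ u, K u ^ 2) ^ 2 / fmin ^ 8 +
      64 / 3 * Cψ * CΛ * c ^ 2 * D / fmin ^ 4 * t) =
      (h ^ p) ^ 2 * N * t' ^ 2 / (4 * V ^ 2 + 8 / 3 * c ^ 2 * t') := by
    rw [hden, hw2, htq]; field_simp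
  rw [hexp2] at hlarge ⊢
  have htail := tauHat_tail (P := P) hn hα hK hf hf_nonneg hg hCKα hmarg hfmin hmin hfmax hmax
    hCXZ hJ hXZ hz hh hh1 hbias1 (x := 4 * t') (by positivity)
  rw [← hV, ← hc] at htail
  generalize h ^ p = w at hw hlarge htail ⊢
  -- `hlarge` gives `w² N t'² ≥ 2V² + (4/3) c² t'`; dropping `V` and dividing by `t'` bounds the
  -- diagonal term.
  have hdiag : (w⁻¹ * c) ^ 2 / n ≤ 3 / 4 * t' := by
    rw [le_div_iff₀ (by positivity)] at hlarge
    have h1 : 4 / 3 * c ^ 2 * t' ≤ w ^ 2 * N * t' * t' := by nlinarith [sq_nonneg V]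
    have h2 : 4 / 3 * c ^ 2 ≤ w ^ 2 * N * t' := le_of_mul_le_mul_right h1 ht'pos
    have h3 : w ^ 2 * N * t' ≤ w ^ 2 * n * t' := by
      gcongr; rw [hN]; linarith
    rw [div_le_iff₀ (by positivity), mul_pow, inv_pow, inv_mul_le_iff₀ (by positivity)]
    linarith
  -- Bias, deviation and diagonal contribute `4t' + 4t' + 3t'`, hence `44 t' / fmin²` in total. The
  -- available threshold is `8 D t' / fmin⁴`, and `D ≥ 9 fmin²` because `fmin ≤ fmax`.
  have hthr : 4 / fmin ^ 2 * (4 * (h ^ α / (α ! : ℝ) * CXZ) + 4 * t' + 4 * (w⁻¹ * c) ^ 2 / n) ≤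
      t / (Cψ * CΛ) := by
    calc _ ≤ 4 / fmin ^ 2 * (4 * t' + 4 * t' + 4 * (3 / 4 * t')) := by
          rw [mul_div_assoc 4 ((w⁻¹ * c) ^ 2)]
          gcongr
      _ = 44 * fmin ^ 2 * t' / fmin ^ 4 := by field_simp; ring
      _ ≤ 8 * D * t' / fmin ^ 4 := by
          refine div_le_div_of_nonneg_right (mul_le_mul_of_nonneg_right ?_ ht'pos.le)
            (by positivity)
          linarith [sq_nonneg fmin]
      _ = t / (Cψ * CΛ) := by rw [htq, hq]; field_simp
  refine (measureReal_mono fun ω hω => lt_of_le_of_lt hthr hω).trans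
    (htail.trans (add_le_add (Real.exp_le_exp.2 (neg_le_neg ?_))
      (mul_le_mul_of_nonneg_left (Real.exp_le_exp.2 (neg_le_neg ?_)) two_pos.le)))
  · rw [bernstein_exponent_density hw hVpos.le hCK hfmin, mul_assoc 32, ← hV]
    gcongr
    rw [hN]; linarith
  -- Rounding in `n / 2` loses at most one observation, whence `n - 1` in the rates.
  · have hm : N ≤ 2 * ((n / 2 : ℕ) : ℝ) := by
      have : n ≤ 2 * (n / 2) + 1 := by omega
      have : (n : ℝ) ≤ 2 * ((n / 2 : ℕ) : ℝ) + 1 := by exact_mod_cast this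
      rw [hN]; linarith
    rw [bernstein_exponent_pair hw hVpos hCK.le ht'pos.le]
    have : 4 / 3 * c ^ 2 * t' ≤ 8 / 3 * c ^ 2 * t' := by gcongr; norm_num
    gcongr

end CondKendall

namespace CondKendall

/-! ### Asymptotics of the tuning parameters -/

theorem tendsto_cast_sub_one : Tendsto (fun n : ℕ => (n : ℝ) - 1) atTop atTop :=
  tendsto_atTop_add_const_right _ (-1) tendsto_natCast_atTop_atTop

theorem tendsto_sub_one_rpow {y : ℝ} (hy : 0 < y) :
    Tendsto (fun n : ℕ => ((n : ℝ) - 1) ^ y) atTop atTop :=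
  (tendsto_rpow_atTop hy).comp tendsto_cast_sub_one

theorem tendsto_sub_one_rpow_neg {y : ℝ} (hy : 0 < y) :
    Tendsto (fun n : ℕ => ((n : ℝ) - 1) ^ (-y)) atTop (𝓝 0) :=
  (tendsto_rpow_neg_atTop hy).comp tendsto_cast_sub_one

section

variable {α p : ℕ} {ε : ℝ}

theorem rateExp_pos (hα : 1 < α) (hε₁ : ε < 1) : 0 < rateExp α p ε := by
  have : (1 : ℝ) < α := by exact_mod_cast hα
  rw [rateExp]
  exact div_pos (mul_pos (by linarith) (by linarith)) (by positivity)

theorem tendsto_tPar (hα : 1 < α) (hε₁ : ε < 1) : Tendsto (tPar α p ε) atTop (𝓝 0) :=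
  tendsto_sub_one_rpow_neg (rateExp_pos hα hε₁)

theorem tendsto_hPar (hα : 1 < α) (c : ℝ) : Tendsto (hPar α p c) atTop (𝓝 0) := by
  have : (1 : ℝ) < α := by exact_mod_cast hα
  have := (tendsto_sub_one_rpow_neg (y := 1 / (2 * (α : ℝ) + 2 * p)) (by positivity)).const_mul c
  rw [mul_zero] at this
  exact this

theorem cBand_pos {fmin fmax Cψ CΛ CXZ : ℝ} (hfmin : 0 < fmin) (hfmax : 0 < fmax)
    (hCψ : 0 < Cψ) (hCΛ : 0 < CΛ) (hCXZ : 0 < CXZ) : 0 < cBand α fmin fmax Cψ CΛ CXZ := by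
  unfold cBand; positivity

theorem C₁_pos {K : Cov p → ℝ} (hK : IsKernelOfOrder K α) {fmin fmax : ℝ} (hfmin : 0 < fmin)
    (hfmax : 0 < fmax) : 0 < C₁ K fmin fmax := by
  have := integral_kernel_sq_pos hK
  have := kernelSup_nonneg hK
  unfold C₁; positivity

theorem C₂_pos {K : Cov p → ℝ} (hK : IsKernelOfOrder K α) {fmin fmax Cψ CΛ : ℝ}
    (hfmin : 0 < fmin) (hfmax : 0 < fmax) (hCψ : 0 < Cψ) (hCΛ : 0 < CΛ) :
    0 < C₂ K fmin fmax Cψ CΛ := by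
  have := integral_kernel_sq_pos hK
  unfold C₂; positivity

theorem tendsto_probBound {K : Cov p → ℝ} (hK : IsKernelOfOrder K α) (hα : 1 < α) (n' : ℕ)
    {fmin fmax Cψ CΛ c : ℝ} (hfmin : 0 < fmin) (hfmax : 0 < fmax) (hCψ : 0 < Cψ) (hCΛ : 0 < CΛ)
    (hc : 0 < c) (hε₀ : 0 < ε) (hε₁ : ε < 1) :
    Tendsto (probBound K n' α fmin fmax Cψ CΛ c ε) atTop (𝓝 1) := by
  have hα' : (1 : ℝ) < α := by exact_mod_cast hα
  have hC1 := C₁_pos hK hfmin hfmax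
  have hC2 := C₂_pos hK hfmin hfmax hCψ hCΛ
  have l1 : Tendsto (fun n : ℕ => Real.exp (-(C₁ K fmin fmax * c ^ p *
      ((n : ℝ) - 1) ^ ((2 * (α : ℝ) + p) / (2 * α + 2 * p))))) atTop (𝓝 0) :=
    Real.tendsto_exp_neg_atTop_nhds_zero.comp
      ((tendsto_sub_one_rpow (by positivity)).const_mul_atTop (by positivity))
  have l2 : Tendsto (fun n : ℕ => Real.exp (-(c ^ (2 * p) *
        ((n : ℝ) - 1) ^ (2 * (α : ℝ) * ε / (2 * p + 2 * α)) /
          (C₂ K fmin fmax Cψ CΛ + C₃ K fmin fmax Cψ CΛ * tPar α p ε n)))) atTop (𝓝 0) := by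
    refine Real.tendsto_exp_neg_atTop_nhds_zero.comp ?_
    have hnum : Tendsto (fun n : ℕ => c ^ (2 * p) *
        ((n : ℝ) - 1) ^ (2 * (α : ℝ) * ε / (2 * p + 2 * α))) atTop atTop :=
      (tendsto_sub_one_rpow (by positivity)).const_mul_atTop (by positivity)
    have hden : Tendsto (fun n : ℕ =>
        (C₂ K fmin fmax Cψ CΛ + C₃ K fmin fmax Cψ CΛ * tPar α p ε n)⁻¹) atTop
        (𝓝 (C₂ K fmin fmax Cψ CΛ)⁻¹) := by
      have := ((tendsto_tPar (p := p) hα hε₁).const_mul (C₃ K fmin fmax Cψ CΛ)).const_add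
        (C₂ K fmin fmax Cψ CΛ)
      rw [mul_zero, add_zero] at this
      exact this.inv₀ hC2.ne'
    simp_rw [div_eq_mul_inv]
    simp_rw [div_eq_mul_inv] at hnum
    exact hnum.atTop_mul_pos (inv_pos.2 hC2) hden
  have := ((l1.const_mul (2 * (n' : ℝ))).const_sub 1).sub (l2.const_mul (2 * (n' : ℝ)))
  rw [mul_zero, sub_zero, sub_zero] at this
  exact this

theorem hPar_pow {c : ℝ} (m : ℕ) {n : ℕ} (hn : 2 ≤ n) :
    hPar α p c n ^ m = c ^ m * ((n : ℝ) - 1) ^ (-(m / (2 * (α : ℝ) + 2 * p))) := by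
  have hN : (0 : ℝ) < (n : ℝ) - 1 := by
    have : (2 : ℝ) ≤ n := by exact_mod_cast hn
    linarith
  rw [hPar, mul_pow, ← Real.rpow_natCast (((n : ℝ) - 1) ^ _), ← Real.rpow_mul hN.le]
  congr 2
  ring

/-- `h^α` equals `t` times a constant times `(n - 1)^{-αε/(2α+2p)}`, so `ε > 0` makes it negligible
against `t`. -/
theorem eventually_bandwidthCond (hα : 1 < α) (hε₀ : 0 < ε)
    {fmin fmax Cψ CΛ CKα CXZ : ℝ} (hfmin : 0 < fmin) (hfmax : 0 < fmax)
    (hCψ : 0 < Cψ) (hCΛ : 0 < CΛ) (hCKα : 0 < CKα) (hCXZ : 0 < CXZ) (c : ℝ) :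
    ∀ᶠ n in atTop,
      BandwidthCond α fmin fmax Cψ CΛ CKα CXZ (hPar α p c n) (tPar α p ε n) := by
  have hα' : (1 : ℝ) < α := by exact_mod_cast hα
  have hfac : (0 : ℝ) < α ! := by exact_mod_cast α.factorial_pos
  have l1 : Tendsto (fun n => hPar α p c n ^ α) atTop (𝓝 0) := by
    have := (tendsto_hPar (p := p) hα c).pow α
    rwa [zero_pow (by omega)] at this
  have l2 : Tendsto (fun n : ℕ => c ^ α * ((n : ℝ) - 1) ^ (-(α * ε / (2 * (α : ℝ) + 2 * p))))
      atTop (𝓝 0) := by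
    have := (tendsto_sub_one_rpow_neg (y := α * ε / (2 * (α : ℝ) + 2 * p))
      (by positivity)).const_mul (c ^ α)
    rwa [mul_zero] at this
  have p1 : 0 < fmin * (α ! : ℝ) / (4 * CKα) := by positivity
  have p2 : 0 < fmin ^ 4 * (α ! : ℝ) / (8 * Cψ * CΛ * (fmin ^ 2 + 8 * fmax ^ 2) * CXZ) := by
    positivity
  filter_upwards [l1.eventually_le_const p1, l2.eventually_le_const p2, eventually_ge_atTop 2]
    with n h1 h2 hn
  refine le_min h1 ?_
  have hN : (0 : ℝ) < (n : ℝ) - 1 := by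
    have : (2 : ℝ) ≤ n := by exact_mod_cast hn
    linarith
  have ht : 0 < tPar α p ε n := Real.rpow_pos_of_pos hN _
  have e : hPar α p c n ^ α =
      c ^ α * ((n : ℝ) - 1) ^ (-(α * ε / (2 * (α : ℝ) + 2 * p))) * tPar α p ε n := by
    rw [hPar_pow α hn, tPar, mul_assoc, ← Real.rpow_add hN]
    congr 2
    rw [rateExp]
    field_simp
    ring
  rw [e]
  calc _ ≤ fmin ^ 4 * (α ! : ℝ) / (8 * Cψ * CΛ * (fmin ^ 2 + 8 * fmax ^ 2) * CXZ) *
        tPar α p ε n := by gcongr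
    _ = _ := by ring

/-- Arithmetic of exponents over the common denominator `2α + 2p`: `1` is `2α + 2p`, `h^p` costs
`p`, `h^{2p}` costs `2p`, and `t²` costs `2α(1 - ε)`. -/
theorem probBound_eq {K : Cov p → ℝ} (n' : ℕ) (hα : 1 < α) {fmin fmax Cψ CΛ c : ℝ} {n : ℕ}
    (hn : 2 ≤ n) :
    probBound K n' α fmin fmax Cψ CΛ c ε n =
      1 - 2 * n' * Real.exp (-(C₁ K fmin fmax * (hPar α p c n ^ p * ((n : ℝ) - 1))))
      - 2 * n' * Real.exp (-(hPar α p c n ^ (2 * p) * ((n : ℝ) - 1) * tPar α p ε n ^ 2 /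
        (C₂ K fmin fmax Cψ CΛ + C₃ K fmin fmax Cψ CΛ * tPar α p ε n))) := by
  have hα' : (1 : ℝ) < α := by exact_mod_cast hα
  have hN : (0 : ℝ) < (n : ℝ) - 1 := by
    have : (2 : ℝ) ≤ n := by exact_mod_cast hn
    linarith
  have e1 : C₁ K fmin fmax * (hPar α p c n ^ p * ((n : ℝ) - 1)) = C₁ K fmin fmax * c ^ p *
        ((n : ℝ) - 1) ^ ((2 * (α : ℝ) + p) / (2 * α + 2 * p)) := by
    rw [hPar_pow p hn, mul_assoc (c ^ p), mul_assoc (C₁ _ _ _)]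
    congr 2
    nth_rewrite 2 [← Real.rpow_one ((n : ℝ) - 1)]
    rw [← Real.rpow_add hN]
    congr 1
    field_simp
    ring
  have e2 : hPar α p c n ^ (2 * p) * ((n : ℝ) - 1) * tPar α p ε n ^ 2 =
      c ^ (2 * p) * ((n : ℝ) - 1) ^ (2 * (α : ℝ) * ε / (2 * p + 2 * α)) := by
    have h3 : tPar α p ε n ^ 2 = ((n : ℝ) - 1) ^ (-(2 * rateExp α p ε)) := by
      rw [tPar, ← Real.rpow_natCast (((n : ℝ) - 1) ^ _), ← Real.rpow_mul hN.le]
      congr 1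
      push_cast; ring
    rw [h3, hPar_pow (2 * p) hn, mul_assoc (c ^ (2 * p)), mul_assoc (c ^ (2 * p))]
    congr 1
    nth_rewrite 2 [← Real.rpow_one ((n : ℝ) - 1)]
    rw [← Real.rpow_add hN, ← Real.rpow_add hN]
    congr 1
    rw [rateExp]
    push_cast
    have h4 : (2 * (p : ℝ) + 2 * α) = 2 * α + 2 * p := by ring
    rw [h4]
    field_simp
    ring
  rw [e1, e2, probBound]

end

/-- The derivative bound holds only on `U`, which need not be an interval; the mean value inequality
is therefore applied on a convex neighbourhood of `τ` inside `U`. -/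
theorem abs_link_sub_le {Λ : ℝ → ℝ} {U : Set ℝ} (hU : IsOpen U) (hΛ : ContDiffOn ℝ 1 Λ U)
    {C : ℝ} (hC : ∀ y ∈ U, |deriv Λ y| ≤ C) {τ r : ℝ} (hI : Set.Icc (τ - r) (τ + r) ⊆ U)
    {y : ℝ} (hy : |y - τ| ≤ r) : |Λ y - Λ τ| ≤ C * |y - τ| := by
  have hr := (abs_nonneg _).trans hy
  have hy' := abs_le.1 hy
  have := Convex.norm_image_sub_le_of_norm_deriv_le (f := Λ) (C := C)
    (s := Set.Icc (τ - r) (τ + r)) (x := τ) (y := y)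
    (fun u hu => (hΛ.differentiableOn one_ne_zero).differentiableAt (hU.mem_nhds (hI hu)))
    (fun u hu => hC u (hI hu)) (convex_Icc _ _) ⟨by linarith, by linarith⟩
    ⟨by linarith, by linarith⟩
  simpa [Real.norm_eq_abs] using this

end CondKendall

/-! ### Assembly: union bound over the design points and Lasso rates. -/

theorem mainTheorem7 {p p' n' α s : ℕ} (hp : 0 < p) (hn' : 0 < n') (hα : 1 < α)
    (hs : 1 ≤ s) (hsp : s ≤ p')
    -- the compact set of covariate values, the kernel, the joint density of `(X, Z)`
    (𝒵 : Set (Cov p)) (h𝒵 : IsCompact 𝒵)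
    (K : Cov p → ℝ) (hK : IsKernelOfOrder K α)
    (f : ℝ × ℝ → Cov p → ℝ) (hf_meas : Measurable (Function.uncurry f))
    (hf_nonneg : ∀ x z, 0 ≤ f x z)
    (g : ℝ × ℝ → ℝ × ℝ → ℝ) (hg : g = g₁ ∨ g = g₂ ∨ g = g₃)
    -- assumptions on the densities
    (CKα : ℝ) (hCKα : 0 < CKα) (hf_marg : MarginalSmooth K (marginal f) 𝒵 α CKα)
    (fmin fmax : ℝ) (hfmin : 0 < fmin) (hfmin_le : ∀ z ∈ 𝒵, fmin ≤ marginal f z)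
    (hfmax : 0 < fmax) (hle_fmax : ∀ z, marginal f z ≤ fmax)
    (CXZ : ℝ) (hCXZ : 0 < CXZ) (hf_joint : JointSmooth K f 𝒵 α CXZ)
    -- the dictionary, the link function, the design points and the model
    (ψ : Fin p' → Cov p → ℝ) (Cψ : ℝ) (hCψ : 0 < Cψ) (hψ : ∀ j, ∀ z ∈ 𝒵, |ψ j z| ≤ Cψ)
    (Λ : ℝ → ℝ) (U : Set ℝ) (hU : IsOpen U) (hτU : tau f '' 𝒵 ⊆ U)
    (hΛ : ContDiffOn ℝ 1 Λ U)
    (CΛ : ℝ) (hCΛ : 0 < CΛ) (hΛ' : ∀ y ∈ U, |deriv Λ y| ≤ CΛ)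
    (z' : Fin n' → Cov p) (hz' : ∀ i, z' i ∈ 𝒵)
    (βs : Fin p' → ℝ) (hβs : {j | βs j ≠ 0}.ncard ≤ s)
    (hmodel : ∀ z ∈ 𝒵, Λ (tau f z) = ∑ j, ψ j z * βs j)
    -- the restricted eigenvalue condition
    (κ : ℝ) (hκ : κ = kappa (designMatrix ψ z') s 3) (hRE : 0 < κ)
    (ε : ℝ) (hε₀ : 0 < ε) (hε₁ : ε < 1)
    -- the tuning parameters and the requirement that `n` be sufficiently large
    (ch : ℝ) (hch : ch = cBand α fmin fmax Cψ CΛ CXZ)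
    (t h : ℕ → ℝ) (ht : t = tPar α p ε) (hh : h = hPar α p ch)
    (Large : ℕ → Prop)
    (hLarge : ∀ n, Large n ↔ BandwidthCond α fmin fmax Cψ CΛ CKα CXZ (h n) (t n) ∧ h n ≤ 1 ∧
      ∀ i, Set.Icc (tau f (z' i) - t n / (Cψ * CΛ)) (tau f (z' i) + t n / (Cψ * CΛ)) ⊆ U) :
    (∀ᶠ n in atTop, Large n) ∧
    Tendsto (probBound K n' α fmin fmax Cψ CΛ ch ε) atTop (𝓝 1) ∧
    ∀ n : ℕ, 2 ≤ n → Large n →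
      ∀ (Ω : Type*) [MeasurableSpace Ω] (P : Measure Ω) [IsProbabilityMeasure P]
        (X : Fin n → Ω → ℝ × ℝ) (Z : Fin n → Ω → Cov p) (_ : IsSample P f X Z)
        (βhat : Ω → Fin p' → ℝ) (_ : Measurable βhat)
        (_ : ∀ᵐ ω ∂P, IsLasso (designMatrix ψ z')
          (fun i => Λ (tauHat g K (h n) (fun k => X k ω) (fun k => Z k ω) (z' i)))
          (4 * t n) (βhat ω)),
        probBound K n' α fmin fmax Cψ CΛ ch ε n ≤
          P.real {ω |
            empNorm ((designMatrix ψ z').mulVec (βhat ω - βs)) ≤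
              20 * √(s : ℝ) / (κ * ((n : ℝ) - 1) ^ rateExp α p ε) ∧
            ∀ q : ℝ, 1 ≤ q → q ≤ 2 →
              lqNorm q (βhat ω - βs) ≤
                5 * (4 : ℝ) ^ (2 / q) * (s : ℝ) ^ (1 / q) /
                  (κ ^ 2 * ((n : ℝ) - 1) ^ rateExp α p ε)} := by
  have hα' : (1 : ℝ) < α := by exact_mod_cast hα
  have hchpos : 0 < ch := hch ▸ cBand_pos hfmin hfmax hCψ hCΛ hCXZ
  have htlim : Tendsto t atTop (𝓝 0) := ht ▸ tendsto_tPar hα hε₁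
  have hhlim : Tendsto h atTop (𝓝 0) := hh ▸ tendsto_hPar hα ch
  refine ⟨?_, tendsto_probBound hK hα n' hfmin hfmax hCψ hCΛ hchpos hε₀ hε₁, ?_⟩
  · have hUi : ∀ i, ∀ᶠ n in atTop, Set.Icc (tau f (z' i) - t n / (Cψ * CΛ))
        (tau f (z' i) + t n / (Cψ * CΛ)) ⊆ U := by
      intro i
      obtain ⟨r, hr, hrU⟩ := Metric.isOpen_iff.1 hU _ (hτU ⟨z' i, hz' i, rfl⟩)
      have hl : Tendsto (fun n => t n / (Cψ * CΛ)) atTop (𝓝 0) := by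
        simpa using htlim.div_const (Cψ * CΛ)
      filter_upwards [hl.eventually_lt_const hr] with n hn y hy
      refine hrU ?_
      rw [Metric.mem_ball, Real.dist_eq, abs_lt]
      constructor <;> linarith [hy.1, hy.2]
    have hb := eventually_bandwidthCond (p := p) hα hε₀ hfmin hfmax hCψ hCΛ hCKα hCXZ ch
    filter_upwards [hb, hhlim.eventually_le_const one_pos, eventually_all.2 hUi]
      with n h1 h2 h3
    rw [hLarge, hh, ht]
    rw [hh] at h2
    rw [ht] at h3
    exact ⟨h1, h2, h3⟩
  · intro n hn hLn Ω _ P _ X Z hXZ βhat _ hβ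
    obtain ⟨hband, hh1, hIU⟩ := (hLarge n).1 hLn
    have hN : (0 : ℝ) < (n : ℝ) - 1 := by
      have : (2 : ℝ) ≤ n := by exact_mod_cast hn
      linarith
    have hn'1 : (1 : ℝ) ≤ n' := by exact_mod_cast hn'
    have htn : 0 < t n := by rw [ht]; exact Real.rpow_pos_of_pos hN _
    have hhn : 0 < h n := by rw [hh]; exact mul_pos hchpos (Real.rpow_pos_of_pos hN _)
    rw [probBound_eq n' hα hn, ← hh, ← ht]
    set e₁ := Real.exp (-(C₁ K fmin fmax * (h n ^ p * ((n : ℝ) - 1)))) with he₁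
    set E₂ := h n ^ (2 * p) * ((n : ℝ) - 1) * t n ^ 2 /
        (C₂ K fmin fmax Cψ CΛ + C₃ K fmin fmax Cψ CΛ * t n) with hE₂
    have he₁pos : 0 < e₁ := Real.exp_pos _
    set S : Set Ω := {ω | empNorm ((designMatrix ψ z').mulVec (βhat ω - βs)) ≤
            20 * √(s : ℝ) / (κ * ((n : ℝ) - 1) ^ rateExp α p ε) ∧
          ∀ q : ℝ, 1 ≤ q → q ≤ 2 → lqNorm q (βhat ω - βs) ≤
            5 * (4 : ℝ) ^ (2 / q) * (s : ℝ) ^ (1 / q) /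
              (κ ^ 2 * ((n : ℝ) - 1) ^ rateExp α p ε)} with hS
    -- For `E₂ < 1/2` one has `exp (-E₂) ≥ 1/2`, so `2n' exp (-E₂) ≥ 1` and the claimed lower bound
    -- is negative.
    rcases lt_or_ge E₂ (1 / 2) with hsmall | hlarge
    · have h1 : 1 / 2 ≤ Real.exp (-E₂) := by
        have := Real.add_one_le_exp (-E₂)
        linarith
      have h2 : 0 ≤ P.real S := measureReal_nonneg
      nlinarith [mul_pos (lt_of_lt_of_le one_pos hn'1) he₁pos]
    · set B : Fin n' → Set Ω := fun i => {ω | t n / (Cψ * CΛ) <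
        |tauHat g K (h n) (fun k => X k ω) (fun k => Z k ω) (z' i) - tau f (z' i)|} with hB
      have hBi : ∀ i, P.real (B i) ≤ e₁ + 2 * Real.exp (-E₂) := fun i =>
        tauHat_tail_of_bandwidthCond hn hα hK hf_meas hf_nonneg hg hCKα hf_marg hfmin hfmin_le
          hfmax hle_fmax hCXZ hf_joint hXZ (hz' i) hhn hh1 htn hCψ hCΛ hband hlarge
      have hcover : ∀ᵐ ω ∂P, ω ∈ S ∪ ⋃ i, B i := by
        filter_upwards [hβ] with ω hω
        by_cases hbad : ω ∈ ⋃ i, B i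
        · exact Or.inr hbad
        refine Or.inl ?_
        have hgood : ∀ i, |tauHat g K (h n) (fun k => X k ω) (fun k => Z k ω) (z' i) -
            tau f (z' i)| ≤ t n / (Cψ * CΛ) := fun i =>
          not_lt.1 fun hlt => hbad (Set.mem_iUnion.2 ⟨i, hlt⟩)
        have hnoise : ∀ i, |Λ (tauHat g K (h n) (fun k => X k ω) (fun k => Z k ω) (z' i)) -
            (designMatrix ψ z').mulVec βs i| ≤ t n / Cψ := by
          intro i
          have hm : (designMatrix ψ z').mulVec βs i = Λ (tau f (z' i)) := by
            rw [hmodel _ (hz' i)]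
            rfl
          rw [hm]
          refine (abs_link_sub_le hU hΛ hΛ' (hIU i) (hgood i)).trans ?_
          calc _ ≤ CΛ * (t n / (Cψ * CΛ)) := mul_le_mul_of_nonneg_left (hgood i) hCΛ.le
            _ = t n / Cψ := by field_simp
        rw [hκ] at hRE
        obtain ⟨r1, r2⟩ := lasso_rates hn' hs (designMatrix ψ z') hCψ htn
          (fun i j => hψ j _ (hz' i)) hβs hnoise hRE hω
        have htinv : t n = (((n : ℝ) - 1) ^ rateExp α p ε)⁻¹ := by
          rw [ht, tPar, Real.rpow_neg hN.le]
        rw [← hκ, htinv] at r1 r2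
        refine ⟨r1.trans (le_of_eq ?_), fun q hq1 hq2 => (r2 q hq1 hq2).trans (le_of_eq ?_)⟩
        · rw [div_mul_eq_div_div, ← div_eq_mul_inv, div_right_comm]
        · rw [div_mul_eq_div_div, ← div_eq_mul_inv, div_right_comm]
      -- Only monotonicity and subadditivity of `P` are used, so the measurability of the sets plays
      -- no role.
      have h1 : P.real (S ∪ ⋃ i, B i) = 1 := by
        have : P (S ∪ ⋃ i, B i) = 1 := by
          refine le_antisymm prob_le_one ?_
          rw [← measure_univ (μ := P)]
          exact measure_mono_ae (hcover.mono fun ω hω _ => hω)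
        rw [measureReal_def, this, ENNReal.toReal_one]
      have h2 : P.real (⋃ i, B i) ≤ n' * (e₁ + 2 * Real.exp (-E₂)) := by
        refine (measureReal_iUnion_fintype_le B).trans ?_
        refine (Finset.sum_le_sum fun i _ => hBi i).trans (le_of_eq ?_)
        simp [mul_add]
      have h3 := measureReal_union_le (μ := P) S (⋃ i, B i)
      -- The union bound yields `n' e₁` where the claim allows `2 n' e₁`.
      nlinarith [mul_pos (lt_of_lt_of_le one_pos hn'1) he₁pos]
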